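/- **Model.** The half-space TASEP with entrance rate $\alpha\ge 0$ is the continuous-time Markov chain $(X_t)_{t\ge 0}$ on finite subsets of $\{1,2,3,\dots\}$ (the occupied sites) in which each particle at a site $s$ jumps to $s+1$ at rate $1$ if $s+1$ is empty, and a new particle enters at site $1$ at rate $\alpha$ whenever site $1$ is empty (no left jumps and no exits, i.e. $q=\gamma=0$). A configuration is written $x=(x_1,\dots,x_N)$ with $x_1>\dots>x_N\ge 1$, and $\mathbb P_t(y\to x)=\mathbb P(X_t=x\mid X_0=y)$. **Kernels.** Let $t\ge 0$. Let $R_1,R_2>\max(1,\alpha)$ with $|R_1-R_2|>1$ and let $r>1$; all contours are positively oriented circles centred at $0$. (Thus the contours of radius $R_1,R_2$ surround $0,1,\alpha,1-\alpha$, and $u+w\ne 1$ for $|w|=R_1$, $|u|=R_2$.) For $i,j\ge 1$ and $a,b\in\mathbb Z$ put $$Q_{i,j}(a,b)=\alpha^2\oint_{|u|=R_2}\frac{du}{2\pi \mathrm i}\oint_{|w|=R_1}\frac{dw}{2\pi \mathrm i}\,\frac{u-w}{1-u-w}\,\frac{w^{i-a}e^{t(w-1)}}{(w-\alpha)(w-1)^i}\,\frac{u^{j-b}e^{t(u-1)}}{(u-\alpha)(u-1)^j},$$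 $$p_i(a)=\alpha\oint_{|w|=R_1}\frac{dw}{2\pi \mathrm i}\,\frac{w^{i-a}e^{t(w-1)}}{(w-\alpha)(w-1)^i},$$ and, for integers $N\ge M\ge 0$ and $k,z\in\mathbb Z$, $$U_k(z)=\oint_{|w|=r}\frac{dw}{2\pi \mathrm i}\,\frac{(w-1)^{N-M-k}e^{t(w-1)}}{w^{z-k+N-M+1}}.$$ For a configuration $x=(x_1,\dots,x_N)$ and a configuration $y=(y_1,\dots,y_M)$ define, for $1\le i,j\le N$ and $1\le k\le M$, $$[\mathsf Q]_{i,j}=Q_{i,j}(x_{N-i+1},x_{N-j+1}),\qquad [\mathsf p]_i=p_i(x_{N-i+1}),\qquad [\mathsf U]_{i,k}=U_{i-k}(x_{N-i+1}-y_{M-k+1}).$$ The Pfaffian of a skew-symmetric $2n\times 2n$ matrix $A$ is $\operatorname{Pf}A=\frac1{2^n n!}\sum_{\sigma\in S_{2n}}\operatorname{sgn}(\sigma)\prod_{i=1}^n A_{\sigma(2i-1),\sigma(2i)}$ (equal to $1$ for $n=0$). **Theorem.** The matrix $\mathsf Q$ is skew-symmetric. Let $N\ge M\ge 0$, let $x$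 be a configuration of $N$ particles and $y$ one of $M$ particles, with $y_M>N-M+1$ if $M\ge 1$. Then, if $N+M$ is even, $$\mathbb P_t(y\to x)=(-1)^{\binom N2}e^{-\alpha t}\operatorname{Pf}\begin{bmatrix}\mathsf Q&\mathsf U\\-\mathsf U^T&0\end{bmatrix},$$ and, if $N+M$ is odd, $$\mathbb P_t(y\to x)=(-1)^{\binom N2}e^{-\alpha t}\operatorname{Pf}\begin{bmatrix}\mathsf Q&\mathsf p&\mathsf U\\-\mathsf p^T&0&0\\-\mathsf U^T&0&0\end{bmatrix}.$$ In particular, for $y=\emptyset$: $\mathbb P_t(\emptyset\to x)=(-1)^{\binom N2}e^{-\alpha t}\operatorname{Pf}[\mathsf Q]$ if $N$ is even, and $\mathbb P_t(\emptyset\to x)=(-1)^{\binom N2}e^{-\alpha t}\operatorname{Pf}\begin{bmatrix}\mathsf Q&\mathsf p\\-\mathsf p^T&0\end{bmatrix}$ if $N$ is odd. -/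

import Mathlib

namespace HalfTASEP

/-! ### The half-space TASEP and its transition probabilities -/

/-- Half-space configurations: finite sets of occupied sites in `{1, 2, 3, …}`. -/
abbrev Config : Type := Finset ℕ+

/-- The configuration obtained when the particle at site `s` jumps to site `s + 1`. -/
def hop (y : Config) (s : ℕ+) : Config := insert (s + 1) (y.erase s)

/-- `∑_{z ≠ y} (rate of the jump y → z) * f z`: a particle enters at site `1` at rate `α` if site `1`
is empty, and every particle with an empty site on its right jumps there at rate `1`.
The generator of the process is `(L f) y = jumpSum α f y - exitRate α y * f y`. -/
noncomputable def jumpSum (α : ℝ) (f : Config → ℝ) (y : Config) : ℝ :=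
  (if 1 ∈ y then 0 else α * f (insert 1 y)) + ∑ s ∈ y with s + 1 ∉ y, f (hop y s)

/-- The total rate at which the process leaves the configuration `y`. -/
noncomputable def exitRate (α : ℝ) (y : Config) : ℝ := jumpSum α (fun _ => 1) y

/-- `ℙ(X_t = x and the process has made exactly n jumps up to time t | X_0 = y)` for the
continuous-time jump Markov process with the above rates, by decomposition at the first jump:
the process waits at `y` for an exponential time of parameter `exitRate α y` and then jumps to
`z` with probability (rate of `y → z`) / `exitRate α y`. -/
noncomputable def jumpProb (α : ℝ) : ℕ → ℝ → Config → Config → ℝ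
  | 0, t, y, x => if y = x then Real.exp (-(exitRate α y * t)) else 0
  | n + 1, t, y, x => ∫ s in (0 : ℝ)..t,
      Real.exp (-(exitRate α y * s)) * jumpSum α (fun z => jumpProb α n (t - s) z x) y

/-- The transition probability `ℙ_t(y → x) = ℙ(X_t = x | X_0 = y)` of the half-space TASEP with
entrance rate `α` (the process makes finitely many jumps in finite time). -/
noncomputable def transProb (α t : ℝ) (y x : Config) : ℝ := ∑' n : ℕ, jumpProb α n t y x

/-- The configuration with (ordered) particle coordinates `x 0 > x 1 > ⋯`. -/
def ofCoords {N : ℕ} (x : Fin N → ℕ+) : Config := Finset.univ.image x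

/-! ### Pfaffians and block matrices -/

/-- The Pfaffian of an `m × m` matrix, for `m` even:
`1 / (2^n n!) * ∑_{σ ∈ S_{2n}} sgn σ ∏_{i=1}^{n} A_{σ(2i-1), σ(2i)}` with `n = m / 2`. -/
noncomputable def pfaffian {m : ℕ} (A : Matrix (Fin m) (Fin m) ℂ) : ℂ :=
  1 / ((2 : ℂ) ^ (m / 2) * ((m / 2).factorial : ℂ)) *
    ∑ σ : Equiv.Perm (Fin m), ((Equiv.Perm.sign σ : ℤ) : ℂ) *
      ∏ i : Fin (m / 2), A (σ ⟨2 * (i : ℕ), by omega⟩) (σ ⟨2 * (i : ℕ) + 1, by omega⟩)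

/-- The matrix `[[Q, U], [-Uᵀ, 0]]`. -/
def blockEven {N M : ℕ} (Q : Matrix (Fin N) (Fin N) ℂ) (U : Matrix (Fin N) (Fin M) ℂ) :
    Matrix (Fin (N + M)) (Fin (N + M)) ℂ :=
  Matrix.reindex finSumFinEquiv finSumFinEquiv (Matrix.fromBlocks Q U (-U.transpose) 0)

/-- The matrix `[[Q, p], [-pᵀ, 0]]`. -/
def blockBorder {N : ℕ} (Q : Matrix (Fin N) (Fin N) ℂ) (p : Fin N → ℂ) :
    Matrix (Fin (N + 1)) (Fin (N + 1)) ℂ :=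
  blockEven Q (Matrix.of fun i (_ : Fin 1) => p i)

/-- The matrix `[[Q, p, U], [-pᵀ, 0, 0], [-Uᵀ, 0, 0]]`. -/
def blockOdd {N M : ℕ} (Q : Matrix (Fin N) (Fin N) ℂ) (p : Fin N → ℂ)
    (U : Matrix (Fin N) (Fin M) ℂ) : Matrix (Fin (N + 1 + M)) (Fin (N + 1 + M)) ℂ :=
  blockEven (blockBorder Q p)
    (Matrix.of fun i k => Fin.lastCases (motive := fun _ => ℂ) 0 (fun i' => U i' k) i)

/-! ### The kernels -/

/-- `∮ dz / (2 π i) f z` over the positively oriented circle of radius `R` around the origin. -/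
noncomputable def contour (R : ℝ) (f : ℂ → ℂ) : ℂ :=
  (2 * (Real.pi : ℂ) * Complex.I)⁻¹ * ∮ z in C(0, R), f z

/-- `w^{i-x} e^{t(w-1)} / ((w-α) (w-1)^i)`. -/
noncomputable def weight (α t : ℝ) (i : ℕ) (x : ℤ) (w : ℂ) : ℂ :=
  w ^ ((i : ℤ) - x) * Complex.exp (t * (w - 1)) / ((w - α) * (w - 1) ^ i)

/-- The kernel `Q_{i,j}(x,y)`, with `w` on the circle of radius `R₁` and `u` on the circle of
radius `R₂`. -/
noncomputable def Qker (α t R₁ R₂ : ℝ) (i j : ℕ) (x y : ℤ) : ℂ :=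
  (α : ℂ) ^ 2 * contour R₂ fun u => contour R₁ fun w =>
    (u - w) / (1 - u - w) * weight α t i x w * weight α t j y u

/-- The kernel `p_i(x)`. -/
noncomputable def pker (α t R : ℝ) (i : ℕ) (x : ℤ) : ℂ :=
  (α : ℂ) * contour R fun w => weight α t i x w

/-- The kernel `U_k(z)`. -/
noncomputable def Uker (t r : ℝ) (N M : ℕ) (k z : ℤ) : ℂ :=
  contour r fun w => (w - 1) ^ ((N : ℤ) - M - k) * Complex.exp (t * (w - 1)) /
    w ^ (z - k + N - M + 1)

/-! In the matrices the index `i : Fin N` stands for `i + 1 ∈ {1, …, N}`, and `x i.rev` is the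
coordinate `x_{N-(i+1)+1}`. -/

/-- `[Q]_{i,j} = Q_{i,j}(x_{N-i+1}, x_{N-j+1})`. -/
noncomputable def Qmat (α t R₁ R₂ : ℝ) {N : ℕ} (x : Fin N → ℕ+) : Matrix (Fin N) (Fin N) ℂ :=
  Matrix.of fun i j => Qker α t R₁ R₂ (i + 1) (j + 1) (x i.rev : ℕ) (x j.rev : ℕ)

/-- `[p]_i = p_i(x_{N-i+1})`. -/
noncomputable def pvec (α t R : ℝ) {N : ℕ} (x : Fin N → ℕ+) : Fin N → ℂ :=
  fun i => pker α t R (i + 1) (x i.rev : ℕ)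

/-- `[U]_{i,k} = U_{i-k}(x_{N-i+1} - y_{M-k+1})`. -/
noncomputable def Umat (t r : ℝ) {N M : ℕ} (x : Fin N → ℕ+) (y : Fin M → ℕ+) :
    Matrix (Fin N) (Fin M) ℂ :=
  Matrix.of fun i k => Uker t r N M ((i : ℤ) - (k : ℤ))
    (((x i.rev : ℕ) : ℤ) - ((y k.rev : ℕ) : ℤ))

end HalfTASEP

/-!
The transition probabilities are determined by the forward equation: the number of particles plus
the sum of the sites grows with every jump, so that the equation at `x` is a linear ordinary
differential equation in `t` whose source involves only configurations of smaller height. It is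
therefore enough that the right-hand side solves the same equations.

Differentiating a row of the Pfaffian in `t` moves the particle of that row one step to the left, so
the Pfaffian, as a function of integer coordinates, solves the forward equation of particles that do
not interact. It takes the interaction into account through two boundary conditions. If the site to
the left of a particle is occupied, moving the particle there does not change the Pfaffian, because
the difference has two equal rows. If the leftmost particle is at `1`, moving it to `0` gives `α`
times the Pfaffian plus, up to sign, `α` times the Pfaffian with that row removed and the other
rows shifted: here the first row becomes orthogonal to all but one functional. At `t = 0` the form
vanishes on the rows, and the remaining block `U` is triangular.
-/

namespace HalfTASEP

/-! ### Pfaffians of alternating forms -/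

section Alternating

variable {R ι V W : Type*} [CommRing R] [AddCommGroup V] [Module R V] [AddCommGroup W] [Module R W]

lemma alternating_update_add_smul [DecidableEq ι] (f : V [⋀^ι]→ₗ[R] W) (v : ι → V) {i k : ι}
    (h : i ≠ k) (c : R) : f (Function.update v i (v i + c • v k)) = f v := by
  simp [AlternatingMap.map_update_add, AlternatingMap.map_update_smul,
    AlternatingMap.map_update_self _ _ h]

lemma alternating_add_smul [Finite ι] (f : V [⋀^ι]→ₗ[R] W) (v : ι → V) (k : ι) {c : ι → R}
    (hc : c k = 0) : f (fun i => v i + c i • v k) = f v := by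
  classical
  cases nonempty_fintype ι
  suffices ∀ s : Finset ι, f (s.piecewise (fun i => v i + c i • v k) v) = f v by
    simpa using this Finset.univ
  intro s
  induction s using Finset.induction_on with
  | empty => simp
  | insert i s his ih =>
    set w := s.piecewise (fun i => v i + c i • v k) v with hw
    have hi : w i = v i := by simp [hw, his]
    have hk : w k = v k := by simp [hw, Finset.piecewise, hc]
    rw [Finset.piecewise_insert, ← hw, ← ih, ← hi, ← hk]
    by_cases hik : i = k
    · rw [hik, hc, zero_smul, add_zero, Function.update_eq_self]
    · exact alternating_update_add_smul f w hik (c i)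

end Alternating

section Pfaffian

variable {V : Type*} [AddCommGroup V] [Module ℂ V] {n : ℕ}

/-- The first index of the pair `{2 i, 2 i + 1}`. -/
def evenIdx (i : Fin n) : Fin (2 * n) := ⟨2 * i, by omega⟩

/-- The second index of the pair `{2 i, 2 i + 1}`. -/
def oddIdx (i : Fin n) : Fin (2 * n) := ⟨2 * i + 1, by omega⟩

@[simp] lemma evenIdx_inj {i j : Fin n} : evenIdx i = evenIdx j ↔ i = j := by
  simp [evenIdx, Fin.ext_iff]

@[simp] lemma oddIdx_inj {i j : Fin n} : oddIdx i = oddIdx j ↔ i = j := by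
  simp [oddIdx, Fin.ext_iff]

@[simp] lemma evenIdx_ne_oddIdx (i j : Fin n) : evenIdx i ≠ oddIdx j := by
  simp only [evenIdx, oddIdx, ne_eq, Fin.ext_iff]; omega

@[simp] lemma oddIdx_ne_evenIdx (i j : Fin n) : oddIdx i ≠ evenIdx j :=
  (evenIdx_ne_oddIdx j i).symm

lemma exists_eq_evenIdx_or_oddIdx (k : Fin (2 * n)) : ∃ i, k = evenIdx i ∨ k = oddIdx i := by
  refine ⟨⟨k / 2, by omega⟩, ?_⟩
  simp only [evenIdx, oddIdx, Fin.ext_iff]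
  omega

lemma sum_evenIdx_add_oddIdx {M : Type*} [AddCommMonoid M] (f : Fin (2 * n) → M) :
    ∑ k, f k = ∑ i : Fin n, (f (evenIdx i) + f (oddIdx i)) := by
  rw [← Equiv.sum_comp (finProdFinEquiv.trans (finCongr (mul_comm n 2))), Fintype.sum_prod_type]
  refine Finset.sum_congr rfl fun i _ => ?_
  rw [Fin.sum_univ_two]
  congr 2 <;> ext <;> simp [evenIdx, oddIdx, add_comm]

lemma prod_pair_update_evenIdx (ω : V →ₗ[ℂ] V →ₗ[ℂ] ℂ) (v : Fin (2 * n) → V) (i : Fin n) (z : V) :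
    ∏ j, ω (Function.update v (evenIdx i) z (evenIdx j))
      (Function.update v (evenIdx i) z (oddIdx j)) =
    ω z (v (oddIdx i)) * ∏ j ∈ Finset.univ.erase i, ω (v (evenIdx j)) (v (oddIdx j)) := by
  rw [← Finset.mul_prod_erase _ _ (Finset.mem_univ i)]
  simp only [Function.update_self, Function.update_of_ne (oddIdx_ne_evenIdx _ _)]
  congr 1
  refine Finset.prod_congr rfl fun j hj => ?_
  rw [Function.update_of_ne (by simpa using Finset.ne_of_mem_erase hj)]

lemma prod_pair_update_oddIdx (ω : V →ₗ[ℂ] V →ₗ[ℂ] ℂ) (v : Fin (2 * n) → V) (i : Fin n) (z : V) :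
    ∏ j, ω (Function.update v (oddIdx i) z (evenIdx j))
      (Function.update v (oddIdx i) z (oddIdx j)) =
    ω (v (evenIdx i)) z * ∏ j ∈ Finset.univ.erase i, ω (v (evenIdx j)) (v (oddIdx j)) := by
  rw [← Finset.mul_prod_erase _ _ (Finset.mem_univ i)]
  simp only [Function.update_self, Function.update_of_ne (evenIdx_ne_oddIdx _ _)]
  congr 1
  refine Finset.prod_congr rfl fun j hj => ?_
  rw [Function.update_of_ne (by simpa using Finset.ne_of_mem_erase hj)]

/-- The multilinear map `v ↦ ∏ i, ω (v (2 i)) (v (2 i + 1))` whose alternatization is, up to a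
constant, the Pfaffian. -/
noncomputable def pairProd (ω : V →ₗ[ℂ] V →ₗ[ℂ] ℂ) (n : ℕ) :
    MultilinearMap ℂ (fun _ : Fin (2 * n) => V) ℂ :=
  MultilinearMap.mk' (fun v => ∏ i : Fin n, ω (v (evenIdx i)) (v (oddIdx i)))
    (fun v k x y => by
      obtain ⟨i, rfl | rfl⟩ := exists_eq_evenIdx_or_oddIdx k <;>
        simp only [prod_pair_update_evenIdx, prod_pair_update_oddIdx, map_add,
          LinearMap.add_apply, add_mul])
    (fun v k c x => by
      obtain ⟨i, rfl | rfl⟩ := exists_eq_evenIdx_or_oddIdx k <;>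
        simp only [prod_pair_update_evenIdx, prod_pair_update_oddIdx, map_smul,
          LinearMap.smul_apply, smul_mul_assoc])

lemma pairProd_apply (ω : V →ₗ[ℂ] V →ₗ[ℂ] ℂ) (v : Fin (2 * n) → V) :
    pairProd ω n v = ∏ i, ω (v (evenIdx i)) (v (oddIdx i)) := rfl

lemma hasDerivAt_pairProd {ω : V →ₗ[ℂ] V →ₗ[ℂ] ℂ} {v : ℝ → Fin (2 * n) → V} {D : Fin (2 * n) → V}
    {t : ℝ} (h : ∀ j k, HasDerivAt (fun s => ω (v s j) (v s k))
      (ω (D j) (v t k) + ω (v t j) (D k)) t) :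
    HasDerivAt (fun s => pairProd ω n (v s))
      (∑ k, pairProd ω n (Function.update (v t) k (D k))) t := by
  simp only [pairProd_apply, sum_evenIdx_add_oddIdx, prod_pair_update_evenIdx,
    prod_pair_update_oddIdx]
  refine (HasDerivAt.fun_finsetProd (u := Finset.univ) fun (i : Fin n) _ =>
    h (evenIdx i) (oddIdx i)).congr_deriv (Finset.sum_congr rfl fun i _ => ?_)
  rw [smul_eq_mul]
  ring

/-- The alternating form `v ↦ Pf (ω (v i) (v j))`. -/
noncomputable def pfForm (ω : V →ₗ[ℂ] V →ₗ[ℂ] ℂ) (n : ℕ) : V [⋀^Fin (2 * n)]→ₗ[ℂ] ℂ :=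
  (1 / ((2 : ℂ) ^ n * (n.factorial : ℂ))) • MultilinearMap.alternatization (pairProd ω n)

/-- The summand of the Pfaffian of `ω (v i) (v j)` at the permutation `σ`. -/
noncomputable def pfTerm (ω : V →ₗ[ℂ] V →ₗ[ℂ] ℂ) (v : Fin (2 * n) → V)
    (σ : Equiv.Perm (Fin (2 * n))) : ℂ :=
  ((Equiv.Perm.sign σ : ℤ) : ℂ) * pairProd ω n (v ∘ σ)

lemma pfForm_apply (ω : V →ₗ[ℂ] V →ₗ[ℂ] ℂ) (v : Fin (2 * n) → V) :
    pfForm ω n v = 1 / ((2 : ℂ) ^ n * (n.factorial : ℂ)) * ∑ σ, pfTerm ω v σ := by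
  simp [pfForm, pfTerm, MultilinearMap.alternatization_apply, Units.smul_def, Function.comp_def]

lemma hasDerivAt_pfForm {ω : V →ₗ[ℂ] V →ₗ[ℂ] ℂ} {v : ℝ → Fin (2 * n) → V} {D : Fin (2 * n) → V}
    {t : ℝ} (h : ∀ j k, HasDerivAt (fun s => ω (v s j) (v s k))
      (ω (D j) (v t k) + ω (v t j) (D k)) t) :
    HasDerivAt (fun s => pfForm ω n (v s))
      (∑ k, pfForm ω n (Function.update (v t) k (D k))) t := by
  have hterm (σ : Equiv.Perm (Fin (2 * n))) : HasDerivAt (fun s => pfTerm ω (v s) σ)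
      (∑ k, pfTerm ω (Function.update (v t) k (D k)) σ) t := by
    refine ((hasDerivAt_pairProd (D := D ∘ σ) (v := fun s => v s ∘ σ)
      fun j k => h (σ j) (σ k)).const_mul _).congr_deriv ?_
    rw [Finset.mul_sum]
    exact Fintype.sum_equiv σ _ _ fun k => by simp [pfTerm, Function.update_comp_equiv]
  simp only [pfForm_apply, ← Finset.mul_sum]
  rw [Finset.sum_comm]
  exact (HasDerivAt.fun_sum fun σ _ => hterm σ).const_mul _

lemma pfForm_congr {V' : Type*} [AddCommGroup V'] [Module ℂ V'] {ω : V →ₗ[ℂ] V →ₗ[ℂ] ℂ}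
    {ω' : V' →ₗ[ℂ] V' →ₗ[ℂ] ℂ} (hω : ω.IsAlt) (hω' : ω'.IsAlt) {v : Fin (2 * n) → V}
    {v' : Fin (2 * n) → V'} (h : ∀ i j, i < j → ω (v i) (v j) = ω' (v' i) (v' j)) :
    pfForm ω n v = pfForm ω' n v' := by
  have hgram (i j) : ω (v i) (v j) = ω' (v' i) (v' j) := by
    obtain hij | rfl | hij := lt_trichotomy i j
    · exact h i j hij
    · rw [hω, hω']
    · rw [← hω.neg, ← hω'.neg, h j i hij]
  simp only [pfForm_apply, pfTerm, pairProd_apply, Function.comp_apply, hgram]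

/-- The permutation exchanging the pairs `{2 i, 2 i + 1}` and `{2 j, 2 j + 1}`. -/
def pairSwap (i j : Fin n) : Equiv.Perm (Fin (2 * n)) :=
  Equiv.swap (evenIdx i) (evenIdx j) * Equiv.swap (oddIdx i) (oddIdx j)

lemma pairSwap_evenIdx (i j l : Fin n) :
    pairSwap i j (evenIdx l) = evenIdx (Equiv.swap i j l) := by
  simp only [pairSwap, Equiv.Perm.mul_apply, Equiv.swap_apply_def, evenIdx_ne_oddIdx, evenIdx_inj,
    if_false]
  split_ifs <;> rfl

lemma pairSwap_oddIdx (i j l : Fin n) :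
    pairSwap i j (oddIdx l) = oddIdx (Equiv.swap i j l) := by
  simp only [pairSwap, Equiv.Perm.mul_apply, Equiv.swap_apply_def, oddIdx_inj]
  split_ifs <;> simp_all

lemma sign_pairSwap (i j : Fin n) : Equiv.Perm.sign (pairSwap i j) = 1 := by
  by_cases h : i = j <;> simp [pairSwap, Equiv.Perm.sign_swap', h]

lemma pfTerm_mul_pairSwap (ω : V →ₗ[ℂ] V →ₗ[ℂ] ℂ) (v : Fin (2 * n) → V)
    (σ : Equiv.Perm (Fin (2 * n))) (i j : Fin n) :
    pfTerm ω v (σ * pairSwap i j) = pfTerm ω v σ := by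
  simp only [pfTerm, map_mul, sign_pairSwap, mul_one, pairProd_apply, Function.comp_apply,
    Equiv.Perm.mul_apply, pairSwap_evenIdx, pairSwap_oddIdx]
  congr 1
  exact Equiv.prod_comp (Equiv.swap i j) fun l => ω (v (σ (evenIdx l))) (v (σ (oddIdx l)))

lemma pfTerm_mul_swap {ω : V →ₗ[ℂ] V →ₗ[ℂ] ℂ} (hω : ω.IsAlt) (v : Fin (2 * n) → V)
    (σ : Equiv.Perm (Fin (2 * n))) (i : Fin n) :
    pfTerm ω v (σ * Equiv.swap (evenIdx i) (oddIdx i)) = pfTerm ω v σ := by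
  have hprod : ∏ j ∈ Finset.univ.erase i,
      ω (v (σ (Equiv.swap (evenIdx i) (oddIdx i) (evenIdx j))))
        (v (σ (Equiv.swap (evenIdx i) (oddIdx i) (oddIdx j)))) =
      ∏ j ∈ Finset.univ.erase i, ω (v (σ (evenIdx j))) (v (σ (oddIdx j))) := by
    refine Finset.prod_congr rfl fun j hj => ?_
    have hji := Finset.ne_of_mem_erase hj
    rw [Equiv.swap_apply_of_ne_of_ne (by simpa) (by simp),
      Equiv.swap_apply_of_ne_of_ne (by simp) (by simpa)]
  simp only [pfTerm, map_mul, Equiv.Perm.sign_swap (evenIdx_ne_oddIdx i i), pairProd_apply,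
    Function.comp_apply, Equiv.Perm.mul_apply]
  rw [← Finset.mul_prod_erase _ _ (Finset.mem_univ i), hprod,
    ← Finset.mul_prod_erase _ _ (Finset.mem_univ i), Equiv.swap_apply_left,
    Equiv.swap_apply_right, ← hω.neg]
  push_cast
  ring

lemma exists_perm_pfTerm_mul_eq {ω : V →ₗ[ℂ] V →ₗ[ℂ] ℂ} (hω : ω.IsAlt)
    (v : Fin (2 * n) → V) (i : Fin n) (k : Fin (2 * n)) :
    ∃ τ : Equiv.Perm (Fin (2 * n)), τ (evenIdx i) = k ∧
      ∀ σ, pfTerm ω v (σ * τ) = pfTerm ω v σ := by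
  obtain ⟨j, rfl | rfl⟩ := exists_eq_evenIdx_or_oddIdx k
  · exact ⟨pairSwap i j, by simp [pairSwap_evenIdx], fun σ => pfTerm_mul_pairSwap ω v σ i j⟩
  · refine ⟨pairSwap i j * Equiv.swap (evenIdx i) (oddIdx i), by simp [pairSwap_oddIdx],
      fun σ => ?_⟩
    rw [← mul_assoc, pfTerm_mul_swap hω, pfTerm_mul_pairSwap]

lemma sum_perm_eq_card_mul_sum_fix {ι R : Type*} [Fintype ι] [DecidableEq ι] [Semiring R]
    (T : Equiv.Perm ι → R) (a : ι)
    (h : ∀ k, ∃ τ : Equiv.Perm ι, τ a = k ∧ ∀ σ, T (σ * τ) = T σ) :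
    ∑ σ, T σ = Fintype.card ι * ∑ σ, if σ a = a then T σ else 0 := by
  calc ∑ σ, T σ = ∑ σ : Equiv.Perm ι, ∑ k, if σ k = a then T σ else 0 := by
        simp only [← Equiv.eq_symm_apply, Finset.sum_ite_eq', Finset.mem_univ, if_true]
    _ = ∑ k, ∑ σ : Equiv.Perm ι, if σ k = a then T σ else 0 := Finset.sum_comm
    _ = ∑ _k : ι, ∑ σ : Equiv.Perm ι, if σ a = a then T σ else 0 := by
        refine Finset.sum_congr rfl fun k _ => ?_
        obtain ⟨τ, hτ, hT⟩ := h k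
        refine Fintype.sum_equiv (Equiv.mulRight τ) _ _ fun σ => ?_
        simp [hτ, hT]
    _ = _ := by simp

lemma sum_perm_fix_fix {R : Type*} [AddCommMonoid R] {m : ℕ} (T : Equiv.Perm (Fin (m + 2)) → R)
    (hT : ∀ σ, σ 0 = 0 → σ 1 ≠ 1 → T σ = 0) :
    (∑ σ : Equiv.Perm (Fin (m + 2)), if σ 0 = 0 then T σ else 0) =
      ∑ e : Equiv.Perm (Fin m),
        T (Equiv.Perm.decomposeFin.symm (0, Equiv.Perm.decomposeFin.symm (0, e))) := by
  rw [← Equiv.sum_comp Equiv.Perm.decomposeFin.symm, Fintype.sum_prod_type,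
    Finset.sum_eq_single 0 (fun p _ hp => by simp [hp]) (by simp),
    ← Equiv.sum_comp Equiv.Perm.decomposeFin.symm, Fintype.sum_prod_type,
    Finset.sum_eq_single 0 _ (by simp)]
  · simp
  · refine fun p _ hp => Finset.sum_eq_zero fun e _ => ?_
    rw [if_pos (by simp)]
    refine hT _ (by simp) ?_
    rw [Equiv.Perm.decomposeFin_symm_apply_one, Equiv.swap_self,
      Equiv.Perm.decomposeFin_symm_apply_zero, Equiv.refl_apply, ← Fin.succ_zero_eq_one]
    exact fun h => hp (Fin.succ_injective _ h)

/-- `Pf (ω (u i) (u j))` for the first `2 n` terms of a sequence `u`. -/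
noncomputable def pfSeq (ω : V →ₗ[ℂ] V →ₗ[ℂ] ℂ) (n : ℕ) (u : ℕ → V) : ℂ :=
  pfForm ω n fun i => u i

lemma pfaffian_eq_pfSeq (ω : V →ₗ[ℂ] V →ₗ[ℂ] ℂ) {m : ℕ} (h : m = 2 * n)
    (A : Matrix (Fin m) (Fin m) ℂ) (u : ℕ → V) (hA : ∀ i j, A i j = ω (u i) (u j)) :
    pfaffian A = pfSeq ω n u := by
  subst h
  have hn : 2 * n / 2 = n := by omega
  simp only [pfSeq, pfForm_apply, pfaffian, hn, hA, pfTerm, pairProd_apply]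
  congr! 3
  exact Fintype.prod_equiv (finCongr hn) _ _ fun i => by simp [evenIdx, oddIdx]

lemma pfSeq_zero (ω : V →ₗ[ℂ] V →ₗ[ℂ] ℂ) (u : ℕ → V) : pfSeq ω 0 u = 1 := by
  have : Subsingleton (Equiv.Perm (Fin (2 * 0))) :=
    inferInstanceAs (Subsingleton (Equiv.Perm (Fin 0)))
  rw [pfSeq, pfForm_apply, Fintype.sum_eq_single 1 fun σ hσ => absurd (Subsingleton.elim σ 1) hσ,
    pfTerm, pairProd_apply]
  simp

lemma pfSeq_congr {V' : Type*} [AddCommGroup V'] [Module ℂ V'] {ω : V →ₗ[ℂ] V →ₗ[ℂ] ℂ}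
    {ω' : V' →ₗ[ℂ] V' →ₗ[ℂ] ℂ} (hω : ω.IsAlt) (hω' : ω'.IsAlt) {u : ℕ → V} {u' : ℕ → V'}
    (h : ∀ i j, i < j → j < 2 * n → ω (u i) (u j) = ω' (u' i) (u' j)) :
    pfSeq ω n u = pfSeq ω' n u' :=
  pfForm_congr hω hω' fun i j hij => h i j hij j.2

lemma pfSeq_congr_seq (ω : V →ₗ[ℂ] V →ₗ[ℂ] ℂ) {u u' : ℕ → V} (h : ∀ i < 2 * n, u i = u' i) :
    pfSeq ω n u = pfSeq ω n u' :=
  congrArg (pfForm ω n) (funext fun i => h i i.2)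

lemma pfSeq_update (ω : V →ₗ[ℂ] V →ₗ[ℂ] ℂ) (u : ℕ → V) {k : ℕ} (hk : k < 2 * n) (x : V) :
    pfSeq ω n (Function.update u k x) =
      pfForm ω n (Function.update (fun i : Fin (2 * n) => u i) ⟨k, hk⟩ x) :=
  congrArg _ (Function.update_comp_eq_of_injective u Fin.val_injective ⟨k, hk⟩ x)

lemma pfSeq_update_add (ω : V →ₗ[ℂ] V →ₗ[ℂ] ℂ) (u : ℕ → V) {k : ℕ} (hk : k < 2 * n) (x y : V) :
    pfSeq ω n (Function.update u k (x + y)) =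
      pfSeq ω n (Function.update u k x) + pfSeq ω n (Function.update u k y) := by
  simp only [pfSeq_update _ _ hk, AlternatingMap.map_update_add]

lemma pfSeq_update_smul (ω : V →ₗ[ℂ] V →ₗ[ℂ] ℂ) (u : ℕ → V) {k : ℕ} (hk : k < 2 * n) (c : ℂ)
    (x : V) : pfSeq ω n (Function.update u k (c • x)) = c * pfSeq ω n (Function.update u k x) := by
  simp only [pfSeq_update _ _ hk, AlternatingMap.map_update_smul, smul_eq_mul]

lemma pfSeq_eq_zero_of_eq (ω : V →ₗ[ℂ] V →ₗ[ℂ] ℂ) {u : ℕ → V} {i j : ℕ} (hij : i ≠ j)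
    (hi : i < 2 * n) (hj : j < 2 * n) (h : u i = u j) : pfSeq ω n u = 0 :=
  AlternatingMap.map_eq_zero_of_eq _ _ (i := ⟨i, hi⟩) (j := ⟨j, hj⟩) h (by simpa using hij)

lemma pfSeq_add_smul (ω : V →ₗ[ℂ] V →ₗ[ℂ] ℂ) {k : ℕ} (hk : k < 2 * n) (u : ℕ → V) {c : ℕ → ℂ}
    (hc : c k = 0) : pfSeq ω n (fun i => u i + c i • u k) = pfSeq ω n u :=
  alternating_add_smul (pfForm ω n) (fun i => u i) ⟨k, hk⟩ (c := fun i => c i) hc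

lemma hasDerivAt_pfSeq {ω : V →ₗ[ℂ] V →ₗ[ℂ] ℂ} {u : ℝ → ℕ → V} {D : ℕ → V} {t : ℝ}
    (h : ∀ j < 2 * n, ∀ k < 2 * n, HasDerivAt (fun s => ω (u s j) (u s k))
      (ω (D j) (u t k) + ω (u t j) (D k)) t) :
    HasDerivAt (fun s => pfSeq ω n (u s))
      (∑ j ∈ Finset.range (2 * n), pfSeq ω n (Function.update (u t) j (D j))) t := by
  rw [Finset.sum_range]
  simp only [pfSeq_update _ _ (Fin.is_lt _)]
  exact hasDerivAt_pfForm (D := fun j => D j) fun j k => h j j.2 k k.2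

lemma pfSeq_eq_zero_of_row {ω : V →ₗ[ℂ] V →ₗ[ℂ] ℂ} (hω : ω.IsAlt) {u : ℕ → V} {k : ℕ}
    (hk : k < 2 * n) (h : ∀ j < 2 * n, j ≠ k → ω (u k) (u j) = 0) : pfSeq ω n u = 0 := by
  have hzero : pfSeq ω n u = pfSeq ω n (Function.update u k ((0 : ℂ) • (0 : V))) := by
    refine pfSeq_congr hω hω fun i j hij hj => ?_
    by_cases hi : i = k
    · simp [hi, h j hj (by omega)]
    · by_cases hjk : j = k
      · rw [hjk, ← hω.neg, h i (by omega) hi]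
        simp
      · rw [Function.update_of_ne hi, Function.update_of_ne hjk]
  rw [hzero, pfSeq_update_smul _ _ hk, zero_mul]

lemma pfSeq_eq_zero_of_isotropic (ω : V →ₗ[ℂ] V →ₗ[ℂ] ℂ) (u : ℕ → V) (Z : Finset (Fin (2 * n)))
    (hZ : n < Z.card) (h : ∀ i ∈ Z, ∀ j ∈ Z, ω (u i) (u j) = 0) : pfSeq ω n u = 0 := by
  rw [pfSeq, pfForm_apply, Finset.sum_eq_zero, mul_zero]
  intro σ _
  choose pair hpair using exists_eq_evenIdx_or_oddIdx (n := n)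
  obtain ⟨a, ha, b, hb, hab, hf⟩ := Finset.exists_ne_map_eq_of_card_lt_of_maps_to
    (s := Z.map σ.symm.toEmbedding) (t := Finset.univ) (f := pair) (by simpa using hZ)
    (by simp)
  rw [Finset.mem_map_equiv, Equiv.symm_symm] at ha hb
  have hmem : σ (evenIdx (pair a)) ∈ Z ∧ σ (oddIdx (pair a)) ∈ Z := by
    have hb' := hpair b
    rw [← hf] at hb'
    grind
  rw [pfTerm, pairProd_apply, Finset.prod_eq_zero (Finset.mem_univ (pair a)), mul_zero]
  exact h _ hmem.1 _ hmem.2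

lemma pfTerm_eq_zero_of_orthogonal {ω : V →ₗ[ℂ] V →ₗ[ℂ] ℂ} {v : Fin (2 * n) → V} {i : Fin n}
    (h : ∀ k, k ≠ evenIdx i → k ≠ oddIdx i → ω (v (evenIdx i)) (v k) = 0)
    {σ : Equiv.Perm (Fin (2 * n))} (h0 : σ (evenIdx i) = evenIdx i)
    (h1 : σ (oddIdx i) ≠ oddIdx i) : pfTerm ω v σ = 0 := by
  rw [pfTerm, pairProd_apply, Finset.prod_eq_zero (Finset.mem_univ i), mul_zero]
  rw [Function.comp_apply, h0]
  refine h _ (fun e => ?_) h1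
  exact oddIdx_ne_evenIdx i i (σ.injective (e.trans h0.symm))

lemma pfTerm_succ (ω : V →ₗ[ℂ] V →ₗ[ℂ] ℂ) (u : ℕ → V) (e : Equiv.Perm (Fin (2 * n))) :
    pfTerm (n := n + 1) ω (fun i => u i)
      (Equiv.Perm.decomposeFin.symm (0, Equiv.Perm.decomposeFin.symm (0, e)) :
        Equiv.Perm (Fin (2 * n + 2))) = ω (u 0) (u 1) * pfTerm ω (fun i => u (i + 2)) e := by
  set σ : Equiv.Perm (Fin (2 * n + 2)) :=
    Equiv.Perm.decomposeFin.symm (0, Equiv.Perm.decomposeFin.symm (0, e)) with hσ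
  have hsign : Equiv.Perm.sign σ = Equiv.Perm.sign e := by
    simp [hσ, Equiv.Perm.decomposeFin.symm_sign]
  calc _ = ((Equiv.Perm.sign σ : ℤ) : ℂ) *
        pairProd ω (n + 1) ((fun i : Fin (2 * n + 2) => u i) ∘ σ) := rfl
    _ = _ := by
      rw [hsign, pairProd_apply, Fin.prod_univ_succ, mul_left_comm]
      rfl

lemma pfSeq_succ {ω : V →ₗ[ℂ] V →ₗ[ℂ] ℂ} (hω : ω.IsAlt) (u : ℕ → V)
    (h : ∀ i, 2 ≤ i → i < 2 * (n + 1) → ω (u 0) (u i) = 0) :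
    pfSeq ω (n + 1) u = ω (u 0) (u 1) * pfSeq ω n fun i => u (i + 2) := by
  have hsum : ∑ σ, pfTerm (n := n + 1) ω (fun i => u i) σ = (2 * n + 2 : ℂ) * (ω (u 0) (u 1) *
      ∑ e : Equiv.Perm (Fin (2 * n)), pfTerm ω (fun i => u (i + 2)) e) := by
    refine (sum_perm_eq_card_mul_sum_fix _ (evenIdx 0) fun k =>
      exists_perm_pfTerm_mul_eq hω _ 0 k).trans ?_
    congr 1
    · simp [mul_add]
    refine (sum_perm_fix_fix (m := 2 * n) (pfTerm (n := n + 1) ω fun i => u i)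
      fun σ h0 h1 => pfTerm_eq_zero_of_orthogonal (i := 0) (fun k hk0 hk1 => ?_) h0 h1).trans ?_
    · refine h k ?_ k.2
      rw [ne_eq, Fin.ext_iff] at hk0 hk1
      simp only [evenIdx, oddIdx, Fin.val_zero] at hk0 hk1
      omega
    · simp only [pfTerm_succ, Finset.mul_sum]
  have hn : (n : ℂ) + 1 ≠ 0 := by exact_mod_cast Nat.succ_ne_zero n
  have hfact : (n.factorial : ℂ) ≠ 0 := by exact_mod_cast n.factorial_ne_zero
  rw [pfSeq, pfSeq, pfForm_apply, pfForm_apply, hsum, Nat.factorial_succ, pow_succ]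
  push_cast
  field_simp

/-- The sequence `a, u 0, u 1, …`. -/
def consSeq {X : Type*} (a : X) (u : ℕ → X) : ℕ → X
  | 0 => a
  | k + 1 => u k

/-- The sequence `u` without its term of index `k`. -/
def eraseTerm {X : Type*} (k : ℕ) (u : ℕ → X) : ℕ → X := fun i => if i < k then u i else u (i + 1)

lemma pfSeq_cons_eraseTerm (ω : V →ₗ[ℂ] V →ₗ[ℂ] ℂ) (u : ℕ → V) {k : ℕ} (hk : k < 2 * n) :
    pfSeq ω n (consSeq (u k) (eraseTerm k u)) = (-1) ^ k * pfSeq ω n u := by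
  set κ : Fin (2 * n) := ⟨k, hk⟩ with hκ
  have hcons : (fun i : Fin (2 * n) => consSeq (u k) (eraseTerm k u) i) =
      (fun i : Fin (2 * n) => u i) ∘ κ.cycleRange.symm := by
    rw [← Equiv.comp_symm_eq, Equiv.symm_symm]
    funext i
    have : NeZero (2 * n) := ⟨by omega⟩
    obtain hi | rfl | hi := lt_trichotomy i κ
    · simp [consSeq, eraseTerm, Fin.coe_cycleRange_of_lt hi, show (i : ℕ) < k from hi]
    · simp [consSeq, hκ]
    · obtain ⟨j, hj⟩ : ∃ j, (i : ℕ) = j + 1 := ⟨i - 1, by have := Fin.lt_def.1 hi; omega⟩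
      have hkj : ¬ j < k := by have := Fin.lt_def.1 hi; simp only [hκ] at this; omega
      simp [consSeq, eraseTerm, Fin.cycleRange_of_gt hi, hj, hkj]
  rw [pfSeq, hcons, AlternatingMap.map_perm]
  simp [pfSeq, hκ, Units.smul_def]

lemma pfSeq_eq_cons_eraseTerm (ω : V →ₗ[ℂ] V →ₗ[ℂ] ℂ) (u : ℕ → V) {k : ℕ} (hk : k < 2 * n) :
    pfSeq ω n u = (-1) ^ k * pfSeq ω n (consSeq (u k) (eraseTerm k u)) := by
  rw [pfSeq_cons_eraseTerm ω u hk, ← mul_assoc, ← mul_pow, neg_one_mul, neg_neg, one_pow, one_mul]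

lemma eraseTerm_succ_consSeq {X : Type*} (k : ℕ) (a : X) (u : ℕ → X) :
    eraseTerm (k + 1) (consSeq a u) = consSeq a (eraseTerm k u) := by
  funext i
  cases i <;> simp [eraseTerm, consSeq]

lemma eraseTerm_zero_consSeq {X : Type*} (a : X) (u : ℕ → X) : eraseTerm 0 (consSeq a u) = u := by
  funext i
  simp [eraseTerm, consSeq]

lemma pfSeq_cons_cons_comm (ω : V →ₗ[ℂ] V →ₗ[ℂ] ℂ) (hn : 0 < n) (a b : V) (u : ℕ → V) :
    pfSeq ω n (consSeq a (consSeq b u)) = -pfSeq ω n (consSeq b (consSeq a u)) := by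
  rw [pfSeq_eq_cons_eraseTerm ω (k := 1) _ (by omega), eraseTerm_succ_consSeq,
    eraseTerm_zero_consSeq, pow_one, neg_one_mul]
  rfl

lemma pfSeq_cons_smul (ω : V →ₗ[ℂ] V →ₗ[ℂ] ℂ) (hn : 0 < n) (c : ℂ) (a : V) (u : ℕ → V) :
    pfSeq ω n (consSeq (c • a) u) = c * pfSeq ω n (consSeq a u) := by
  have hcons (x : V) : consSeq x u = Function.update (consSeq a u) 0 x := by
    funext i
    cases i <;> simp [consSeq]
  rw [hcons (c • a), pfSeq_update_smul ω _ (by omega), ← hcons]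

lemma pfSeq_cons_add_smul (ω : V →ₗ[ℂ] V →ₗ[ℂ] ℂ) (hn : 0 < n) (a : V) (u : ℕ → V) (c : ℕ → ℂ) :
    pfSeq ω n (consSeq a fun i => u i + c i • a) = pfSeq ω n (consSeq a u) := by
  rw [← pfSeq_add_smul ω (k := 0) (by omega) (consSeq a u) (c := consSeq 0 c) rfl]
  congr 1
  funext i
  cases i <;> simp [consSeq]

end Pfaffian

/-! ### Pfaffians bordered by linear functionals -/

section Bordered

variable {F : Type*} [AddCommGroup F] [Module ℂ F] {B : F →ₗ[ℂ] F →ₗ[ℂ] ℂ} {n N M : ℕ}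

/-- The form `((f, φ), (g, ψ)) ↦ B f g + ψ f - φ g` on `F × F*`. With it the block matrix
`[[B (f i) (f j), φ k (f i)], [-φ k (f i), 0]]` becomes a Gram matrix. -/
noncomputable def extForm (B : F →ₗ[ℂ] F →ₗ[ℂ] ℂ) :
    (F × Module.Dual ℂ F) →ₗ[ℂ] (F × Module.Dual ℂ F) →ₗ[ℂ] ℂ :=
  LinearMap.mk₂ ℂ (fun x y => B x.1 y.1 + y.2 x.1 - x.2 y.1)
    (fun x x' y => by
      simp only [Prod.fst_add, Prod.snd_add, map_add, LinearMap.add_apply]; ring)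
    (fun c x y => by
      simp only [Prod.smul_fst, Prod.smul_snd, map_smul, LinearMap.smul_apply, smul_eq_mul]; ring)
    (fun x y y' => by
      simp only [Prod.fst_add, Prod.snd_add, map_add, LinearMap.add_apply]; ring)
    (fun c x y => by
      simp only [Prod.smul_fst, Prod.smul_snd, map_smul, LinearMap.smul_apply, smul_eq_mul]; ring)

lemma extForm_apply (B : F →ₗ[ℂ] F →ₗ[ℂ] ℂ) (x y : F × Module.Dual ℂ F) :
    extForm B x y = B x.1 y.1 + y.2 x.1 - x.2 y.1 := rfl

lemma extForm_isAlt (hB : B.IsAlt) : (extForm B).IsAlt := fun x => by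
  rw [extForm_apply, hB, zero_add, sub_self]

/-- The sequence `f 0, …, f (N - 1), φ 0, φ 1, …` in `F × F*`. -/
def rowSeq (N : ℕ) (f : ℕ → F) (φ : ℕ → Module.Dual ℂ F) : ℕ → F × Module.Dual ℂ F :=
  fun i => if i < N then (f i, 0) else (0, φ (i - N))

lemma rowSeq_of_lt {i : ℕ} (f : ℕ → F) (φ : ℕ → Module.Dual ℂ F) (h : i < N) :
    rowSeq N f φ i = (f i, 0) := if_pos h

lemma rowSeq_of_ge {i : ℕ} (f : ℕ → F) (φ : ℕ → Module.Dual ℂ F) (h : N ≤ i) :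
    rowSeq N f φ i = (0, φ (i - N)) := if_neg h.not_gt

lemma rowSeq_succ_consSeq (h : F) (g : ℕ → F) (φ : ℕ → Module.Dual ℂ F) :
    rowSeq (N + 1) (consSeq h g) φ = consSeq (h, 0) (rowSeq N g φ) := by
  funext i
  cases i <;> simp [rowSeq, consSeq]

lemma eraseTerm_rowSeq_consSeq (f : ℕ → F) (ψ : Module.Dual ℂ F) (φ : ℕ → Module.Dual ℂ F) :
    eraseTerm N (rowSeq N f (consSeq ψ φ)) = rowSeq N f φ := by
  funext i
  by_cases hi : i < N
  · simp [eraseTerm, rowSeq, hi]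
  · simp [eraseTerm, rowSeq, hi, show ¬ i + 1 < N by omega, Nat.sub_add_comm (not_lt.1 hi), consSeq]

lemma eraseTerm_rowSeq_succ (f : ℕ → F) (φ : ℕ → Module.Dual ℂ F) :
    eraseTerm N (rowSeq (N + 1) f φ) = rowSeq N f φ := by
  funext i
  by_cases hi : i < N
  · simp [eraseTerm, rowSeq, hi, hi.trans (Nat.lt_succ_self N)]
  · simp [eraseTerm, rowSeq, hi]

/-- The Pfaffian of the `2 n × 2 n` block matrix with entries `B (f i) (f j)` for `i, j < N`,
`φ k (f i)` in the border, and `0` elsewhere. -/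
noncomputable def pfRow (B : F →ₗ[ℂ] F →ₗ[ℂ] ℂ) (n N : ℕ) (f : ℕ → F)
    (φ : ℕ → Module.Dual ℂ F) : ℂ := pfSeq (extForm B) n (rowSeq N f φ)

lemma pfRow_cons_eq_of_shift (hB : B.IsAlt) (hn : 2 * n = N + 1 + M) {h : F} {g g' : ℕ → F}
    {P : Module.Dual ℂ F} {φ φ' : ℕ → Module.Dual ℂ F} {c : ℂ}
    (hgh : ∀ i < N, B (g i) h = c ^ 2 * P (g' i))
    (hgg : ∀ i < N, ∀ j < N, B (g i) (g j) =
      B (g' i) (g' j) - c ^ 2 * (P (g i) * P (g' j) - P (g' i) * P (g j)))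
    (hφ : ∀ k < M, ∀ i < N, φ k (g i) = φ' k (g' i)) (hφh : ∀ k < M, φ k h = 0) :
    pfRow B n (N + 1) (consSeq h g) φ = (-1) ^ N * c * pfRow B n N g' (consSeq (c • P) φ') := by
  have hω := extForm_isAlt hB
  have hright : (-1) ^ N * c * pfRow B n N g' (consSeq (c • P) φ') =
      pfSeq (extForm B) n (consSeq (0, c ^ 2 • P) (rowSeq N g' φ')) := by
    have hfront : rowSeq N g' (consSeq (c • P) φ') N = (0, c • P) := by simp [rowSeq, consSeq]
    rw [show ((0 : F), c ^ 2 • P) = c • (0, c • P) by simp [smul_smul, sq],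
      pfSeq_cons_smul _ (by omega), ← hfront, ← eraseTerm_rowSeq_consSeq g' (c • P) φ',
      pfSeq_cons_eraseTerm _ _ (by omega), pfRow]
    ring
  rw [hright, pfRow, rowSeq_succ_consSeq,
    ← pfSeq_cons_add_smul _ (by omega) _ _ fun i => if i < N then -P (g i) else 0]
  refine pfSeq_congr hω hω fun i j hij hj => ?_
  obtain ⟨j, rfl⟩ : ∃ j', j = j' + 1 := ⟨j - 1, by omega⟩
  obtain _ | i := i
  · by_cases hjN : j < N
    · simp [consSeq, extForm_apply, rowSeq, hjN, hB h, ← hB.neg (g j) h, hgh j hjN]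
    · simp [consSeq, extForm_apply, rowSeq, hjN, hφh (j - N) (by omega)]
  · by_cases hiN : i < N
    · by_cases hjN : j < N
      · simp only [consSeq, rowSeq, hiN, hjN, ↓reduceIte, neg_smul, Prod.smul_mk, smul_zero,
          Prod.neg_mk, neg_zero, Prod.mk_add_mk, add_zero, extForm_apply, map_add, map_neg,
          map_smul, LinearMap.add_apply, LinearMap.neg_apply, LinearMap.smul_apply, smul_eq_mul,
          hgg i hiN j hjN, hgh i hiN, ← hB.neg (g j) h, hgh j hjN, hB h, mul_zero, mul_neg,
          neg_neg, LinearMap.zero_apply, sub_zero]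
        ring
      · simp [consSeq, extForm_apply, rowSeq, hiN, hjN, hφh (j - N) (by omega),
          hφ (j - N) (by omega) i hiN]
    · simp [consSeq, extForm_apply, rowSeq, hiN, show ¬ j < N by omega]

lemma pfRow_cons_consSeq (hn : 0 < n) (hN : N + 1 < 2 * n) (h : F) (g : ℕ → F)
    (ψ : Module.Dual ℂ F) (φ : ℕ → Module.Dual ℂ F) :
    pfRow B n (N + 1) (consSeq h g) (consSeq ψ φ) =
      (-1) ^ N * pfSeq (extForm B) n (consSeq (h, 0) (consSeq (0, ψ) (rowSeq N g φ))) := by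
  have hψ : rowSeq (N + 1) (consSeq h g) (consSeq ψ φ) (N + 1) = (0, ψ) := by
    simp [rowSeq, consSeq]
  rw [pfRow, pfSeq_eq_cons_eraseTerm _ _ hN, hψ, eraseTerm_rowSeq_consSeq, rowSeq_succ_consSeq,
    pfSeq_cons_cons_comm _ hn]
  ring

lemma pfRow_cons_cons_eq_of_shift (hB : B.IsAlt) (hn : 2 * n = N + M) {h : F} {g g' : ℕ → F}
    {P : Module.Dual ℂ F} {φ φ' : ℕ → Module.Dual ℂ F} {c : ℂ}
    (hgh : ∀ i < N, B (g i) h = c ^ 2 * P (g' i))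
    (hgg : ∀ i < N, ∀ j < N, B (g i) (g j) =
      B (g' i) (g' j) - c ^ 2 * (P (g i) * P (g' j) - P (g' i) * P (g j)))
    (hφ : ∀ k < M, ∀ i < N, φ k (g i) = φ' k (g' i)) (hφh : ∀ k < M, φ k h = 0)
    (hPh : P h = 1) :
    pfRow B (n + 1) (N + 1) (consSeq h g) (consSeq (c • P) φ) =
      (-1) ^ N * c * pfRow B n N g' φ' := by
  have hω := extForm_isAlt hB
  -- The multiples of `(0, c • P)` make all rows but that one orthogonal to `(h, 0)`.
  rw [pfRow_cons_consSeq (by omega) (by omega), ← pfSeq_add_smul _ (k := 1) (by omega) _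
      (c := consSeq 0 (consSeq 0 fun i => if i < N then c * P (g' i) else 0)) rfl,
    pfSeq_succ hω, mul_assoc]
  · congr 2
    · simp [consSeq, extForm_apply, hPh]
    · refine pfSeq_congr hω hω fun i j hij hj => ?_
      by_cases hiN : i < N
      · by_cases hjN : j < N
        · simp only [consSeq, rowSeq, hiN, hjN, ↓reduceIte, Prod.smul_mk, smul_zero,
            Prod.mk_add_mk, add_zero, zero_add, extForm_apply, hgg i hiN j hjN,
            LinearMap.smul_apply, smul_eq_mul, LinearMap.zero_apply, sub_zero]
          ring
        · simp [consSeq, extForm_apply, rowSeq, hiN, hjN, hφ (j - N) (by omega) i hiN]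
      · simp [consSeq, extForm_apply, rowSeq, hiN, show ¬ j < N by omega]
  · intro i hi hi'
    obtain ⟨k, rfl⟩ : ∃ k, i = k + 2 := ⟨i - 2, by omega⟩
    by_cases hk : k < N
    · simp only [consSeq, rowSeq, hk, ↓reduceIte, zero_smul, Prod.smul_mk, smul_zero,
        Prod.mk_add_mk, add_zero, zero_add, extForm_apply, ← hB.neg (g k) h, hgh k hk, hPh,
        LinearMap.smul_apply, smul_eq_mul, mul_one, LinearMap.zero_apply, sub_zero]
      ring
    · simp [consSeq, extForm_apply, rowSeq, hk, hφh (k - N) (by omega)]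

lemma pfRow_succ_of_isotropic (hB : B.IsAlt) {f : ℕ → F} {φ : ℕ → Module.Dual ℂ F}
    (hf : ∀ i < N, B (f N) (f i) = 0) (hφ : ∀ k < N, φ k (f N) = 0) :
    pfRow B (N + 1) (N + 1) f φ = (-1) ^ N * φ N (f N) * pfRow B N N f φ := by
  have hω := extForm_isAlt hB
  have hfN : rowSeq (N + 1) f φ N = (f N, 0) := rowSeq_of_lt f φ (Nat.lt_succ_self N)
  have hφN : consSeq (f N, 0) (rowSeq N f φ) (2 * N + 1) = (0, φ N) := by
    simp [consSeq, rowSeq, show ¬ 2 * N < N by omega, show 2 * N - N = N by omega]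
  rw [pfRow, pfSeq_eq_cons_eraseTerm _ _ (k := N) (by omega), hfN, eraseTerm_rowSeq_succ,
    pfSeq_eq_cons_eraseTerm _ _ (k := 2 * N + 1) (by omega), hφN, eraseTerm_succ_consSeq,
    pfSeq_cons_cons_comm _ (by omega), pfSeq_succ hω, pow_succ, pow_mul, neg_one_sq, one_pow,
    one_mul, mul_neg, neg_mul, one_mul, neg_neg, mul_assoc]
  · congr 2
    · simp [consSeq, extForm_apply]
    · exact pfSeq_congr_seq _ fun i hi => by simp [consSeq, eraseTerm, hi]
  · intro i hi hi'
    obtain ⟨k, rfl⟩ : ∃ k, i = k + 2 := ⟨i - 2, by omega⟩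
    have hk2 : k < 2 * N := by omega
    by_cases hk : k < N
    · simp [consSeq, eraseTerm, hk2, rowSeq, hk, extForm_apply, hf k hk]
    · simp [consSeq, eraseTerm, hk2, rowSeq, hk, extForm_apply, hφ (k - N) (by omega)]

end Bordered

/-! ### The forward equation -/

/-- The configuration obtained when the particle at site `s + 1` moves back to `s`. -/
def hopBack (x : Config) (s : ℕ+) : Config := insert s (x.erase (s + 1))

/-- `∑_{z ≠ x} f z * (rate of the jump z → x)`, the adjoint of `jumpSum`; the sum is over the sites
`s` which are empty in `x` while `s + 1` is occupied. -/
noncomputable def predSum (α : ℝ) (f : Config → ℝ) (x : Config) : ℝ :=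
  (if 1 ∈ x then α * f (x.erase 1) else 0) +
    ∑ s ∈ x.image (fun s => s - 1) with s + 1 ∈ x ∧ s ∉ x, f (hopBack x s)

lemma jumpSum_add (α : ℝ) (f g : Config → ℝ) (y : Config) :
    jumpSum α (fun z => f z + g z) y = jumpSum α f y + jumpSum α g y := by
  unfold jumpSum
  rw [Finset.sum_add_distrib]
  split_ifs <;> ring

lemma jumpSum_mul_left (α c : ℝ) (f : Config → ℝ) (y : Config) :
    jumpSum α (fun z => c * f z) y = c * jumpSum α f y := by
  unfold jumpSum
  rw [mul_add, Finset.mul_sum]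
  split_ifs <;> ring

lemma jumpSum_sub (α : ℝ) (f g : Config → ℝ) (y : Config) :
    jumpSum α (fun z => f z - g z) y = jumpSum α f y - jumpSum α g y := by
  unfold jumpSum
  rw [Finset.sum_sub_distrib]
  split_ifs <;> ring

lemma predSum_sub (α : ℝ) (f g : Config → ℝ) (y : Config) :
    predSum α (fun z => f z - g z) y = predSum α f y - predSum α g y := by
  unfold predSum
  rw [Finset.sum_sub_distrib]
  split_ifs <;> ring

lemma predSum_mul_left (α c : ℝ) (f : Config → ℝ) (y : Config) :
    predSum α (fun z => c * f z) y = c * predSum α f y := by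
  unfold predSum
  rw [mul_add, Finset.mul_sum]
  split_ifs <;> ring

lemma jumpSum_sum (α : ℝ) {ι : Type*} (S : Finset ι) (f : ι → Config → ℝ) (y : Config) :
    jumpSum α (fun z => ∑ i ∈ S, f i z) y = ∑ i ∈ S, jumpSum α (f i) y := by
  classical
  induction S using Finset.induction_on with
  | empty => simp [jumpSum]
  | insert a S ha ih => simp only [Finset.sum_insert ha, jumpSum_add, ih]

lemma jumpSum_predSum_comm (α : ℝ) (f : Config → Config → ℝ) (y x : Config) :
    jumpSum α (fun z => predSum α (f z) x) y =
      predSum α (fun w => jumpSum α (fun z => f z w) y) x := by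
  unfold predSum
  rw [jumpSum_add, jumpSum_sum]
  congr 1
  split_ifs
  · rw [jumpSum_mul_left]
  · simp [jumpSum]

lemma hasDerivAt_jumpSum {α : ℝ} {f : ℝ → Config → ℝ} {f' : Config → ℝ} {t : ℝ}
    (h : ∀ z, HasDerivAt (fun s => f s z) (f' z) t) (y : Config) :
    HasDerivAt (fun s => jumpSum α (f s) y) (jumpSum α f' y) t := by
  unfold jumpSum
  refine HasDerivAt.add ?_ (HasDerivAt.fun_sum fun s _ => h _)
  split_ifs
  · exact hasDerivAt_const _ _
  · exact (h _).const_mul _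

lemma hasDerivAt_predSum {α : ℝ} {f : ℝ → Config → ℝ} {f' : Config → ℝ} {t : ℝ}
    (h : ∀ z, HasDerivAt (fun s => f s z) (f' z) t) (y : Config) :
    HasDerivAt (fun s => predSum α (f s) y) (predSum α f' y) t := by
  unfold predSum
  refine HasDerivAt.add ?_ (HasDerivAt.fun_sum fun s _ => h _)
  split_ifs
  · exact (h _).const_mul _
  · exact hasDerivAt_const _ _

lemma eq_hopBack_iff {x y : Config} {s : ℕ+} :
    (s ∈ y ∧ s + 1 ∉ y ∧ hop y s = x) ↔ (s + 1 ∈ x ∧ s ∉ x ∧ y = hopBack x s) := by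
  have hs : s ≠ s + 1 := (PNat.lt_add_right s 1).ne
  constructor
  · rintro ⟨h1, h2, rfl⟩
    refine ⟨by simp [hop], by simp [hop, hs], ?_⟩
    ext a
    simp only [hopBack, hop, Finset.mem_insert, Finset.mem_erase]
    by_cases ha : a = s
    · subst ha; simp [h1]
    · by_cases hb : a = s + 1
      · subst hb; simp [h2, hs.symm]
      · simp [ha, hb]
  · rintro ⟨h1, h2, rfl⟩
    refine ⟨by simp [hopBack], by simp [hopBack, hs.symm], ?_⟩
    ext a
    simp only [hopBack, hop, Finset.mem_insert, Finset.mem_erase]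
    by_cases ha : a = s + 1
    · subst ha; simp [h1]
    · by_cases hb : a = s
      · subst hb; simp [h2, ha]
      · simp [ha, hb]

lemma entrance_single (α : ℝ) (c : Config → ℝ) (y x : Config) :
    (if 1 ∈ y then 0 else α * if insert 1 y = x then c (insert 1 y) else 0) =
      c x * if 1 ∈ x then α * (if y = x.erase 1 then 1 else 0) else 0 := by
  by_cases hy : (1 : ℕ+) ∈ y
  · have hne : y ≠ x.erase 1 := by rintro rfl; simp at hy
    simp [hy, hne]
  by_cases hx : insert 1 y = x
  · subst hx
    simp [hy, mul_comm]
  · have hne : 1 ∈ x → y ≠ x.erase 1 := fun h1 h => hx (by rw [h, Finset.insert_erase h1])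
    simp +contextual [hy, hx, hne]

lemma sum_hop_single (c : Config → ℝ) (y x : Config) :
    ∑ s ∈ y with s + 1 ∉ y, (if hop y s = x then c (hop y s) else 0) =
      c x * ∑ s ∈ x.image (fun s => s - 1) with s + 1 ∈ x ∧ s ∉ x,
        if y = hopBack x s then 1 else 0 := by
  calc
    _ = ∑ s ∈ y with s + 1 ∉ y, if hop y s = x then c x else 0 :=
      Finset.sum_congr rfl fun s _ => by split_ifs with h <;> simp [h]
    _ = ∑ s ∈ x.image (fun s => s - 1) with s + 1 ∈ x ∧ s ∉ x,
        if y = hopBack x s then c x else 0 := by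
      rw [← Finset.sum_filter, ← Finset.sum_filter, Finset.filter_filter, Finset.filter_filter]
      refine Finset.sum_congr ?_ fun _ _ => rfl
      ext s
      simp only [Finset.mem_filter, Finset.mem_image, and_assoc]
      rw [eq_hopBack_iff]
      exact ⟨fun h => ⟨⟨s + 1, h.1, PNat.add_sub⟩, h⟩, fun h => h.2⟩
    _ = _ := by simp only [Finset.mul_sum, mul_ite, mul_one, mul_zero]

lemma jumpSum_single (α : ℝ) (c : Config → ℝ) (y x : Config) :
    jumpSum α (fun z => if z = x then c z else 0) y =
      c x * predSum α (fun z => if y = z then 1 else 0) x := by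
  unfold jumpSum predSum
  rw [mul_add, entrance_single, sum_hop_single]

lemma hasDerivAt_exp_neg_mul (c t : ℝ) :
    HasDerivAt (fun s => Real.exp (-(c * s))) (-(c * Real.exp (-(c * t)))) t := by
  have h : HasDerivAt (fun s => -(c * s)) (-c) t := by
    simpa using ((hasDerivAt_id t).const_mul c).fun_neg
  exact h.exp.congr_deriv (by ring)

lemma hasDerivAt_jumpProb_zero (α t : ℝ) (y x : Config) :
    HasDerivAt (fun s => jumpProb α 0 s y x) (-(exitRate α y * jumpProb α 0 t y x)) t := by
  simp only [jumpProb]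
  split_ifs
  · exact hasDerivAt_exp_neg_mul _ _
  · simpa using hasDerivAt_const t (0 : ℝ)

lemma jumpProb_succ_eq (α : ℝ) (n : ℕ) (t : ℝ) (y x : Config) :
    jumpProb α (n + 1) t y x = Real.exp (-(exitRate α y * t)) *
      ∫ s in (0 : ℝ)..t, Real.exp (exitRate α y * s) *
        jumpSum α (fun z => jumpProb α n s z x) y := by
  have h := intervalIntegral.integral_comp_sub_left (a := 0) (b := t)
    (fun s => Real.exp (-(exitRate α y * (t - s))) * jumpSum α (fun z => jumpProb α n s z x) y) t
  simp only [sub_sub_cancel, sub_zero, sub_self] at h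
  rw [jumpProb, h, ← intervalIntegral.integral_const_mul]
  congr 1
  funext s
  rw [← mul_assoc, ← Real.exp_add]
  congr 2
  ring

lemma hasDerivAt_jumpProb_succ_of_continuous {α : ℝ} {n : ℕ} {x : Config}
    (hc : ∀ z, Continuous fun s => jumpProb α n s z x) (t : ℝ) (y : Config) :
    HasDerivAt (fun s => jumpProb α (n + 1) s y x)
      (jumpSum α (fun z => jumpProb α n t z x) y - exitRate α y * jumpProb α (n + 1) t y x) t := by
  have hJ : Continuous fun s => Real.exp (exitRate α y * s) *
      jumpSum α (fun z => jumpProb α n s z x) y := by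
    refine (by fun_prop : Continuous fun s => Real.exp (exitRate α y * s)).mul ?_
    unfold jumpSum
    refine Continuous.add ?_ (continuous_finsetSum _ fun s _ => hc _)
    split_ifs
    · exact continuous_const
    · exact (hc _).const_mul _
  simp only [jumpProb_succ_eq α n]
  have h1 := intervalIntegral.integral_hasDerivAt_right (hJ.intervalIntegrable 0 t)
    hJ.stronglyMeasurable.stronglyMeasurableAtFilter hJ.continuousAt
  refine ((hasDerivAt_exp_neg_mul (exitRate α y) t).mul h1).congr_deriv ?_
  have : Real.exp (-(exitRate α y * t)) * Real.exp (exitRate α y * t) = 1 := by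
    rw [← Real.exp_add]; simp
  linear_combination jumpSum α (fun z => jumpProb α n t z x) y * this

lemma continuous_jumpProb (α : ℝ) : ∀ (n : ℕ) (y x : Config),
    Continuous fun s => jumpProb α n s y x
  | 0, y, x => continuous_iff_continuousAt.2 fun t =>
    (hasDerivAt_jumpProb_zero α t y x).continuousAt
  | n + 1, y, x => continuous_iff_continuousAt.2 fun t =>
    (hasDerivAt_jumpProb_succ_of_continuous (fun z => continuous_jumpProb α n z x) t y).continuousAt

lemma hasDerivAt_jumpProb_succ (α : ℝ) (n : ℕ) (t : ℝ) (y x : Config) :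
    HasDerivAt (fun s => jumpProb α (n + 1) s y x)
      (jumpSum α (fun z => jumpProb α n t z x) y - exitRate α y * jumpProb α (n + 1) t y x) t :=
  hasDerivAt_jumpProb_succ_of_continuous (fun z => continuous_jumpProb α n z x) t y

lemma jumpProb_succ_zero (α : ℝ) (n : ℕ) (y x : Config) : jumpProb α (n + 1) 0 y x = 0 := by
  simp [jumpProb]

lemma eq_zero_of_hasDerivAt_smul {E : Type*} [NormedAddCommGroup E] [NormedSpace ℝ E] {f : ℝ → E}
    {c : ℝ} (h : ∀ t, HasDerivAt f (c • f t) t) (h0 : f 0 = 0) (t : ℝ) : f t = 0 := by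
  have h1 : ∀ s, HasDerivAt (fun s => Real.exp (-(c * s)) • f s) 0 s := by
    intro s
    refine ((hasDerivAt_exp_neg_mul c s).fun_smul (h s)).congr_deriv ?_
    module
  have h2 := is_const_of_deriv_eq_zero (fun s => (h1 s).differentiableAt)
    (fun s => (h1 s).deriv) t 0
  simp only [h0, smul_zero] at h2
  exact (smul_eq_zero.1 h2).resolve_left (Real.exp_pos _).ne'

lemma sub_eq_sub_of_hasDerivAt {c d : ℝ} {f g h k : ℝ → ℝ}
    (hf : ∀ t, HasDerivAt f (g t - c * f t) t) (hg : ∀ t, HasDerivAt g (k t - d * g t) t)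
    (hh : ∀ t, HasDerivAt h (k t - c * h t) t) (h0 : g 0 - c * f 0 = h 0 - d * f 0) (t : ℝ) :
    g t - c * f t = h t - d * f t := by
  refine sub_eq_zero.1 (eq_zero_of_hasDerivAt_smul (c := -c)
    (f := fun t => g t - c * f t - (h t - d * f t)) (fun s => ?_) (sub_eq_zero.2 h0) t)
  refine (((hg s).sub ((hf s).const_mul c)).sub ((hh s).sub ((hf s).const_mul d))).congr_deriv ?_
  rw [smul_eq_mul]
  ring

lemma jumpProb_forward (α : ℝ) : ∀ (n : ℕ) (t : ℝ) (y x : Config),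
    jumpSum α (fun z => jumpProb α n t z x) y - exitRate α y * jumpProb α (n + 1) t y x =
      predSum α (fun z => jumpProb α n t y z) x - exitRate α x * jumpProb α (n + 1) t y x
  | 0, t, y, x => by
    set r := predSum α (fun z => if y = z then 1 else 0) x with hr
    have hJ : ∀ t, jumpSum α (fun z => jumpProb α 0 t z x) y =
        Real.exp (-(exitRate α x * t)) * r :=
      fun t => jumpSum_single α (fun z => Real.exp (-(exitRate α z * t))) y x
    have hP : ∀ t, predSum α (fun z => jumpProb α 0 t y z) x =
        Real.exp (-(exitRate α y * t)) * r := by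
      intro t
      rw [hr, ← predSum_mul_left]
      simp [jumpProb]
    have hexp : ∀ c s : ℝ, HasDerivAt (fun s => Real.exp (-(c * s)) * r)
        (0 - c * (Real.exp (-(c * s)) * r)) s :=
      fun c s => ((hasDerivAt_exp_neg_mul c s).mul_const r).congr_deriv (by ring)
    refine sub_eq_sub_of_hasDerivAt (h := fun s => predSum α (fun z => jumpProb α 0 s y z) x)
      (k := fun _ => 0) (fun s => hasDerivAt_jumpProb_succ α 0 s y x)
      (fun s => ?_) (fun s => ?_) ?_ t
    · simpa only [hJ] using hexp _ s
    · simpa only [hP] using hexp _ s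
    · simp [hJ, hP, jumpProb_succ_zero α 0]
  | n + 1, t, y, x => by
    refine sub_eq_sub_of_hasDerivAt
      (h := fun s => predSum α (fun z => jumpProb α (n + 1) s y z) x)
      (k := fun s => predSum α (fun w => jumpSum α (fun z => jumpProb α n s z w) y) x)
      (fun s => hasDerivAt_jumpProb_succ α (n + 1) s y x) (fun s => ?_) (fun s => ?_) ?_ t
    · refine (hasDerivAt_jumpSum (fun z => (hasDerivAt_jumpProb_succ α n s z x).congr_deriv
        (jumpProb_forward α n s z x)) y).congr_deriv ?_
      rw [jumpSum_sub, jumpSum_mul_left, jumpSum_predSum_comm]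
    · refine (hasDerivAt_predSum (fun z => hasDerivAt_jumpProb_succ α n s y z) x).congr_deriv ?_
      rw [predSum_sub, predSum_mul_left]
    · simp [jumpProb_succ_zero, jumpSum, predSum]

/-- The sum of the particle positions. -/
def height (x : Config) : ℕ := ∑ s ∈ x, (s : ℕ)

lemma height_hop {y : Config} {s : ℕ+} (hs : s ∈ y) (hs' : s + 1 ∉ y) :
    height (hop y s) = height y + 1 := by
  unfold height hop
  rw [Finset.sum_insert (by simp [hs']), ← Finset.add_sum_erase y _ hs]
  push_cast
  ring

lemma height_insert_one {y : Config} (h : 1 ∉ y) : height (insert 1 y) = height y + 1 := by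
  unfold height
  rw [Finset.sum_insert h, PNat.one_coe, add_comm]

lemma jumpSum_eq_zero {α : ℝ} {f : Config → ℝ} {y : Config}
    (h1 : 1 ∉ y → f (insert 1 y) = 0) (h2 : ∀ s ∈ y, s + 1 ∉ y → f (hop y s) = 0) :
    jumpSum α f y = 0 := by
  unfold jumpSum
  rw [Finset.sum_eq_zero fun s hs => h2 s (Finset.mem_filter.1 hs).1 (Finset.mem_filter.1 hs).2]
  split_ifs with h
  · simp
  · simp [h1 h]

lemma jumpProb_eq_zero_of_height (α : ℝ) : ∀ (n : ℕ) (t : ℝ) (y x : Config),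
    height x ≠ height y + n → jumpProb α n t y x = 0
  | 0, t, y, x, h => by
    rw [jumpProb, if_neg]
    rintro rfl
    exact h rfl
  | n + 1, t, y, x, h => by
    have : ∀ s, jumpSum α (fun z => jumpProb α n (t - s) z x) y = 0 := fun s =>
      jumpSum_eq_zero
        (fun h1 => jumpProb_eq_zero_of_height α n _ _ _ (by rw [height_insert_one h1]; omega))
        (fun a ha ha' => jumpProb_eq_zero_of_height α n _ _ _ (by rw [height_hop ha ha']; omega))
    simp [jumpProb, this]

lemma card_hop {y : Config} {s : ℕ+} (hs : s ∈ y) (hs' : s + 1 ∉ y) :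
    (hop y s).card = y.card := by
  unfold hop
  rw [Finset.card_insert_of_notMem (by simp [hs']), Finset.card_erase_add_one hs]

lemma jumpProb_eq_zero_of_card (α : ℝ) : ∀ (n : ℕ) (t : ℝ) (y x : Config),
    x.card < y.card → jumpProb α n t y x = 0
  | 0, t, y, x, h => by
    rw [jumpProb, if_neg]
    rintro rfl
    exact absurd h (lt_irrefl _)
  | n + 1, t, y, x, h => by
    have : ∀ s, jumpSum α (fun z => jumpProb α n (t - s) z x) y = 0 := fun s =>
      jumpSum_eq_zero
        (fun h1 => jumpProb_eq_zero_of_card α n _ _ _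
          (by rw [Finset.card_insert_of_notMem h1]; omega))
        (fun a ha ha' => jumpProb_eq_zero_of_card α n _ _ _ (by rw [card_hop ha ha']; omega))
    simp [jumpProb, this]

lemma transProb_eq_jumpProb {α t : ℝ} {n : ℕ} {y x : Config} (h : height x = height y + n) :
    transProb α t y x = jumpProb α n t y x :=
  tsum_eq_single n fun m hm => jumpProb_eq_zero_of_height α m t y x (by omega)

lemma transProb_eq_zero_of_height {α t : ℝ} {y x : Config} (h : height x < height y) :
    transProb α t y x = 0 := by
  unfold transProb
  simp [fun n => jumpProb_eq_zero_of_height α n t y x (by omega)]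

lemma transProb_eq_zero_of_card {α t : ℝ} {y x : Config} (h : x.card < y.card) :
    transProb α t y x = 0 := by
  unfold transProb
  simp [fun n => jumpProb_eq_zero_of_card α n t y x h]

lemma transProb_zero (α : ℝ) (y x : Config) : transProb α 0 y x = if y = x then 1 else 0 := by
  unfold transProb
  rw [tsum_eq_single 0]
  · simp [jumpProb]
  · intro n hn
    obtain ⟨m, rfl⟩ := Nat.exists_eq_succ_of_ne_zero hn
    exact jumpProb_succ_zero α m y x

lemma height_hopBack {x : Config} {s : ℕ+} (hs : s + 1 ∈ x) (hs' : s ∉ x) :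
    height (hopBack x s) + 1 = height x := by
  unfold height hopBack
  rw [Finset.sum_insert (by simp [hs']), ← Finset.add_sum_erase x _ hs]
  push_cast
  ring

lemma height_erase_one {x : Config} (h : 1 ∈ x) : height (x.erase 1) + 1 = height x := by
  unfold height
  rw [← Finset.sum_erase_add x _ h, PNat.one_coe]

lemma predSum_congr {α : ℝ} {f g : Config → ℝ} {x : Config}
    (h : ∀ z, height z + 1 = height x → f z = g z) : predSum α f x = predSum α g x := by
  unfold predSum
  congr 1
  · split_ifs with h1
    · rw [h _ (height_erase_one h1)]
    · rfl
  · refine Finset.sum_congr rfl fun s hs => ?_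
    have := (Finset.mem_filter.1 hs).2
    exact h _ (height_hopBack this.1 this.2)

lemma predSum_transProb_eq_zero {α t : ℝ} {y x : Config} (h : height x ≤ height y) :
    predSum α (transProb α t y) x = 0 := by
  have h0 : predSum α (transProb α t y) x = predSum α (fun _ => 0) x :=
    predSum_congr fun z hz => transProb_eq_zero_of_height (by omega)
  rw [h0]
  simp [predSum]

lemma hasDerivAt_transProb (α t : ℝ) (y x : Config) :
    HasDerivAt (fun s => transProb α s y x)
      (predSum α (transProb α t y) x - exitRate α x * transProb α t y x) t := by
  obtain hlt | ⟨n, hn⟩ := (lt_or_ge (height x) (height y)).imp_right Nat.exists_eq_add_of_le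
  · simp only [transProb_eq_zero_of_height hlt, predSum_transProb_eq_zero hlt.le]
    simpa using hasDerivAt_const t (0 : ℝ)
  simp only [transProb_eq_jumpProb hn]
  cases n with
  | zero =>
    rw [predSum_transProb_eq_zero hn.le]
    by_cases hyx : y = x
    · subst hyx
      simpa using hasDerivAt_jumpProb_zero α t y y
    · simpa [jumpProb, hyx] using hasDerivAt_const t (0 : ℝ)
  | succ n =>
    refine (hasDerivAt_jumpProb_succ α n t y x).congr_deriv ?_
    rw [jumpProb_forward]
    congr 1
    exact predSum_congr fun z hz => (transProb_eq_jumpProb (by omega)).symm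

/-! ### Contour integrals -/

section Contour

open Filter Topology Metric

lemma contour_congr {R : ℝ} (hR : 0 ≤ R) {f g : ℂ → ℂ} (h : ∀ z, ‖z‖ = R → f z = g z) :
    contour R f = contour R g := by
  unfold contour
  rw [circleIntegral.integral_congr hR fun z hz => h z (by simpa using hz)]

lemma contour_const_mul (R : ℝ) (c : ℂ) (f : ℂ → ℂ) :
    contour R (fun z => c * f z) = c * contour R f := by
  unfold contour
  rw [circleIntegral.integral_const_mul]; ring

lemma contour_neg (R : ℝ) (f : ℂ → ℂ) : contour R (fun z => -f z) = -contour R f := by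
  simpa using contour_const_mul R (-1) f

lemma contour_add {R : ℝ} (hR : 0 ≤ R) {f g : ℂ → ℂ} (hf : ContinuousOn f (sphere 0 R))
    (hg : ContinuousOn g (sphere 0 R)) :
    contour R (fun z => f z + g z) = contour R f + contour R g := by
  unfold contour
  rw [circleIntegral.integral_add (hf.circleIntegrable hR) (hg.circleIntegrable hR), mul_add]

lemma contour_sub {R : ℝ} (hR : 0 ≤ R) {f g : ℂ → ℂ} (hf : ContinuousOn f (sphere 0 R))
    (hg : ContinuousOn g (sphere 0 R)) :
    contour R (fun z => f z - g z) = contour R f - contour R g := by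
  unfold contour
  rw [circleIntegral.integral_sub (hf.circleIntegrable hR) (hg.circleIntegrable hR), mul_sub]

lemma norm_contour_le {R C : ℝ} (hR : 0 ≤ R) {f : ℂ → ℂ} (hf : ∀ z, ‖z‖ = R → ‖f z‖ ≤ C) :
    ‖contour R f‖ ≤ R * C :=
  circleIntegral.norm_two_pi_i_inv_smul_integral_le_of_norm_le_const hR
    fun z hz => hf z (by simpa using hz)

lemma contour_eq_of_annulus_off_countable {r R : ℝ} (hr : 0 < r) (hrR : r ≤ R) {f : ℂ → ℂ}
    {s : Set ℂ} (hs : s.Countable) (hc : ∀ z, r ≤ ‖z‖ → ‖z‖ ≤ R → ContinuousAt f z)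
    (hd : ∀ z, z ∉ s → r ≤ ‖z‖ → ‖z‖ ≤ R → DifferentiableAt ℂ f z) :
    contour R f = contour r f := by
  unfold contour
  rw [Complex.circleIntegral_eq_of_differentiable_on_annulus_off_countable hr hrR hs]
  · intro z hz
    simp only [Set.mem_sdiff, mem_closedBall, mem_ball, dist_zero_right, not_lt] at hz
    exact (hc z hz.2 hz.1).continuousWithinAt
  · intro z hz
    simp only [Set.mem_sdiff, mem_closedBall, mem_ball, dist_zero_right, not_le] at hz
    exact hd z hz.2 hz.1.2.le hz.1.1.le

lemma contour_eq_of_annulus {r R : ℝ} (hr : 0 < r) (hrR : r ≤ R) {f : ℂ → ℂ}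
    (hf : ∀ z, r ≤ ‖z‖ → ‖z‖ ≤ R → DifferentiableAt ℂ f z) : contour R f = contour r f :=
  contour_eq_of_annulus_off_countable hr hrR Set.countable_empty
    (fun z h₁ h₂ => (hf z h₁ h₂).continuousAt) fun z _ => hf z

lemma contour_div_sub {R : ℝ} {c : ℂ} (hc : ‖c‖ < R) {f : ℂ → ℂ}
    (hf : ∀ z, ‖z‖ ≤ R → DifferentiableAt ℂ f z) : contour R (fun z => f z / (z - c)) = f c := by
  unfold contour
  rw [Complex.circleIntegral_div_sub_of_differentiable_on_off_countable Set.countable_empty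
    (by simpa using hc), ← mul_assoc, inv_mul_cancel₀ Complex.two_pi_I_ne_zero, one_mul]
  · exact fun z hz => (hf z (by simpa using hz)).continuousAt.continuousWithinAt
  · exact fun z hz => hf z (by simpa using ball_subset_closedBall hz.1)

lemma contour_eq_zero_of_disc {R : ℝ} (hR : 0 ≤ R) {f : ℂ → ℂ}
    (hf : ∀ z, ‖z‖ ≤ R → DifferentiableAt ℂ f z) : contour R f = 0 := by
  unfold contour
  rw [Complex.circleIntegral_eq_zero_of_differentiable_on_off_countable hR Set.countable_empty,
    mul_zero]
  · exact fun z hz => (hf z (by simpa using hz)).continuousAt.continuousWithinAt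
  · exact fun z hz => hf z (by simpa using ball_subset_closedBall hz.1)

lemma contour_eq_zero_of_decay {R : ℝ} (hR : 0 < R) {f : ℂ → ℂ}
    (hf : ∀ z, R ≤ ‖z‖ → DifferentiableAt ℂ f z)
    (hd : Tendsto (fun z => z * f z) (Bornology.cobounded ℂ) (𝓝 0)) : contour R f = 0 := by
  refine norm_le_zero_iff.1 (le_of_forall_pos_le_add fun ε hε => ?_)
  have hsmall : ∀ᶠ z in Bornology.cobounded ℂ, ‖z * f z‖ < ε := by
    simpa using hd.eventually (ball_mem_nhds 0 hε)
  rw [← comap_norm_atTop, eventually_comap] at hsmall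
  obtain ⟨R', hR', hRR'⟩ := (hsmall.and (eventually_ge_atTop R)).exists
  have hpos : 0 < R' := hR.trans_le hRR'
  rw [← contour_eq_of_annulus hR hRR' fun z hz _ => hf z hz, zero_add]
  refine (norm_contour_le (C := ε / R') hpos.le fun z hz => ?_).trans_eq
    (mul_div_cancel₀ _ hpos.ne')
  have hz' := hR' z hz
  rw [norm_mul, hz] at hz'
  rw [le_div_iff₀ hpos, mul_comm]
  exact hz'.le

lemma contour_div_sub_eq_dslope {ρ : ℝ} (hρ : 0 ≤ ρ) {c : ℂ} (hc : ‖c‖ ≠ ρ) {f : ℂ → ℂ}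
    (hf : ContinuousOn f (sphere 0 ρ)) :
    contour ρ (fun z => f z / (z - c)) =
      contour ρ (dslope f c) + f c * contour ρ (fun z => 1 / (z - c)) := by
  have hne : ∀ z ∈ sphere (0 : ℂ) ρ, z - c ≠ 0 := fun z hz h =>
    hc (by rw [← sub_eq_zero.1 h, ← mem_sphere_zero_iff_norm.1 hz])
  have hslope : ContinuousOn (dslope f c) (sphere 0 ρ) :=
    fun z hz => (continuousWithinAt_dslope_of_ne (sub_ne_zero.1 (hne z hz))).2 (hf z hz)
  have hpole : ContinuousOn (fun z => f c * (1 / (z - c))) (sphere 0 ρ) := by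
    fun_prop (disch := assumption)
  rw [← contour_const_mul, ← contour_add hρ hslope hpole]
  refine contour_congr hρ fun z hz => ?_
  rw [dslope_of_ne _ (sub_ne_zero.1 (hne z (by simpa using hz))), slope_def_field]
  ring

lemma contour_div_sub_of_annulus {r R : ℝ} (hr : 0 < r) {c : ℂ} (hrc : r < ‖c‖) (hcR : ‖c‖ < R)
    {f : ℂ → ℂ} (hf : ∀ z, r ≤ ‖z‖ → ‖z‖ ≤ R → DifferentiableAt ℂ f z) :
    contour R (fun z => f z / (z - c)) - contour r (fun z => f z / (z - c)) = f c := by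
  have hrR := hrc.trans hcR
  have hcont : ∀ ρ, r ≤ ρ → ρ ≤ R → ContinuousOn f (sphere 0 ρ) := fun ρ h₁ h₂ z hz => by
    rw [mem_sphere_zero_iff_norm] at hz
    exact (hf z (by rwa [hz]) (by rwa [hz])).continuousAt.continuousWithinAt
  have hslope : contour R (dslope f c) = contour r (dslope f c) := by
    refine contour_eq_of_annulus_off_countable hr hrR.le (Set.countable_singleton c)
      (fun z h₁ h₂ => ?_) fun z hz h₁ h₂ => (differentiableAt_dslope_of_ne hz).2 (hf z h₁ h₂)
    obtain rfl | hz := eq_or_ne z c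
    · exact continuousAt_dslope_same.2 (hf z h₁ h₂)
    · exact (continuousAt_dslope_of_ne hz).2 (hf z h₁ h₂).continuousAt
  have hinner : contour r (fun z => 1 / (z - c)) = 0 := by
    refine contour_eq_zero_of_disc hr.le fun z hz => ?_
    have : z - c ≠ 0 := sub_ne_zero.2 (by rintro rfl; linarith)
    fun_prop (disch := assumption)
  have houter : contour R (fun z => 1 / (z - c)) = 1 :=
    contour_div_sub (f := fun _ => 1) hcR fun z _ => differentiableAt_const _
  rw [contour_div_sub_eq_dslope (hr.trans hrR).le hcR.ne (hcont R hrR.le le_rfl),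
    contour_div_sub_eq_dslope hr.le hrc.ne' (hcont r le_rfl hrR.le), hslope, hinner, houter]
  ring

/-- The density of `dz / (2 π i)` on the circle of radius `R`, in the angular coordinate. -/
noncomputable def circleDensity (R θ : ℝ) : ℂ := circleMap 0 R θ / (2 * Real.pi)

@[fun_prop]
lemma continuous_circleDensity (R : ℝ) : Continuous (circleDensity R) := by
  unfold circleDensity; fun_prop

lemma contour_eq_intervalIntegral (R : ℝ) (f : ℂ → ℂ) :
    contour R f = ∫ θ in (0 : ℝ)..2 * Real.pi, circleDensity R θ * f (circleMap 0 R θ) := by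
  unfold contour circleIntegral circleDensity
  rw [← intervalIntegral.integral_const_mul]
  congr 1
  funext θ
  have : (Real.pi : ℂ) ≠ 0 := by exact_mod_cast Real.pi_ne_zero
  rw [deriv_circleMap, smul_eq_mul]
  field_simp [Complex.I_ne_zero]

lemma contour_swap {R₁ R₂ : ℝ} (hR₁ : 0 ≤ R₁) (hR₂ : 0 ≤ R₂) {K : ℂ → ℂ → ℂ}
    (hK : ContinuousOn K.uncurry (sphere 0 R₂ ×ˢ sphere 0 R₁)) :
    contour R₂ (fun u => contour R₁ fun w => K u w) =
      contour R₁ fun w => contour R₂ fun u => K u w := by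
  have hK' : Continuous fun p : ℝ × ℝ => K (circleMap 0 R₂ p.1) (circleMap 0 R₁ p.2) :=
    hK.comp_continuous (f := fun p : ℝ × ℝ => (circleMap 0 R₂ p.1, circleMap 0 R₁ p.2))
      (by fun_prop) fun p => ⟨circleMap_mem_sphere _ hR₂ _, circleMap_mem_sphere _ hR₁ _⟩
  simp only [contour_eq_intervalIntegral, ← intervalIntegral.integral_const_mul]
  rw [MeasureTheory.intervalIntegral_intervalIntegral_swap]
  · simp only [mul_left_comm]
  · refine MeasureTheory.IntegrableOn.mono_set (ContinuousOn.integrableOn_compact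
      (isCompact_uIcc.prod isCompact_uIcc) (Continuous.continuousOn ?_))
      (Set.prod_mono Set.uIoc_subset_uIcc Set.uIoc_subset_uIcc)
    exact ((continuous_circleDensity R₂).comp continuous_fst).mul
      (((continuous_circleDensity R₁).comp continuous_snd).mul hK')

lemma continuousOn_contour {X : Type*} [TopologicalSpace X] {R : ℝ} (hR : 0 ≤ R) {s : Set X}
    {K : X → ℂ → ℂ} (hK : ContinuousOn K.uncurry (s ×ˢ sphere 0 R)) :
    ContinuousOn (fun x => contour R (K x)) s := by
  have hK' : Continuous fun p : s × ℝ => K p.1 (circleMap 0 R p.2) :=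
    hK.comp_continuous (f := fun p : s × ℝ => ((p.1 : X), circleMap 0 R p.2))
      (by fun_prop) fun p => ⟨p.1.2, circleMap_mem_sphere _ hR _⟩
  simp only [continuousOn_iff_continuous_domRestrict, Set.domRestrict_def,
    contour_eq_intervalIntegral]
  exact intervalIntegral.continuous_parametric_intervalIntegral_of_continuous'
    (((continuous_circleDensity R).comp continuous_snd).mul hK') _ _

lemma hasDerivAt_contour {R : ℝ} (hR : 0 ≤ R) {F F' : ℝ → ℂ → ℂ}
    (hF : ∀ t, ContinuousOn (F t) (sphere 0 R))
    (hF' : ContinuousOn F'.uncurry (Set.univ ×ˢ sphere 0 R))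
    (h : ∀ t, ∀ z ∈ sphere (0 : ℂ) R, HasDerivAt (fun s => F s z) (F' t z) t) (t : ℝ) :
    HasDerivAt (fun s => contour R (F s)) (contour R (F' t)) t := by
  have hcirc : ∀ θ, circleMap 0 R θ ∈ sphere (0 : ℂ) R := fun θ => circleMap_mem_sphere _ hR θ
  have hcF : ∀ s, Continuous fun θ => circleDensity R θ * F s (circleMap 0 R θ) := fun s =>
    (continuous_circleDensity R).mul ((hF s).comp_continuous (continuous_circleMap 0 R) hcirc)
  have hcF' : Continuous fun p : ℝ × ℝ => circleDensity R p.2 * F' p.1 (circleMap 0 R p.2) :=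
    ((continuous_circleDensity R).comp continuous_snd).mul <|
      hF'.comp_continuous (f := fun p : ℝ × ℝ => (p.1, circleMap 0 R p.2)) (by fun_prop)
        fun p => ⟨Set.mem_univ _, hcirc _⟩
  obtain ⟨C, hC⟩ := ((isCompact_closedBall t 1).prod
    (isCompact_uIcc (a := 0) (b := 2 * Real.pi))).exists_bound_of_continuousOn hcF'.continuousOn
  simp only [contour_eq_intervalIntegral]
  refine (intervalIntegral.hasDerivAt_integral_of_dominated_loc_of_deriv_le (bound := fun _ => C)
    (F := fun s θ => circleDensity R θ * F s (circleMap 0 R θ))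
    (F' := fun s θ => circleDensity R θ * F' s (circleMap 0 R θ))
    (closedBall_mem_nhds t one_pos) ?_ ?_ ?_ ?_ ?_ ?_).2
  · exact Eventually.of_forall fun s => (hcF s).aestronglyMeasurable
  · exact (hcF t).intervalIntegrable _ _
  · exact (hcF'.comp (Continuous.prodMk_right t)).aestronglyMeasurable
  · exact Eventually.of_forall fun θ hθ s hs => hC (s, θ) ⟨hs, Set.uIoc_subset_uIcc hθ⟩
  · exact continuous_const.intervalIntegrable _ _
  · exact Eventually.of_forall fun θ _ s _ => (h s _ (hcirc θ)).const_mul _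

end Contour

/-! ### The double contour integral and the weights -/

section DoubleContour

open Filter Topology Metric

/-- The double integral of `f w * g u` against the kernel `(u - w) / (1 - u - w)` of `Qker`, with
`w` on the circle of radius `R₁` and `u` on the circle of radius `R₂`. -/
noncomputable def doubleContour (R₁ R₂ : ℝ) (f g : ℂ → ℂ) : ℂ :=
  contour R₂ fun u => contour R₁ fun w => (u - w) / (1 - u - w) * f w * g u

lemma one_sub_sub_ne_zero {u w : ℂ} (h : 1 < |‖w‖ - ‖u‖|) : 1 - u - w ≠ 0 := by
  intro h0
  have hle := abs_norm_sub_norm_le w (-u)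
  rw [sub_neg_eq_add, norm_neg, show w + u = 1 by linear_combination -h0, norm_one] at hle
  linarith

lemma one_sub_sub_ne_zero_on_spheres {R₁ R₂ : ℝ} (h : 1 < |R₁ - R₂|) :
    ∀ p ∈ sphere (0 : ℂ) R₂ ×ˢ sphere (0 : ℂ) R₁, 1 - p.1 - p.2 ≠ 0 := by
  rintro ⟨u, w⟩ ⟨hu, hw⟩
  rw [mem_sphere_zero_iff_norm] at hu hw
  exact one_sub_sub_ne_zero (by rwa [hu, hw])

lemma continuousOn_doubleContour_integrand {R₁ R₂ : ℝ} (h : 1 < |R₁ - R₂|) {f g : ℂ → ℂ}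
    (hf : ContinuousOn f (sphere 0 R₁)) (hg : ContinuousOn g (sphere 0 R₂)) :
    ContinuousOn (fun u w => (u - w) / (1 - u - w) * f w * g u).uncurry
      (sphere 0 R₂ ×ˢ sphere 0 R₁) :=
  ((ContinuousOn.div (by fun_prop) (by fun_prop) (one_sub_sub_ne_zero_on_spheres h)).mul
    (hf.comp continuousOn_snd fun _ hp => hp.2)).mul
    (hg.comp continuousOn_fst fun _ hp => hp.1)

lemma doubleContour_swap {R₁ R₂ : ℝ} (hR₁ : 0 ≤ R₁) (hR₂ : 0 ≤ R₂) (h : 1 < |R₁ - R₂|)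
    {f g : ℂ → ℂ} (hf : ContinuousOn f (sphere 0 R₁)) (hg : ContinuousOn g (sphere 0 R₂)) :
    doubleContour R₁ R₂ f g = -doubleContour R₂ R₁ g f := by
  unfold doubleContour
  rw [contour_swap hR₁ hR₂ (continuousOn_doubleContour_integrand h hf hg), ← contour_neg]
  congr 1
  funext w
  rw [← contour_neg]
  congr 1
  funext u
  rw [sub_right_comm, ← neg_sub w u, neg_div]
  ring

lemma doubleContour_eq_of_annulus {r R R₂ : ℝ} (hr : 0 < r) (hrR : r ≤ R) (hR₂ : 0 ≤ R₂)
    (h : ∀ ρ, r ≤ ρ → ρ ≤ R → 1 < |ρ - R₂|) {f : ℂ → ℂ}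
    (hf : ∀ z, r ≤ ‖z‖ → ‖z‖ ≤ R → DifferentiableAt ℂ f z) (g : ℂ → ℂ) :
    doubleContour R R₂ f g = doubleContour r R₂ f g := by
  refine contour_congr hR₂ fun u hu => contour_eq_of_annulus hr hrR fun w h₁ h₂ => ?_
  have hne : 1 - u - w ≠ 0 := one_sub_sub_ne_zero (by rw [hu]; exact h _ h₁ h₂)
  have := hf w h₁ h₂
  fun_prop (disch := assumption)

lemma doubleContour_sub_eq_residue {r R R₂ : ℝ} (hr : 0 < r) (hrR₂ : r + 1 < R₂) (hR : R₂ + 1 < R)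
    {f g : ℂ → ℂ} (hf : ∀ z, r ≤ ‖z‖ → ‖z‖ ≤ R → DifferentiableAt ℂ f z)
    (hg : ContinuousOn g (sphere 0 R₂)) :
    doubleContour R R₂ f g - doubleContour r R₂ f g =
      contour R₂ fun u => (1 - 2 * u) * f (1 - u) * g u := by
  have hcont : ∀ ρ, r ≤ ρ → ρ ≤ R → 1 < |ρ - R₂| →
      ContinuousOn (fun u => contour ρ fun w => (u - w) / (1 - u - w) * f w * g u)
        (sphere 0 R₂) := fun ρ h₁ h₂ h =>
    continuousOn_contour (hr.le.trans h₁) <| continuousOn_doubleContour_integrand h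
      (fun z hz => by
        rw [mem_sphere_zero_iff_norm] at hz
        exact (hf z (by rwa [hz]) (by rwa [hz])).continuousAt.continuousWithinAt) hg
  unfold doubleContour
  rw [← contour_sub (by linarith)
    (hcont R (by linarith) le_rfl ((by linarith : 1 < R - R₂).trans_le (le_abs_self _)))
    (hcont r le_rfl (by linarith) ((by linarith : 1 < -(r - R₂)).trans_le (neg_le_abs _)))]
  refine contour_congr (by linarith) fun u hu => ?_
  have hlower := norm_sub_norm_le u 1
  have hupper := norm_sub_le (1 : ℂ) u
  rw [norm_sub_rev] at hlower
  rw [norm_one, hu] at hlower hupper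
  have hpole : (fun w => (u - w) / (1 - u - w) * f w * g u) =
      fun w => (w - u) * f w * g u / (w - (1 - u)) := by
    funext w
    rw [← neg_sub w u, show 1 - u - w = -(w - (1 - u)) by ring, neg_div_neg_eq]
    ring
  have hdiff : ∀ z, r ≤ ‖z‖ → ‖z‖ ≤ R →
      DifferentiableAt ℂ (fun w => (w - u) * f w * g u) z := fun z h₁ h₂ => by
    have := hf z h₁ h₂
    fun_prop
  rw [hpole, contour_div_sub_of_annulus hr (by linarith) (by linarith) hdiff]
  ring

/-- Both contours are moved past each other: first `w` outwards across the pole `w = 1 - u`, at the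
cost of a residue, then `u` inwards and `w` back, with no pole in the way. -/
lemma doubleContour_comm_radii {R₁ R₂ : ℝ} (hR₁ : 0 < R₁) (h : R₁ + 1 < R₂) {f g : ℂ → ℂ}
    (hf : ∀ z, R₁ ≤ ‖z‖ → DifferentiableAt ℂ f z) (hg : ∀ z, R₁ ≤ ‖z‖ → DifferentiableAt ℂ g z)
    (hres : contour R₂ (fun u => (1 - 2 * u) * f (1 - u) * g u) = 0) :
    doubleContour R₁ R₂ f g = doubleContour R₂ R₁ f g := by
  have hcont : ∀ {k : ℂ → ℂ}, (∀ z, R₁ ≤ ‖z‖ → DifferentiableAt ℂ k z) →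
      ∀ ρ, R₁ ≤ ρ → ContinuousOn k (sphere 0 ρ) := fun hk ρ hρ z hz =>
    (hk z (by rwa [mem_sphere_zero_iff_norm.1 hz])).continuousAt.continuousWithinAt
  have hgap : ∀ {ρ σ : ℝ}, ρ + 1 < σ → 1 < |σ - ρ| := fun hρσ =>
    (lt_sub_iff_add_lt'.2 hρσ).trans_le (le_abs_self _)
  set R₃ := R₂ + 2
  have hR₃ : R₂ + 1 < R₃ := by simp only [R₃]; linarith
  calc doubleContour R₁ R₂ f g = doubleContour R₃ R₂ f g := by
        rw [eq_comm, ← sub_eq_zero, ← hres]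
        exact doubleContour_sub_eq_residue hR₁ h hR₃ (fun z hz _ => hf z hz)
          (hcont hg R₂ (by linarith))
    _ = -doubleContour R₂ R₃ g f :=
        doubleContour_swap (by linarith) (by linarith) (hgap hR₃) (hcont hf _ (by linarith))
          (hcont hg _ (by linarith))
    _ = -doubleContour R₁ R₃ g f := by
        rw [doubleContour_eq_of_annulus hR₁ (by linarith) (by linarith)
          (fun ρ _ hρ => abs_sub_comm R₃ ρ ▸ hgap (by linarith)) fun z hz _ => hg z hz]
    _ = doubleContour R₃ R₁ f g := by
        rw [doubleContour_swap (by linarith) hR₁.le (hgap (by linarith))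
          (hcont hf _ (by linarith)) (hcont hg _ le_rfl)]
    _ = doubleContour R₂ R₁ f g :=
        doubleContour_eq_of_annulus (by linarith) (by linarith) hR₁.le
          (fun ρ hρ _ => hgap (by linarith)) (fun z hz _ => hf z (by linarith)) g

end DoubleContour

section Weights

open Filter Topology Metric Bornology

lemma Qker_eq_doubleContour (α t R₁ R₂ : ℝ) (i j : ℕ) (a b : ℤ) : Qker α t R₁ R₂ i j a b =
    (α : ℂ) ^ 2 * doubleContour R₁ R₂ (weight α t i a) (weight α t j b) := rfl

lemma ne_of_max_lt_norm {α : ℝ} {w : ℂ} (hw : max 1 |α| < ‖w‖) : w ≠ 0 ∧ w ≠ 1 ∧ w ≠ α := by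
  obtain ⟨h₁, h₂⟩ := max_lt_iff.1 hw
  refine ⟨?_, ?_, ?_⟩ <;> rintro rfl
  · rw [norm_zero] at h₁; linarith
  · simp at h₁
  · simp at h₂

lemma pos_of_max_one_lt {x R : ℝ} (h : max 1 x < R) : 0 < R :=
  one_pos.trans ((le_max_left 1 x).trans_lt h)

lemma differentiableAt_weight {α : ℝ} (t : ℝ) (i : ℕ) (a : ℤ) {w : ℂ} (hw : max 1 |α| < ‖w‖) :
    DifferentiableAt ℂ (weight α t i a) w := by
  obtain ⟨h0, h1, hα⟩ := ne_of_max_lt_norm hw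
  have hden : (w - α) * (w - 1) ^ i ≠ 0 :=
    mul_ne_zero (sub_ne_zero.2 hα) (pow_ne_zero _ (sub_ne_zero.2 h1))
  have hzpow : DifferentiableAt ℂ (fun w : ℂ => w ^ ((i : ℤ) - a)) w :=
    differentiableAt_zpow.2 (Or.inl h0)
  unfold weight
  fun_prop (disch := assumption)

lemma continuousOn_weight {α R : ℝ} (hR : max 1 |α| < R) (t : ℝ) (i : ℕ) (a : ℤ) :
    ContinuousOn (weight α t i a) (sphere 0 R) := fun z hz =>
  (differentiableAt_weight t i a
    (by rwa [mem_sphere_zero_iff_norm.1 hz])).continuousAt.continuousWithinAt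

lemma tendsto_div_sub (c : ℂ) : Tendsto (fun z : ℂ => z / (z - c)) (cobounded ℂ) (𝓝 1) := by
  have h : Tendsto (fun z : ℂ => (1 - c * z⁻¹)⁻¹) (cobounded ℂ) (𝓝 1) := by
    have := ((tendsto_inv₀_cobounded (α := ℂ)).const_mul c).const_sub 1
    simpa using this.inv₀ (by simp)
  refine h.congr' ?_
  filter_upwards [eventually_ne_cobounded (0 : ℂ)] with z hz
  rw [show 1 - c * z⁻¹ = (z - c) / z by field_simp, inv_div]

lemma tendsto_zpow_neg_cobounded {n : ℤ} (hn : 0 < n) :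
    Tendsto (fun z : ℂ => z ^ (-n)) (cobounded ℂ) (𝓝 0) := by
  obtain ⟨m, rfl⟩ := Int.eq_ofNat_of_zero_le hn.le
  have hm := (tendsto_inv₀_cobounded (α := ℂ)).pow m
  rw [zero_pow (by rintro rfl; simp at hn)] at hm
  exact hm.congr fun z => by simp

/-- The part of `weight α t i` that tends to `1` at infinity. -/
noncomputable def weightTail (α : ℝ) (i : ℕ) (w : ℂ) : ℂ := (w / (w - 1)) ^ i * (w / (w - α))

lemma tendsto_weightTail (α : ℝ) (i : ℕ) : Tendsto (weightTail α i) (cobounded ℂ) (𝓝 1) := by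
  have h := ((tendsto_div_sub 1).pow i).mul (tendsto_div_sub α)
  rwa [one_pow, one_mul] at h

lemma weight_eq_weightTail (α t : ℝ) (i : ℕ) (a : ℤ) {w : ℂ} (hw : w ≠ 0) :
    weight α t i a w = w ^ (-(a + 1)) * weightTail α i w * Complex.exp (t * (w - 1)) := by
  unfold weight weightTail
  rw [show (i : ℤ) - a = -(a + 1) + i + 1 by ring, zpow_add_one₀ hw, zpow_add₀ hw, zpow_natCast,
    div_pow]
  simp only [div_eq_mul_inv, mul_inv]
  ring

lemma weight_time_zero_eq_weightTail (α : ℝ) (i : ℕ) (a : ℤ) {w : ℂ} (hw : w ≠ 0) :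
    weight α 0 i a w = w ^ (-(a + 1)) * weightTail α i w := by
  simp [weight_eq_weightTail α 0 i a hw]

lemma contour_weight_time_zero {α R : ℝ} (hR : max 1 |α| < R) (i : ℕ) {a : ℤ} (ha : 1 ≤ a) :
    contour R (weight α 0 i a) = 0 := by
  refine contour_eq_zero_of_decay (pos_of_max_one_lt hR)
    (fun z hz => differentiableAt_weight 0 i a (hR.trans_le hz)) ?_
  have hlim := (tendsto_zpow_neg_cobounded ha).mul (tendsto_weightTail α i)
  rw [zero_mul] at hlim
  refine hlim.congr' ?_
  filter_upwards [eventually_ne_cobounded (0 : ℂ)] with z hz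
  rw [weight_time_zero_eq_weightTail α i a hz, neg_add, zpow_add₀ hz, zpow_neg_one]
  field_simp

lemma tendsto_residue_weight (α t : ℝ) (i j : ℕ) {a b : ℤ} (hab : 1 ≤ a + b) :
    Tendsto (fun u => u * ((1 - 2 * u) * weight α t i a (1 - u) * weight α t j b u))
      (cobounded ℂ) (𝓝 0) := by
  have hratio : Tendsto (fun u : ℂ => u / (u - 1)) (cobounded ℂ) (𝓝 1) := tendsto_div_sub 1
  have hlim := ((tendsto_zpow_neg_cobounded (by omega : 0 < a + b)).const_mul
    (Complex.exp (-t))).mul <| ((hratio.add_const 1).mul (hratio.neg.zpow₀ a (by simp))).mul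
    (((tendsto_weightTail α i).comp (tendsto_const_sub_cobounded 1)).mul (tendsto_weightTail α j))
  rw [mul_zero, zero_mul] at hlim
  refine hlim.congr' ?_
  filter_upwards [eventually_ne_cobounded (0 : ℂ), eventually_ne_cobounded (1 : ℂ)] with u h0 h1
  have h1' : 1 - u ≠ 0 := sub_ne_zero.2 h1.symm
  have hneg : -(u / (u - 1)) = u / (1 - u) := by rw [← div_neg, neg_sub]
  have hexp : Complex.exp (-t) = Complex.exp (t * (1 - u - 1)) * Complex.exp (t * (u - 1)) := by
    rw [← Complex.exp_add]; congr 1; ring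
  have hadd : u / (u - 1) + 1 = (1 - 2 * u) / (1 - u) := by
    rw [← neg_sub 1 u]; field_simp; ring
  have hpow : u ^ (-(a + b)) * (u / (1 - u)) ^ a / (1 - u) =
      u * ((1 - u) ^ (-(a + 1)) * u ^ (-(b + 1))) := by
    rw [div_zpow, neg_add, zpow_add₀ h0, neg_add, neg_add, zpow_add₀ h0, zpow_add₀ h1']
    simp only [zpow_neg, zpow_one]
    have := zpow_ne_zero a h0
    field_simp
  rw [weight_eq_weightTail α t i a h1', weight_eq_weightTail α t j b h0, hneg, hexp, hadd,
    Function.comp_apply]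
  linear_combination (1 - 2 * u) * weightTail α i (1 - u) * weightTail α j u *
    Complex.exp (t * (1 - u - 1)) * Complex.exp (t * (u - 1)) * hpow

lemma contour_residue_weight {α R : ℝ} (hR : max 1 |α| + 1 < R) (t : ℝ) (i j : ℕ) {a b : ℤ}
    (hab : 1 ≤ a + b) :
    contour R (fun u => (1 - 2 * u) * weight α t i a (1 - u) * weight α t j b u) = 0 := by
  have hpos : 0 < R := pos_of_max_one_lt ((lt_add_one _).trans hR)
  refine contour_eq_zero_of_decay hpos (fun z hz => ?_) (tendsto_residue_weight α t i j hab)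
  have hnorm : max 1 |α| < ‖1 - z‖ := by
    have := norm_sub_norm_le z 1
    rw [norm_sub_rev, norm_one] at this
    linarith
  exact ((by fun_prop : DifferentiableAt ℂ (fun u : ℂ => 1 - 2 * u) z).mul
    ((differentiableAt_weight t i a hnorm).comp z (differentiableAt_id.const_sub 1))).mul
    (differentiableAt_weight t j b (by linarith))

lemma Qker_comm_radii {α R₁ R₂ : ℝ} (h₁ : max 1 |α| < R₁) (h₂ : R₁ + 1 < R₂) (t : ℝ)
    (i j : ℕ) {a b : ℤ} (hab : 1 ≤ a + b) :
    Qker α t R₁ R₂ i j a b = Qker α t R₂ R₁ i j a b := by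
  rw [Qker_eq_doubleContour, Qker_eq_doubleContour,
    doubleContour_comm_radii (pos_of_max_one_lt h₁) h₂
      (fun z hz => differentiableAt_weight t i a (h₁.trans_le hz))
      (fun z hz => differentiableAt_weight t j b (h₁.trans_le hz))
      (contour_residue_weight (by linarith) t i j hab)]

lemma Qker_swap {α R₁ R₂ : ℝ} (h₁ : max 1 |α| < R₁) (h₂ : max 1 |α| < R₂) (h : 1 < |R₁ - R₂|)
    (t : ℝ) (i j : ℕ) (a b : ℤ) : Qker α t R₁ R₂ i j a b = -Qker α t R₂ R₁ j i b a := by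
  rw [Qker_eq_doubleContour, Qker_eq_doubleContour,
    doubleContour_swap (pos_of_max_one_lt h₁).le (pos_of_max_one_lt h₂).le h
      (continuousOn_weight h₁ t i a) (continuousOn_weight h₂ t j b), mul_neg]

lemma Qker_skew {α R₁ R₂ : ℝ} (h₁ : max 1 |α| < R₁) (h₂ : max 1 |α| < R₂) (h : 1 < |R₁ - R₂|)
    (t : ℝ) (i j : ℕ) {a b : ℤ} (hab : 1 ≤ a + b) :
    Qker α t R₁ R₂ i j a b = -Qker α t R₁ R₂ j i b a := by
  rw [Qker_swap h₁ h₂ h, neg_inj]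
  obtain h | h := lt_abs.1 h
  · exact Qker_comm_radii h₂ (by linarith) t j i (by omega)
  · exact (Qker_comm_radii h₁ (by linarith) t j i (by omega)).symm

lemma contour_weight_eq_of_radii {α R R' : ℝ} (hR : max 1 |α| < R) (hR' : max 1 |α| < R') (t : ℝ)
    (i : ℕ) (a : ℤ) : contour R (weight α t i a) = contour R' (weight α t i a) := by
  wlog h : R ≤ R' generalizing R R'
  · exact (this hR' hR (le_of_not_ge h)).symm
  exact (contour_eq_of_annulus (pos_of_max_one_lt hR) h
    fun z hz _ => differentiableAt_weight t i a (hR.trans_le hz)).symm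

lemma pker_eq_of_radii {α R R' : ℝ} (hR : max 1 |α| < R) (hR' : max 1 |α| < R') (t : ℝ)
    (i : ℕ) (a : ℤ) : pker α t R i a = pker α t R' i a :=
  congrArg ((α : ℂ) * ·) (contour_weight_eq_of_radii hR hR' t i a)

lemma Qker_time_zero {α R₁ R₂ : ℝ} (h₁ : max 1 |α| < R₁) (h₂ : R₁ + 1 < R₂)
    (i j : ℕ) {a b : ℤ} (ha : 1 ≤ a) (hb : 1 ≤ b) : Qker α 0 R₁ R₂ i j a b = 0 := by
  have hpos := pos_of_max_one_lt h₁
  suffices h : ∀ u : ℂ, ‖u‖ = R₁ → contour R₂ (fun w =>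
      (u - w) / (1 - u - w) * weight α 0 i a w * weight α 0 j b u) = 0 by
    rw [Qker_comm_radii h₁ h₂ 0 i j (by omega), Qker]
    have hzero : contour R₁ (fun _ => (0 : ℂ)) = 0 :=
      contour_eq_zero_of_disc hpos.le fun z _ => differentiableAt_const _
    rw [contour_congr hpos.le h, hzero, mul_zero]
  intro u hu
  refine contour_eq_zero_of_decay (by linarith) (fun w hw => ?_) ?_
  · have hne : 1 - u - w ≠ 0 := one_sub_sub_ne_zero <| by
      rw [hu]; exact (by linarith : 1 < ‖w‖ - R₁).trans_le (le_abs_self _)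
    have := differentiableAt_weight 0 i a (α := α) (w := w) (by linarith)
    fun_prop (disch := assumption)
  · have hlim := ((tendsto_zpow_neg_cobounded ha).mul
      ((((tendsto_inv₀_cobounded (α := ℂ)).const_mul u).const_sub 1).mul
        ((tendsto_div_sub (1 - u)).mul (tendsto_weightTail α i)))).mul_const (weight α 0 j b u)
    rw [zero_mul, zero_mul] at hlim
    refine hlim.congr' ?_
    filter_upwards [eventually_ne_cobounded (0 : ℂ), eventually_ne_cobounded (1 - u)] with w h0 h1
    rw [weight_time_zero_eq_weightTail α i a h0, neg_add, zpow_add₀ h0, zpow_neg_one,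
      ← neg_sub w u, show 1 - u - w = -(w - (1 - u)) by ring, neg_div_neg_eq]
    have := sub_ne_zero.2 h1
    field_simp

end Weights

/-! ### The alternating form and the functionals of the Pfaffian -/

section DoubleContourLinear

open Filter Topology Metric

variable {R₁ R₂ : ℝ} {f f' g g' : ℂ → ℂ}

lemma doubleContour_congr (hR₁ : 0 ≤ R₁) (hR₂ : 0 ≤ R₂) (hf : ∀ w, ‖w‖ = R₁ → f w = f' w)
    (hg : ∀ u, ‖u‖ = R₂ → g u = g' u) : doubleContour R₁ R₂ f g = doubleContour R₁ R₂ f' g' :=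
  contour_congr hR₂ fun u hu => contour_congr hR₁ fun w hw => by rw [hf w hw, hg u hu]

lemma doubleContour_const_mul_left (c : ℂ) :
    doubleContour R₁ R₂ (fun w => c * f w) g = c * doubleContour R₁ R₂ f g := by
  simp only [doubleContour, ← contour_const_mul]
  congr! 4
  ring

lemma doubleContour_const_mul_right (c : ℂ) :
    doubleContour R₁ R₂ f (fun u => c * g u) = c * doubleContour R₁ R₂ f g := by
  simp only [doubleContour, ← contour_const_mul]
  congr! 4
  ring

lemma continuousOn_doubleContour_inner (hR₁ : 0 ≤ R₁) (h : 1 < |R₁ - R₂|)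
    (hf : ContinuousOn f (sphere 0 R₁)) (hg : ContinuousOn g (sphere 0 R₂)) :
    ContinuousOn (fun u => contour R₁ fun w => (u - w) / (1 - u - w) * f w * g u) (sphere 0 R₂) :=
  continuousOn_contour hR₁ (continuousOn_doubleContour_integrand h hf hg)

lemma continuousOn_doubleContour_slice (h : 1 < |R₁ - R₂|) (hf : ContinuousOn f (sphere 0 R₁))
    (hg : ContinuousOn g (sphere 0 R₂)) {u : ℂ} (hu : ‖u‖ = R₂) :
    ContinuousOn (fun w => (u - w) / (1 - u - w) * f w * g u) (sphere 0 R₁) :=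
  (continuousOn_doubleContour_integrand h hf hg).comp (f := fun w => (u, w)) (by fun_prop)
    fun w hw => ⟨by simpa using hu, hw⟩

lemma doubleContour_add_left (hR₁ : 0 ≤ R₁) (hR₂ : 0 ≤ R₂) (h : 1 < |R₁ - R₂|)
    (hf : ContinuousOn f (sphere 0 R₁)) (hf' : ContinuousOn f' (sphere 0 R₁))
    (hg : ContinuousOn g (sphere 0 R₂)) :
    doubleContour R₁ R₂ (fun w => f w + f' w) g =
      doubleContour R₁ R₂ f g + doubleContour R₁ R₂ f' g := by
  unfold doubleContour
  rw [← contour_add hR₂ (continuousOn_doubleContour_inner hR₁ h hf hg)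
    (continuousOn_doubleContour_inner hR₁ h hf' hg)]
  refine contour_congr hR₂ fun u hu => ?_
  rw [← contour_add hR₁ (continuousOn_doubleContour_slice h hf hg hu)
    (continuousOn_doubleContour_slice h hf' hg hu)]
  simp only [mul_add, add_mul]

lemma doubleContour_add_right (hR₁ : 0 ≤ R₁) (hR₂ : 0 ≤ R₂) (h : 1 < |R₁ - R₂|)
    (hf : ContinuousOn f (sphere 0 R₁)) (hg : ContinuousOn g (sphere 0 R₂))
    (hg' : ContinuousOn g' (sphere 0 R₂)) :
    doubleContour R₁ R₂ f (fun u => g u + g' u) =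
      doubleContour R₁ R₂ f g + doubleContour R₁ R₂ f g' := by
  have h' := h
  rw [abs_sub_comm] at h'
  rw [doubleContour_swap hR₁ hR₂ h hf (hg.fun_add hg'), doubleContour_add_left hR₂ hR₁ h' hg hg' hf,
    neg_add, ← doubleContour_swap hR₁ hR₂ h hf hg, ← doubleContour_swap hR₁ hR₂ h hf hg']

/-- With `m z = z / (z - 1)` the kernel `K` satisfies `K (m u * m w - 1) = m u - m w`, which
separates the variables. -/
lemma doubleContour_ratio_mul (hR₁ : 1 < R₁) (hR₂ : 1 < R₂) (h : 1 < |R₁ - R₂|)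
    (hf : ContinuousOn f (sphere 0 R₁)) (hg : ContinuousOn g (sphere 0 R₂)) :
    doubleContour R₁ R₂ (fun w => w / (w - 1) * f w) (fun u => u / (u - 1) * g u) =
      doubleContour R₁ R₂ f g + (contour R₁ f * contour R₂ (fun u => u / (u - 1) * g u) -
        contour R₁ (fun w => w / (w - 1) * f w) * contour R₂ g) := by
  have hne : ∀ {ρ : ℝ}, 1 < ρ → ∀ z ∈ sphere (0 : ℂ) ρ, z - 1 ≠ 0 := fun hρ z hz h0 => by
    rw [mem_sphere_zero_iff_norm, sub_eq_zero.1 h0, norm_one] at hz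
    exact hρ.ne hz
  have hmul : ∀ {ρ : ℝ} {k : ℂ → ℂ}, 1 < ρ → ContinuousOn k (sphere 0 ρ) →
      ContinuousOn (fun z => z / (z - 1) * k z) (sphere 0 ρ) := fun hρ hk =>
    (continuousOn_id.div (by fun_prop) (hne hρ)).mul hk
  have hR₁' : 0 ≤ R₁ := by linarith
  have hR₂' : 0 ≤ R₂ := by linarith
  have hmf := hmul hR₁ hf
  have hmg := hmul hR₂ hg
  have key : ∀ u, ‖u‖ = R₂ → ∀ w, ‖w‖ = R₁ →
      (u - w) / (1 - u - w) * (w / (w - 1) * f w) * (u / (u - 1) * g u) =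
        (u - w) / (1 - u - w) * f w * g u +
          (u / (u - 1) * g u * f w - g u * (w / (w - 1) * f w)) := fun u hu w hw => by
    have h1 := hne hR₂ u (by simpa using hu)
    have h2 := hne hR₁ w (by simpa using hw)
    have h3 : 1 - u - w ≠ 0 := one_sub_sub_ne_zero (by rwa [hu, hw])
    field_simp
    ring
  have hsplit : contour R₁ f * contour R₂ (fun u => u / (u - 1) * g u) -
      contour R₁ (fun w => w / (w - 1) * f w) * contour R₂ g =
      contour R₂ fun u => u / (u - 1) * g u * contour R₁ f -
        g u * contour R₁ fun w => w / (w - 1) * f w := by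
    rw [contour_sub hR₂' (hmg.mul_const _) (hg.mul_const _), ← contour_const_mul,
      ← contour_const_mul]
    simp only [mul_comm]
  rw [hsplit]
  unfold doubleContour
  rw [← contour_add hR₂' (continuousOn_doubleContour_inner hR₁' h hf hg)
    ((hmg.mul_const _).fun_sub (hg.mul_const _))]
  refine contour_congr hR₂' fun u hu => ?_
  rw [contour_congr hR₁' (key u hu), contour_add hR₁'
    (continuousOn_doubleContour_slice h hf hg hu) ((hf.const_mul _).fun_sub (hmf.const_mul _)),
    contour_sub hR₁' (hf.const_mul _) (hmf.const_mul _), contour_const_mul, contour_const_mul]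

/-- Only the pole `w = 1` lies inside the inner contour. -/
lemma doubleContour_div_sub_one (hR₁ : 1 < R₁) (h : R₁ + 1 < R₂)
    (hf : ∀ w, ‖w‖ ≤ R₁ → DifferentiableAt ℂ f w) :
    doubleContour R₁ R₂ (fun w => f w / (w - 1)) (fun u => u / (u - 1) * g u) =
      -(f 1 * contour R₂ g) := by
  rw [← contour_const_mul, ← contour_neg]
  refine contour_congr (by linarith) fun u hu => ?_
  have hu0 : u ≠ 0 := by rintro rfl; rw [norm_zero] at hu; linarith
  have hu1 : u - 1 ≠ 0 := fun h1 => by rw [sub_eq_zero.1 h1, norm_one] at hu; linarith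
  have hpole : (fun w => (u - w) / (1 - u - w) * (f w / (w - 1)) * (u / (u - 1) * g u)) =
      fun w => (u - w) / (1 - u - w) * f w * (u / (u - 1) * g u) / (w - 1) := by
    funext w; ring
  rw [hpole, contour_div_sub (by rwa [norm_one])]
  · rw [show 1 - u - 1 = -u by ring]
    field_simp
  · intro w hw
    have hne : 1 - u - w ≠ 0 := one_sub_sub_ne_zero <| by
      rw [hu, abs_sub_comm]
      exact (by linarith : 1 < R₂ - ‖w‖).trans_le (le_abs_self _)
    have := hf w hw
    fun_prop (disch := assumption)

lemma continuousOn_doubleContour_integrand_time (h : 1 < |R₁ - R₂|) {F G : ℝ → ℂ → ℂ}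
    (hF : ContinuousOn F.uncurry (Set.univ ×ˢ sphere 0 R₁))
    (hG : ContinuousOn G.uncurry (Set.univ ×ˢ sphere 0 R₂)) :
    ContinuousOn (fun p : (ℝ × ℂ) × ℂ =>
      (p.1.2 - p.2) / (1 - p.1.2 - p.2) * F p.1.1 p.2 * G p.1.1 p.1.2)
      ((Set.univ ×ˢ sphere 0 R₂) ×ˢ sphere 0 R₁) :=
  ((ContinuousOn.div (by fun_prop) (by fun_prop) fun p hp =>
    one_sub_sub_ne_zero_on_spheres h (p.1.2, p.2) ⟨hp.1.2, hp.2⟩).mul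
    (hF.comp (f := fun p : (ℝ × ℂ) × ℂ => (p.1.1, p.2)) (by fun_prop)
      fun p hp => ⟨Set.mem_univ _, hp.2⟩)).mul
    (hG.comp (f := fun p : (ℝ × ℂ) × ℂ => p.1) (by fun_prop) fun p hp => hp.1)

lemma hasDerivAt_doubleContour (hR₁ : 0 ≤ R₁) (hR₂ : 0 ≤ R₂) (h : 1 < |R₁ - R₂|)
    {F F' G G' : ℝ → ℂ → ℂ} (hF : ContinuousOn F.uncurry (Set.univ ×ˢ sphere 0 R₁))
    (hF' : ContinuousOn F'.uncurry (Set.univ ×ˢ sphere 0 R₁))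
    (hG : ContinuousOn G.uncurry (Set.univ ×ˢ sphere 0 R₂))
    (hG' : ContinuousOn G'.uncurry (Set.univ ×ˢ sphere 0 R₂))
    (hdF : ∀ t, ∀ w ∈ sphere (0 : ℂ) R₁, HasDerivAt (fun s => F s w) (F' t w) t)
    (hdG : ∀ t, ∀ u ∈ sphere (0 : ℂ) R₂, HasDerivAt (fun s => G s u) (G' t u) t) (t : ℝ) :
    HasDerivAt (fun s => doubleContour R₁ R₂ (F s) (G s))
      (doubleContour R₁ R₂ (F' t) (G t) + doubleContour R₁ R₂ (F t) (G' t)) t := by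
  have hslice : ∀ {ρ : ℝ} {H : ℝ → ℂ → ℂ}, ContinuousOn H.uncurry (Set.univ ×ˢ sphere 0 ρ) →
      ∀ s, ContinuousOn (H s) (sphere 0 ρ) := fun hH s =>
    hH.comp (f := fun z => (s, z)) (by fun_prop) fun z hz => ⟨Set.mem_univ _, hz⟩
  let D : ℝ → ℂ → ℂ → ℂ := fun s u w =>
    (u - w) / (1 - u - w) * F' s w * G s u + (u - w) / (1 - u - w) * F s w * G' s u
  have hD : ContinuousOn (fun p : (ℝ × ℂ) × ℂ => D p.1.1 p.1.2 p.2)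
      ((Set.univ ×ˢ sphere 0 R₂) ×ˢ sphere 0 R₁) :=
    (continuousOn_doubleContour_integrand_time h hF' hG).fun_add
      (continuousOn_doubleContour_integrand_time h hF hG')
  have hinner : ∀ s, ∀ u ∈ sphere (0 : ℂ) R₂, HasDerivAt
      (fun s => contour R₁ fun w => (u - w) / (1 - u - w) * F s w * G s u)
      (contour R₁ (D s u)) s := fun s u hu => by
    refine hasDerivAt_contour hR₁ (F' := fun s => D s u)
      (fun s => continuousOn_doubleContour_slice h (hslice hF s) (hslice hG s) (by simpa using hu))
      ?_ (fun s w hw => ?_) s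
    · exact hD.comp (f := fun p : ℝ × ℂ => ((p.1, u), p.2)) (by fun_prop)
        fun p hp => ⟨⟨Set.mem_univ _, hu⟩, hp.2⟩
    · exact ((hdF s w hw).const_mul _).mul (hdG s u hu)
  have houter := hasDerivAt_contour hR₂
    (F := fun s u => contour R₁ fun w => (u - w) / (1 - u - w) * F s w * G s u)
    (F' := fun s u => contour R₁ (D s u))
    (fun s => continuousOn_doubleContour_inner hR₁ h (hslice hF s) (hslice hG s))
    (continuousOn_contour hR₁ (K := fun (p : ℝ × ℂ) w => D p.1 p.2 w) hD) hinner t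
  refine houter.congr_deriv ?_
  unfold doubleContour
  rw [← contour_add hR₂ (continuousOn_doubleContour_inner hR₁ h (hslice hF' t) (hslice hG t))
    (continuousOn_doubleContour_inner hR₁ h (hslice hF t) (hslice hG' t))]
  exact contour_congr hR₂ fun u hu => contour_add hR₁
    (continuousOn_doubleContour_slice h (hslice hF' t) (hslice hG t) hu)
    (continuousOn_doubleContour_slice h (hslice hF t) (hslice hG' t) hu)

end DoubleContourLinear

section Functionals

open Metric

lemma weight_succ (α t : ℝ) (i : ℕ) (a : ℤ) {w : ℂ} (h0 : w ≠ 0) :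
    weight α t (i + 1) a w = w / (w - 1) * weight α t i a w := by
  unfold weight
  rw [show ((i + 1 : ℕ) : ℤ) - a = ((i : ℤ) - a) + 1 by push_cast; ring, zpow_add_one₀ h0, pow_succ,
    ← mul_assoc, mul_comm _ (w - 1), div_mul_div_comm]
  ring

lemma weight_sub_weight_succ (α t : ℝ) (i : ℕ) (a : ℤ) {w : ℂ} (h0 : w ≠ 0) (h1 : w ≠ 1) :
    weight α t (i + 1) a w - weight α t (i + 1) (a + 1) w = weight α t i a w := by
  have := sub_ne_zero.2 h1
  rw [weight_succ _ _ _ _ h0, weight_succ _ _ _ _ h0, weight, weight,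
    show (i : ℤ) - a = (i - (a + 1)) + 1 by ring, zpow_add_one₀ h0]
  field_simp

lemma weight_pred (α t : ℝ) (i : ℕ) (a : ℤ) {w : ℂ} (h0 : w ≠ 0) :
    weight α t i (a - 1) w - weight α t i a w = (w - 1) * weight α t i a w := by
  unfold weight
  rw [show (i : ℤ) - (a - 1) = ((i : ℤ) - a) + 1 by ring, zpow_add_one₀ h0]
  ring

lemma weight_one_sub (α t : ℝ) {w : ℂ} (hα : w ≠ α) :
    weight α t 1 0 w - α * weight α t 1 1 w = Complex.exp (t * (w - 1)) / (w - 1) := by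
  have := sub_ne_zero.2 hα
  unfold weight
  simp only [Nat.cast_one, sub_zero, zpow_one, sub_self, zpow_zero, pow_one, one_mul]
  rw [← mul_div_assoc, ← sub_div, ← mul_div_mul_left _ (w - 1) this]
  ring

lemma weight_eq_mul_exp (α t : ℝ) (i : ℕ) (a : ℤ) (w : ℂ) :
    weight α t i a w = weight α 0 i a w * Complex.exp (t * (w - 1)) := by
  unfold weight
  simp only [Complex.ofReal_zero, zero_mul, Complex.exp_zero, mul_one]
  ring

lemma hasDerivAt_weight (α t : ℝ) (i : ℕ) (a : ℤ) {w : ℂ} (h0 : w ≠ 0) :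
    HasDerivAt (fun s : ℝ => weight α s i a w)
      (weight α t i (a - 1) w - weight α t i a w) t := by
  have hexp : HasDerivAt (fun s : ℝ => (s : ℂ) * (w - 1)) (w - 1) t := by
    simpa using (Complex.ofRealCLM.hasDerivAt (x := t)).mul_const (w - 1)
  rw [weight_pred α t i a h0, weight_eq_mul_exp α t i a w,
    funext fun s : ℝ => weight_eq_mul_exp α s i a w]
  exact (hexp.cexp.const_mul (weight α 0 i a w)).congr_deriv (by ring)

lemma continuousOn_weight_time {α R : ℝ} (hR : max 1 |α| < R) (i : ℕ) (a : ℤ) :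
    ContinuousOn (fun s => weight α s i a).uncurry (Set.univ ×ˢ sphere 0 R) := by
  have h0 : ContinuousOn (fun p : ℝ × ℂ => weight α 0 i a p.2) (Set.univ ×ˢ sphere 0 R) :=
    (continuousOn_weight hR 0 i a).comp continuousOn_snd fun _ hp => hp.2
  refine (h0.mul (by fun_prop : Continuous fun p : ℝ × ℂ =>
    Complex.exp (p.1 * (p.2 - 1))).continuousOn).congr fun p _ => ?_
  exact weight_eq_mul_exp α p.1 i a p.2

/-- The region outside all poles of the functions `weight α t i a`, which contains the contours. -/
def exterior (α : ℝ) : Set ℂ := {w | max 1 |α| < ‖w‖}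

/-- Extension by zero. The form and the functionals below only see the values in the exterior. -/
noncomputable def extendByZero (α : ℝ) : C(exterior α, ℂ) →ₗ[ℂ] ℂ → ℂ :=
  Function.ExtendByZero.linearMap ℂ Subtype.val ∘ₗ ContinuousMap.coeFnLinearMap ℂ

variable {α : ℝ}

lemma extendByZero_apply (f : C(exterior α, ℂ)) {w : ℂ} (hw : w ∈ exterior α) :
    extendByZero α f w = f ⟨w, hw⟩ :=
  Subtype.val_injective.extend_apply f 0 ⟨w, hw⟩

lemma sphere_subset_exterior {R : ℝ} (hR : max 1 |α| < R) : sphere 0 R ⊆ exterior α :=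
  fun w hw => by rwa [exterior, Set.mem_ofPred_eq, mem_sphere_zero_iff_norm.1 hw]

lemma continuousOn_extendByZero (f : C(exterior α, ℂ)) {R : ℝ} (hR : max 1 |α| < R) :
    ContinuousOn (extendByZero α f) (sphere 0 R) := by
  refine ContinuousOn.mono ?_ (sphere_subset_exterior hR)
  rw [continuousOn_iff_continuous_domRestrict]
  exact f.continuous.congr fun w => (extendByZero_apply f w.2).symm

/-- The function `weight α t i a` on the exterior region. -/
noncomputable def weightVec (α t : ℝ) (i : ℕ) (a : ℤ) : C(exterior α, ℂ) where
  toFun w := weight α t i a w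
  continuous_toFun := continuous_iff_continuousAt.2 fun w =>
    (differentiableAt_weight t i a w.2).continuousAt.comp continuousAt_subtype_val

lemma extendByZero_weightVec {R : ℝ} (hR : max 1 |α| < R) (t : ℝ) (i : ℕ) (a : ℤ) {w : ℂ}
    (hw : ‖w‖ = R) : extendByZero α (weightVec α t i a) w = weight α t i a w :=
  extendByZero_apply _ (sphere_subset_exterior hR (by simpa using hw))

lemma weightVec_sub_weightVec_succ (t : ℝ) (i : ℕ) (a : ℤ) :
    weightVec α t (i + 1) a - weightVec α t (i + 1) (a + 1) = weightVec α t i a := by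
  ext w
  obtain ⟨h0, h1, -⟩ := ne_of_max_lt_norm w.2
  exact weight_sub_weight_succ α t i a h0 h1

/-- Two nested contours in the exterior region, so far apart that `u + w ≠ 1` for `w` on the inner
and `u` on the outer one. -/
structure ContourRadii (α : ℝ) where
  /-- The radius of the inner contour. -/
  inner : ℝ
  /-- The radius of the outer contour. -/
  outer : ℝ
  max_lt_inner : max 1 |α| < inner
  inner_add_one_lt_outer : inner + 1 < outer

namespace ContourRadii

variable (ρ : ContourRadii α)

lemma max_lt_outer : max 1 |α| < ρ.outer := by
  linarith [ρ.max_lt_inner, ρ.inner_add_one_lt_outer]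

lemma one_lt_abs_sub : 1 < |ρ.inner - ρ.outer| := by
  rw [abs_sub_comm]
  exact (lt_sub_iff_add_lt'.2 ρ.inner_add_one_lt_outer).trans_le (le_abs_self _)

lemma inner_nonneg : 0 ≤ ρ.inner := (pos_of_max_one_lt ρ.max_lt_inner).le

lemma outer_nonneg : 0 ≤ ρ.outer := (pos_of_max_one_lt ρ.max_lt_outer).le

end ContourRadii

variable (ρ : ContourRadii α)

/-- The functional `f ↦ ∮ f(w) dw / (2 π i)` over the inner contour; it gives the kernel `p`. -/
noncomputable def contourDual : Module.Dual ℂ C(exterior α, ℂ) where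
  toFun f := contour ρ.inner (extendByZero α f)
  map_add' f g := by
    rw [map_add]
    exact contour_add ρ.inner_nonneg (continuousOn_extendByZero f ρ.max_lt_inner)
      (continuousOn_extendByZero g ρ.max_lt_inner)
  map_smul' c f := by
    rw [map_smul]
    exact contour_const_mul _ c _

lemma continuousOn_moment {R : ℝ} (hR : max 1 |α| < R) (e : ℕ) (m : ℤ) {f : ℂ → ℂ}
    (hf : ContinuousOn f (sphere 0 R)) :
    ContinuousOn (fun w => (w - α) * (w - 1) ^ e * w ^ m * f w) (sphere 0 R) :=
  (ContinuousOn.mul (by fun_prop) (continuousOn_id.zpow₀ m fun w hw =>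
    Or.inl (ne_of_max_lt_norm (sphere_subset_exterior hR hw)).1)).mul hf

/-- The functional `f ↦ ∮ f(w) (w - α) (w - 1)^e w^m dw / (2 π i)` over the inner contour; it gives
the kernels `U`. -/
noncomputable def momentDual (e : ℕ) (m : ℤ) : Module.Dual ℂ C(exterior α, ℂ) where
  toFun f := contour ρ.inner fun w => (w - α) * (w - 1) ^ e * w ^ m * extendByZero α f w
  map_add' f g := by
    rw [← contour_add ρ.inner_nonneg
      (continuousOn_moment ρ.max_lt_inner e m (continuousOn_extendByZero f ρ.max_lt_inner))
      (continuousOn_moment ρ.max_lt_inner e m (continuousOn_extendByZero g ρ.max_lt_inner))]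
    simp only [map_add, Pi.add_apply, mul_add]
  map_smul' c f := by
    rw [RingHom.id_apply, smul_eq_mul, ← contour_const_mul]
    simp only [map_smul, Pi.smul_apply, smul_eq_mul, mul_left_comm]

/-- The double contour integral of `Q` as a form, without the factor `α²`; it is alternating only
on suitable functions. -/
noncomputable def doubleContourForm :
    C(exterior α, ℂ) →ₗ[ℂ] C(exterior α, ℂ) →ₗ[ℂ] ℂ :=
  LinearMap.mk₂ ℂ
    (fun f g => doubleContour ρ.inner ρ.outer (extendByZero α f) (extendByZero α g))
    (fun f f' g => by
      rw [map_add]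
      exact doubleContour_add_left ρ.inner_nonneg ρ.outer_nonneg ρ.one_lt_abs_sub
        (continuousOn_extendByZero f ρ.max_lt_inner) (continuousOn_extendByZero f' ρ.max_lt_inner)
        (continuousOn_extendByZero g ρ.max_lt_outer))
    (fun c f g => by
      rw [map_smul]
      exact doubleContour_const_mul_left c)
    (fun f g g' => by
      rw [map_add]
      exact doubleContour_add_right ρ.inner_nonneg ρ.outer_nonneg ρ.one_lt_abs_sub
        (continuousOn_extendByZero f ρ.max_lt_inner) (continuousOn_extendByZero g ρ.max_lt_outer)
        (continuousOn_extendByZero g' ρ.max_lt_outer))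
    (fun c f g => by
      rw [map_smul]
      exact doubleContour_const_mul_right c)

/-- The alternating form of the Pfaffian: the antisymmetrization of the double contour integral. -/
noncomputable def qForm : C(exterior α, ℂ) →ₗ[ℂ] C(exterior α, ℂ) →ₗ[ℂ] ℂ :=
  ((α : ℂ) ^ 2 / 2) • (doubleContourForm ρ - (doubleContourForm ρ).flip)

lemma qForm_apply (f g : C(exterior α, ℂ)) : qForm ρ f g =
    (α : ℂ) ^ 2 / 2 * (doubleContourForm ρ f g - doubleContourForm ρ g f) := rfl

lemma qForm_isAlt : (qForm ρ).IsAlt := fun f => by rw [qForm_apply, sub_self, mul_zero]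

lemma contourDual_weightVec (t : ℝ) (i : ℕ) (a : ℤ) :
    contourDual ρ (weightVec α t i a) = contour ρ.inner (weight α t i a) :=
  contour_congr ρ.inner_nonneg fun _ hw => extendByZero_weightVec ρ.max_lt_inner t i a hw

lemma doubleContourForm_weightVec (t : ℝ) (i j : ℕ) (a b : ℤ) :
    doubleContourForm ρ (weightVec α t i a) (weightVec α t j b) =
      doubleContour ρ.inner ρ.outer (weight α t i a) (weight α t j b) :=
  doubleContour_congr ρ.inner_nonneg ρ.outer_nonneg
    (fun _ hw => extendByZero_weightVec ρ.max_lt_inner t i a hw)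
    (fun _ hu => extendByZero_weightVec ρ.max_lt_outer t j b hu)

lemma qForm_weightVec_eq_Qker (t : ℝ) (i j : ℕ) {a b : ℤ} (hab : 1 ≤ a + b) :
    qForm ρ (weightVec α t i a) (weightVec α t j b) =
      Qker α t ρ.inner ρ.outer i j a b := by
  have hskew := Qker_skew ρ.max_lt_inner ρ.max_lt_outer ρ.one_lt_abs_sub t i j hab
  rw [Qker_eq_doubleContour, Qker_eq_doubleContour] at hskew
  rw [qForm_apply, doubleContourForm_weightVec, doubleContourForm_weightVec, Qker_eq_doubleContour]
  linear_combination -hskew / 2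

lemma doubleContourForm_succ_succ (t : ℝ) (i j : ℕ) (a b : ℤ) :
    doubleContourForm ρ (weightVec α t (i + 1) a) (weightVec α t (j + 1) b) =
      doubleContourForm ρ (weightVec α t i a) (weightVec α t j b) +
        (contourDual ρ (weightVec α t i a) * contourDual ρ (weightVec α t (j + 1) b) -
          contourDual ρ (weightVec α t (i + 1) a) * contourDual ρ (weightVec α t j b)) := by
  have hsucc : ∀ {R : ℝ}, max 1 |α| < R → ∀ (i : ℕ) (a : ℤ) (w : ℂ), ‖w‖ = R →
      weight α t (i + 1) a w = w / (w - 1) * weight α t i a w := fun hR i a w hw =>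
    weight_succ α t i a (ne_of_max_lt_norm (hw ▸ hR)).1
  have houter : ∀ (j : ℕ) (b : ℤ),
      contourDual ρ (weightVec α t j b) = contour ρ.outer (weight α t j b) := fun j b => by
    rw [contourDual_weightVec, contour_weight_eq_of_radii ρ.max_lt_inner ρ.max_lt_outer]
  have hone := (le_max_left 1 |α|).trans_lt ρ.max_lt_inner
  rw [doubleContourForm_weightVec, doubleContourForm_weightVec, houter j, houter (j + 1),
    contourDual_weightVec, contourDual_weightVec,
    doubleContour_congr ρ.inner_nonneg ρ.outer_nonneg (hsucc ρ.max_lt_inner i a)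
      (hsucc ρ.max_lt_outer j b),
    contour_congr ρ.inner_nonneg (hsucc ρ.max_lt_inner i a),
    contour_congr ρ.outer_nonneg (hsucc ρ.max_lt_outer j b)]
  exact doubleContour_ratio_mul hone ((le_max_left 1 |α|).trans_lt ρ.max_lt_outer)
    ρ.one_lt_abs_sub (continuousOn_weight ρ.max_lt_inner t i a)
    (continuousOn_weight ρ.max_lt_outer t j b)

lemma qForm_succ_succ (t : ℝ) (i j : ℕ) (a b : ℤ) :
    qForm ρ (weightVec α t (i + 1) a) (weightVec α t (j + 1) b) =
      qForm ρ (weightVec α t i a) (weightVec α t j b) - (α : ℂ) ^ 2 *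
        (contourDual ρ (weightVec α t (i + 1) a) * contourDual ρ (weightVec α t j b) -
          contourDual ρ (weightVec α t i a) * contourDual ρ (weightVec α t (j + 1) b)) := by
  rw [qForm_apply, qForm_apply, doubleContourForm_succ_succ, doubleContourForm_succ_succ]
  ring

/-- The function `e^{t(w-1)} / (w-1)`. The row of a virtual particle at `0` is `α` times that of a
particle at `1` plus this vector. -/
noncomputable def wallVec (α t : ℝ) : C(exterior α, ℂ) :=
  weightVec α t 1 0 - (α : ℂ) • weightVec α t 1 1

lemma extendByZero_wallVec {R : ℝ} (hR : max 1 |α| < R) (t : ℝ) {w : ℂ} (hw : ‖w‖ = R) :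
    extendByZero α (wallVec α t) w = Complex.exp (t * (w - 1)) / (w - 1) := by
  rw [wallVec, map_sub, map_smul, Pi.sub_apply, Pi.smul_apply, smul_eq_mul,
    extendByZero_weightVec hR t 1 0 hw, extendByZero_weightVec hR t 1 1 hw,
    weight_one_sub α t (ne_of_max_lt_norm (hw ▸ hR)).2.2]

lemma contourDual_wallVec (t : ℝ) : contourDual ρ (wallVec α t) = 1 := by
  have hone := (le_max_left 1 |α|).trans_lt ρ.max_lt_inner
  calc contourDual ρ (wallVec α t)
      = contour ρ.inner fun w => Complex.exp (t * (w - 1)) / (w - 1) :=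
        contour_congr ρ.inner_nonneg fun _ hw => extendByZero_wallVec ρ.max_lt_inner t hw
    _ = Complex.exp (t * (1 - 1)) :=
        contour_div_sub (by rwa [norm_one]) fun w _ => by fun_prop
    _ = 1 := by simp

lemma doubleContourForm_wallVec (t : ℝ) (j : ℕ) (b : ℤ) :
    doubleContourForm ρ (wallVec α t) (weightVec α t (j + 1) b) =
      -contourDual ρ (weightVec α t j b) := by
  have hone := (le_max_left 1 |α|).trans_lt ρ.max_lt_inner
  calc doubleContourForm ρ (wallVec α t) (weightVec α t (j + 1) b)
      = doubleContour ρ.inner ρ.outer (fun w => Complex.exp (t * (w - 1)) / (w - 1))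
          (fun u => u / (u - 1) * weight α t j b u) :=
        doubleContour_congr ρ.inner_nonneg ρ.outer_nonneg
          (fun _ hw => extendByZero_wallVec ρ.max_lt_inner t hw) fun u hu => by
            rw [extendByZero_weightVec ρ.max_lt_outer _ _ _ hu,
              weight_succ _ _ _ _ (ne_of_max_lt_norm (hu ▸ ρ.max_lt_outer)).1]
    _ = -(Complex.exp (t * (1 - 1)) * contour ρ.outer (weight α t j b)) :=
        doubleContour_div_sub_one hone ρ.inner_add_one_lt_outer fun w _ => by fun_prop
    _ = -contourDual ρ (weightVec α t j b) := by
        rw [contourDual_weightVec, contour_weight_eq_of_radii ρ.max_lt_inner ρ.max_lt_outer,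
          sub_self, mul_zero, Complex.exp_zero, one_mul]

lemma qForm_wallVec (t : ℝ) (j : ℕ) {b : ℤ} (hb : 1 ≤ b) :
    qForm ρ (weightVec α t (j + 1) b) (wallVec α t) =
      (α : ℂ) ^ 2 * contourDual ρ (weightVec α t j b) := by
  have hQ : ∀ a : ℤ, 0 ≤ a → qForm ρ (weightVec α t 1 a) (weightVec α t (j + 1) b) =
      (α : ℂ) ^ 2 * doubleContourForm ρ (weightVec α t 1 a) (weightVec α t (j + 1) b) :=
    fun a ha => by
      rw [qForm_weightVec_eq_Qker ρ t _ _ (by omega), Qker_eq_doubleContour,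
        doubleContourForm_weightVec]
  have hwall := doubleContourForm_wallVec ρ t j b
  rw [wallVec, map_sub, map_smul, LinearMap.sub_apply, LinearMap.smul_apply, smul_eq_mul] at hwall
  rw [← (qForm_isAlt ρ).neg, wallVec, map_sub, map_smul, LinearMap.sub_apply,
    LinearMap.smul_apply, smul_eq_mul, hQ 0 le_rfl, hQ 1 zero_le_one]
  linear_combination -(α : ℂ) ^ 2 * hwall

lemma momentDual_weightVec (e : ℕ) (m : ℤ) (t : ℝ) (i : ℕ) (a : ℤ) :
    momentDual ρ e m (weightVec α t i a) = contour ρ.inner fun w =>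
      (w - 1) ^ ((e : ℤ) - i) * Complex.exp (t * (w - 1)) * w ^ (m + i - a) := by
  refine contour_congr ρ.inner_nonneg fun w hw => ?_
  obtain ⟨h0, h1, hα⟩ := ne_of_max_lt_norm (hw ▸ ρ.max_lt_inner)
  have := sub_ne_zero.2 h1
  have := sub_ne_zero.2 hα
  rw [extendByZero_weightVec ρ.max_lt_inner t i a hw, show m + i - a = m + ((i : ℤ) - a) by ring,
    zpow_add₀ h0 m, zpow_sub₀ (sub_ne_zero.2 h1), zpow_natCast, zpow_natCast, weight]
  field_simp

lemma momentDual_succ (e : ℕ) (m : ℤ) (t : ℝ) (i : ℕ) (a : ℤ) :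
    momentDual ρ (e + 1) m (weightVec α t (i + 1) a) =
      momentDual ρ e (m + 1) (weightVec α t i a) := by
  simp only [momentDual_weightVec, Nat.cast_add, Nat.cast_one, add_sub_add_right_eq_sub,
    add_assoc, add_comm (1 : ℤ)]

lemma momentDual_wallVec (e : ℕ) {m : ℤ} (hm : 0 ≤ m) (t : ℝ) :
    momentDual ρ (e + 1) m (wallVec α t) = 0 := by
  obtain ⟨k, rfl⟩ := Int.eq_ofNat_of_zero_le hm
  refine (contour_congr ρ.inner_nonneg fun w hw => ?_).trans
    (contour_eq_zero_of_disc ρ.inner_nonneg (f := fun w : ℂ =>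
      (w - α) * (w - 1) ^ e * w ^ k * Complex.exp (t * (w - 1))) fun w _ => by fun_prop)
  have := sub_ne_zero.2 (ne_of_max_lt_norm (hw ▸ ρ.max_lt_inner)).2.1
  rw [extendByZero_wallVec ρ.max_lt_inner t hw, zpow_natCast, pow_succ]
  field_simp

lemma contourDual_time_zero (i : ℕ) {a : ℤ} (ha : 1 ≤ a) :
    contourDual ρ (weightVec α 0 i a) = 0 := by
  rw [contourDual_weightVec, contour_weight_time_zero ρ.max_lt_inner i ha]

lemma qForm_time_zero (i j : ℕ) {a b : ℤ} (ha : 1 ≤ a) (hb : 1 ≤ b) :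
    qForm ρ (weightVec α 0 i a) (weightVec α 0 j b) = 0 := by
  rw [qForm_weightVec_eq_Qker ρ 0 i j (by omega),
    Qker_time_zero ρ.max_lt_inner ρ.inner_add_one_lt_outer i j ha hb]

lemma extendByZero_sub_weightVec {R : ℝ} (hR : max 1 |α| < R) (t : ℝ) (i : ℕ) (a : ℤ) {w : ℂ}
    (hw : ‖w‖ = R) : extendByZero α (weightVec α t i (a - 1) - weightVec α t i a) w =
      weight α t i (a - 1) w - weight α t i a w := by
  rw [map_sub, Pi.sub_apply, extendByZero_weightVec hR _ _ _ hw, extendByZero_weightVec hR _ _ _ hw]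

lemma hasDerivAt_weight_of_mem_sphere {R : ℝ} (hR : max 1 |α| < R) (i : ℕ) (a : ℤ) (t : ℝ) :
    ∀ w ∈ sphere (0 : ℂ) R, HasDerivAt (fun s => weight α s i a w)
      (weight α t i (a - 1) w - weight α t i a w) t := fun _ hw =>
  hasDerivAt_weight α t i a (ne_of_max_lt_norm (sphere_subset_exterior hR hw)).1

lemma continuousOn_weight_sub_time {R : ℝ} (hR : max 1 |α| < R) (i : ℕ) (a : ℤ) :
    ContinuousOn (fun s w => weight α s i (a - 1) w - weight α s i a w).uncurry
      (Set.univ ×ˢ sphere 0 R) :=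
  (continuousOn_weight_time hR i (a - 1)).sub (continuousOn_weight_time hR i a)

lemma hasDerivAt_contourDual (t : ℝ) (i : ℕ) (a : ℤ) :
    HasDerivAt (fun s => contourDual ρ (weightVec α s i a))
      (contourDual ρ (weightVec α t i (a - 1) - weightVec α t i a)) t := by
  have hmax := ρ.max_lt_inner
  simp only [contourDual_weightVec]
  exact (hasDerivAt_contour ρ.inner_nonneg (fun s => continuousOn_weight hmax s i a)
    (continuousOn_weight_sub_time hmax i a) (fun s => hasDerivAt_weight_of_mem_sphere hmax i a s)
    t).congr_deriv <| contour_congr ρ.inner_nonneg fun w hw =>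
      (extendByZero_sub_weightVec hmax t i a hw).symm

lemma hasDerivAt_momentDual (e : ℕ) (m : ℤ) (t : ℝ) (i : ℕ) (a : ℤ) :
    HasDerivAt (fun s => momentDual ρ e m (weightVec α s i a))
      (momentDual ρ e m (weightVec α t i (a - 1) - weightVec α t i a)) t := by
  have hmax := ρ.max_lt_inner
  have hmoment : ContinuousOn (fun w : ℂ => (w - α) * (w - 1) ^ e * w ^ m)
      (sphere 0 ρ.inner) := by
    simpa only [mul_one] using continuousOn_moment hmax e m (f := fun _ => 1) continuousOn_const
  have hderiv := hasDerivAt_contour ρ.inner_nonneg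
    (F := fun s w => (w - α) * (w - 1) ^ e * w ^ m * weight α s i a w)
    (F' := fun s w =>
      (w - α) * (w - 1) ^ e * w ^ m * (weight α s i (a - 1) w - weight α s i a w))
    (fun s => continuousOn_moment hmax e m (continuousOn_weight hmax s i a))
    ((hmoment.comp continuousOn_snd fun _ hp => hp.2).mul (continuousOn_weight_sub_time hmax i a))
    (fun s w hw => (hasDerivAt_weight_of_mem_sphere hmax i a s w hw).const_mul _) t
  refine (hderiv.congr_deriv <| contour_congr ρ.inner_nonneg fun w hw =>
    congrArg _ (extendByZero_sub_weightVec hmax t i a hw).symm).congr_of_eventuallyEq ?_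
  exact .of_forall fun s => contour_congr ρ.inner_nonneg fun w hw =>
    congrArg _ (extendByZero_weightVec hmax s i a hw)

lemma hasDerivAt_doubleContourForm (t : ℝ) (i j : ℕ) (a b : ℤ) :
    HasDerivAt (fun s => doubleContourForm ρ (weightVec α s i a) (weightVec α s j b))
      (doubleContourForm ρ (weightVec α t i (a - 1) - weightVec α t i a) (weightVec α t j b) +
        doubleContourForm ρ (weightVec α t i a)
          (weightVec α t j (b - 1) - weightVec α t j b)) t := by
  have hin := ρ.max_lt_inner
  have hout := ρ.max_lt_outer
  simp only [doubleContourForm_weightVec]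
  refine (hasDerivAt_doubleContour ρ.inner_nonneg ρ.outer_nonneg ρ.one_lt_abs_sub
    (continuousOn_weight_time hin i a) (continuousOn_weight_sub_time hin i a)
    (continuousOn_weight_time hout j b) (continuousOn_weight_sub_time hout j b)
    (fun s => hasDerivAt_weight_of_mem_sphere hin i a s)
    (fun s => hasDerivAt_weight_of_mem_sphere hout j b s) t).congr_deriv (congrArg₂ _ ?_ ?_)
  · exact doubleContour_congr ρ.inner_nonneg ρ.outer_nonneg
      (fun w hw => (extendByZero_sub_weightVec hin t i a hw).symm)
      (fun u hu => (extendByZero_weightVec hout t j b hu).symm)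
  · exact doubleContour_congr ρ.inner_nonneg ρ.outer_nonneg
      (fun w hw => (extendByZero_weightVec hin t i a hw).symm)
      (fun u hu => (extendByZero_sub_weightVec hout t j b hu).symm)

lemma hasDerivAt_qForm (t : ℝ) (i j : ℕ) (a b : ℤ) :
    HasDerivAt (fun s => qForm ρ (weightVec α s i a) (weightVec α s j b))
      (qForm ρ (weightVec α t i (a - 1) - weightVec α t i a) (weightVec α t j b) +
        qForm ρ (weightVec α t i a) (weightVec α t j (b - 1) - weightVec α t j b)) t := by
  simp only [qForm_apply]
  refine (((hasDerivAt_doubleContourForm ρ t i j a b).sub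
    (hasDerivAt_doubleContourForm ρ t j i b a)).const_mul _).congr_deriv ?_
  ring

end Functionals

/-! ### Evolution equation and boundary conditions of the Pfaffian -/

section Dynamics

lemma rowSeq_update {F : Type*} [AddCommGroup F] [Module ℂ F] {N j : ℕ} (hj : j < N) (f : ℕ → F)
    (φ : ℕ → Module.Dual ℂ F) (v : F) :
    rowSeq N (Function.update f j v) φ = Function.update (rowSeq N f φ) j (v, 0) := by
  funext i
  obtain rfl | hi := eq_or_ne i j
  · simp [rowSeq, hj]
  · simp [rowSeq, hi]

lemma pfRow_update_sub {F : Type*} [AddCommGroup F] [Module ℂ F] (B : F →ₗ[ℂ] F →ₗ[ℂ] ℂ)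
    {n N j : ℕ} (hN : N ≤ 2 * n) (hj : j < N) (f : ℕ → F) (φ : ℕ → Module.Dual ℂ F) (v w : F) :
    pfRow B n N (Function.update f j (v - w)) φ =
      pfRow B n N (Function.update f j v) φ - pfRow B n N (Function.update f j w) φ := by
  simp only [pfRow, rowSeq_update hj]
  rw [eq_sub_iff_add_eq, ← pfSeq_update_add _ _ (hj.trans_le hN), Prod.mk_add_mk, sub_add_cancel,
    add_zero]

lemma pfRow_update_smul {F : Type*} [AddCommGroup F] [Module ℂ F] (B : F →ₗ[ℂ] F →ₗ[ℂ] ℂ)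
    {n N j : ℕ} (hN : N ≤ 2 * n) (hj : j < N) (f : ℕ → F) (φ : ℕ → Module.Dual ℂ F) (c : ℂ)
    (v : F) :
    pfRow B n N (Function.update f j (c • v)) φ = c * pfRow B n N (Function.update f j v) φ := by
  simp only [pfRow, rowSeq_update hj]
  rw [← pfSeq_update_smul _ _ (hj.trans_le hN), Prod.smul_mk, smul_zero]

/-- The rows `weightVec α t (i + 1) (a i)` of the Pfaffian for particles at `a 0, a 1, …`. -/
noncomputable def rowVec (α t : ℝ) (a : ℕ → ℤ) : ℕ → C(exterior α, ℂ) :=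
  fun i => weightVec α t (i + 1) (a i)

lemma rowVec_update (α t : ℝ) (a : ℕ → ℤ) (j : ℕ) (b : ℤ) :
    rowVec α t (Function.update a j b) =
      Function.update (rowVec α t a) j (weightVec α t (j + 1) b) := by
  funext i
  obtain rfl | hi := eq_or_ne i j
  · simp [rowVec]
  · simp [rowVec, hi]

variable {α : ℝ} (ρ : ContourRadii α) {M N : ℕ}

lemma hasDerivAt_pfRow {n : ℕ} (hN : N ≤ 2 * n) {ψ : ℕ → Module.Dual ℂ C(exterior α, ℂ)} (t : ℝ)
    (hψ : ∀ k i a, HasDerivAt (fun s => ψ k (weightVec α s i a))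
      (ψ k (weightVec α t i (a - 1) - weightVec α t i a)) t) (a : ℕ → ℤ) :
    HasDerivAt (fun s => pfRow (qForm ρ) n N (rowVec α s a) ψ)
      (∑ j ∈ Finset.range N,
        (pfRow (qForm ρ) n N (rowVec α t (Function.update a j (a j - 1))) ψ -
          pfRow (qForm ρ) n N (rowVec α t a) ψ)) t := by
  have hderiv := hasDerivAt_pfSeq (ω := extForm (qForm ρ)) (n := n)
    (u := fun s => rowSeq N (rowVec α s a) ψ) (t := t)
    (D := fun j => if j < N then
      (weightVec α t (j + 1) (a j - 1) - weightVec α t (j + 1) (a j), 0) else 0) fun j _ k _ => by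
    simp only [extForm_apply, rowSeq, rowVec]
    by_cases hj : j < N <;> by_cases hk : k < N
    · simpa [hj, hk] using hasDerivAt_qForm ρ t (j + 1) (k + 1) (a j) (a k)
    · simpa [hj, hk] using hψ (k - N) (j + 1) (a j)
    · simpa [hj, hk] using (hψ (j - N) (k + 1) (a k)).fun_neg
    · simpa [hj, hk] using hasDerivAt_const t (0 : ℂ)
  refine hderiv.congr_deriv ?_
  rw [← Finset.sum_subset (Finset.range_subset_range.2 hN)]
  · refine Finset.sum_congr rfl fun j hj => ?_
    have hj := Finset.mem_range.1 hj
    conv_rhs => rw [← Function.update_eq_self j (rowVec α t a)]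
    rw [rowVec_update, rowVec, ← pfRow_update_sub _ hN hj, if_pos hj, ← rowSeq_update hj]
    rfl
  · intro j hj hjN
    rw [if_neg (by simpa using hjN), ← zero_smul ℂ (0 : _ × _),
      pfSeq_update_smul _ _ (Finset.mem_range.1 hj), zero_mul]

lemma pfRow_update_of_eq {n : ℕ} (hN : N ≤ 2 * n) (ψ : ℕ → Module.Dual ℂ C(exterior α, ℂ)) (t : ℝ)
    {a : ℕ → ℤ} {j : ℕ} (hj : j + 1 < N) (h : a (j + 1) = a j + 1) :
    pfRow (qForm ρ) n N (rowVec α t (Function.update a (j + 1) (a (j + 1) - 1))) ψ =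
      pfRow (qForm ρ) n N (rowVec α t a) ψ := by
  conv_rhs => rw [← Function.update_eq_self (j + 1) a]
  rw [← sub_eq_zero, rowVec_update, rowVec_update, ← pfRow_update_sub _ hN hj, h,
    add_sub_cancel_right, weightVec_sub_weightVec_succ, pfRow, rowSeq_update hj]
  refine pfSeq_eq_zero_of_eq _ (i := j) (j := j + 1) (by omega) (by omega) (by omega) ?_
  rw [Function.update_self, Function.update_of_ne (by omega), rowSeq_of_lt _ _ (by omega)]
  rfl

/-- The functionals giving the matrix `U`, for `M` particles starting at `d 0, d 1, …`. -/
noncomputable def initDual (M N : ℕ) (d : ℕ → ℤ) (k : ℕ) : Module.Dual ℂ C(exterior α, ℂ) :=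
  momentDual ρ (N + k + 1 - M) (d k - k - N + M - 2)

/-- The functionals bordering the matrix of the form: those of `U`, preceded by that of `p` if
`N + M` is odd. -/
noncomputable def borderDual (M N : ℕ) (d : ℕ → ℤ) : ℕ → Module.Dual ℂ C(exterior α, ℂ) :=
  if Even (N + M) then initDual ρ M N d
  else consSeq ((α : ℂ) • contourDual ρ) (initDual ρ M N d)

/-- The Pfaffian of the theorem for `M` particles starting at `d 0 < d 1 < ⋯` and `N` particles at
`a 0 < a 1 < ⋯`. -/
noncomputable def transPf (t : ℝ) (M N : ℕ) (d a : ℕ → ℤ) : ℂ :=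
  pfRow (qForm ρ) ((N + M + 1) / 2) N (rowVec α t a) (borderDual ρ M N d)

lemma hasDerivAt_borderDual (t : ℝ) (M N : ℕ) (d : ℕ → ℤ) (k i : ℕ) (a : ℤ) :
    HasDerivAt (fun s => borderDual ρ M N d k (weightVec α s i a))
      (borderDual ρ M N d k (weightVec α t i (a - 1) - weightVec α t i a)) t := by
  unfold borderDual
  split_ifs
  · exact hasDerivAt_momentDual ρ _ _ t i a
  · cases k with
    | zero => exact (hasDerivAt_contourDual ρ t i a).const_mul (α : ℂ)
    | succ k => exact hasDerivAt_momentDual ρ _ _ t i a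

lemma initDual_succ (hM : M ≤ N + 1) (d : ℕ → ℤ) (k : ℕ) (t : ℝ) (i : ℕ) (a : ℤ) :
    initDual ρ M (N + 1) d k (weightVec α t (i + 1) a) =
      initDual ρ M N d k (weightVec α t i a) := by
  unfold initDual
  rw [show N + 1 + k + 1 - M = (N + k + 1 - M) + 1 by omega, momentDual_succ]
  congr 2
  push_cast
  ring

lemma initDual_wallVec (hM : M ≤ N + 1) {d : ℕ → ℤ} {k : ℕ} (hd : (N : ℤ) + 3 + k ≤ d k + M)
    (t : ℝ) : initDual ρ M (N + 1) d k (wallVec α t) = 0 := by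
  rw [initDual, show N + 1 + k + 1 - M = (N + k + 1 - M) + 1 by omega]
  exact momentDual_wallVec ρ _ (by push_cast; omega) t

lemma pfRow_update_wall {n : ℕ} (hN : N < 2 * n) (ψ : ℕ → Module.Dual ℂ C(exterior α, ℂ)) (t : ℝ)
    {a : ℕ → ℤ} (ha0 : a 0 = 1) :
    pfRow (qForm ρ) n (N + 1) (rowVec α t (Function.update a 0 (a 0 - 1))) ψ =
      α * pfRow (qForm ρ) n (N + 1) (rowVec α t a) ψ +
        pfRow (qForm ρ) n (N + 1)
          (consSeq (wallVec α t) fun i => weightVec α t (i + 2) (a (i + 1))) ψ := by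
  have hcons : consSeq (wallVec α t) (fun i => weightVec α t (i + 2) (a (i + 1))) =
      Function.update (rowVec α t a) 0 (weightVec α t 1 0 - (α : ℂ) • rowVec α t a 0) := by
    funext i
    cases i <;> simp [consSeq, rowVec, wallVec, ha0]
  rw [hcons, pfRow_update_sub _ hN N.succ_pos, pfRow_update_smul _ hN N.succ_pos,
    Function.update_eq_self, rowVec_update, ha0, sub_self, add_sub_cancel]

lemma pfRow_consSeq_wallVec (hM : M ≤ N + 1) {d : ℕ → ℤ}
    (hd : ∀ k < M, (N : ℤ) + 3 + k ≤ d k + M) (t : ℝ) {a : ℕ → ℤ} (ha : ∀ i < N, 1 ≤ a i) :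
    pfRow (qForm ρ) ((N + 1 + M + 1) / 2) (N + 1)
        (consSeq (wallVec α t) fun i => weightVec α t (i + 2) (a i)) (borderDual ρ M (N + 1) d) =
      (-1) ^ N * α * transPf ρ t M N d a := by
  have hwall (i) (hi : i < N) : qForm ρ (weightVec α t (i + 2) (a i)) (wallVec α t) =
      (α : ℂ) ^ 2 * contourDual ρ (rowVec α t a i) := qForm_wallVec ρ t (i + 1) (ha i hi)
  have hshift (i) (_ : i < N) (j) (_ : j < N) :=
    qForm_succ_succ ρ t (i + 1) (j + 1) (a i) (a j)
  have hinit (k) (_ : k < M) (i) (_ : i < N) := initDual_succ ρ hM d k t (i + 1) (a i)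
  have hinit_wall (k) (hk : k < M) := initDual_wallVec ρ hM (hd k hk) t
  rw [transPf]
  by_cases hpar : Even (N + M)
  · have hpar' : ¬ Even (N + 1 + M) := by
      rwa [add_right_comm, Nat.even_add_one, not_not]
    rw [borderDual, if_neg hpar', borderDual, if_pos hpar]
    obtain ⟨n, hn⟩ := hpar
    rw [show (N + 1 + M + 1) / 2 = n + 1 by omega, show (N + M + 1) / 2 = n by omega]
    exact pfRow_cons_cons_eq_of_shift (qForm_isAlt ρ) (by omega) hwall hshift hinit hinit_wall
      (contourDual_wallVec ρ t)
  · have hpar' : Even (N + 1 + M) := by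
      rwa [add_right_comm, Nat.even_add_one]
    rw [borderDual, if_pos hpar', borderDual, if_neg hpar]
    obtain ⟨n, hn⟩ := hpar'
    rw [show (N + 1 + M + 1) / 2 = n by omega, show (N + M + 1) / 2 = n by omega]
    exact pfRow_cons_eq_of_shift (qForm_isAlt ρ) (by omega) hwall hshift hinit hinit_wall

lemma transPf_update_wall (hM : M ≤ N + 1) {d : ℕ → ℤ}
    (hd : ∀ k < M, (N : ℤ) + 3 + k ≤ d k + M) (t : ℝ) {a : ℕ → ℤ}
    (ha0 : a 0 = 1) (ha : ∀ i < N, 1 ≤ a (i + 1)) :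
    transPf ρ t M (N + 1) d (Function.update a 0 (a 0 - 1)) =
      α * transPf ρ t M (N + 1) d a +
        (-1) ^ N * α * transPf ρ t M N d (fun i => a (i + 1)) := by
  rw [transPf, pfRow_update_wall ρ (by omega) _ t ha0, pfRow_consSeq_wallVec ρ hM hd t ha]
  rfl

lemma transPf_of_lt (h : N < M) (t : ℝ) (d a : ℕ → ℤ) : transPf ρ t M N d a = 0 := by
  refine pfSeq_eq_zero_of_isotropic _ _ ({i | (i : ℕ) < N} : Finset (Fin _))ᶜ ?_ ?_
  · rw [Finset.card_compl, Fin.card_filter_val_lt, Fintype.card_fin]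
    omega
  · intro i hi j hj
    rw [rowSeq_of_ge _ _ (by simpa using hi), rowSeq_of_ge _ _ (by simpa using hj)]
    simp [extForm_apply]

lemma transPf_time_zero_of_gt (h : M < N) (d : ℕ → ℤ) {a : ℕ → ℤ} (ha : ∀ i < N, 1 ≤ a i) :
    transPf ρ 0 M N d a = 0 := by
  set L := if Even (N + M) then N else N + 1 with hL
  refine pfSeq_eq_zero_of_isotropic _ _ {i | (i : ℕ) < L} ?_ ?_
  · rw [Fin.card_filter_val_lt]
    grind
  · intro i hi j hj
    have hlast : ∀ l < L, ¬ l < N →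
        rowSeq N (rowVec α 0 a) (borderDual ρ M N d) l = (0, (α : ℂ) • contourDual ρ) := by
      intro l hl hlN
      split_ifs at hL with hpar
      · omega
      · rw [rowSeq_of_ge _ _ (by omega), show l - N = 0 by omega, borderDual, if_neg hpar]
        rfl
    have hi : (i : ℕ) < L := by simpa using hi
    have hj : (j : ℕ) < L := by simpa using hj
    by_cases hiN : (i : ℕ) < N <;> by_cases hjN : (j : ℕ) < N
    · simp [rowSeq_of_lt _ _ hiN, rowSeq_of_lt _ _ hjN, extForm_apply, rowVec,
        qForm_time_zero ρ _ _ (ha i hiN) (ha j hjN)]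
    · simp [rowSeq_of_lt _ _ hiN, hlast _ hj hjN, extForm_apply, rowVec,
        contourDual_time_zero ρ _ (ha i hiN)]
    · simp [rowSeq_of_lt _ _ hjN, hlast _ hi hiN, extForm_apply, rowVec,
        contourDual_time_zero ρ _ (ha j hjN)]
    · simp [hlast _ hi hiN, hlast _ hj hjN, extForm_apply]

end Dynamics
/-! ### The initial condition -/

section InitialCondition

open Filter Topology

lemma contour_moment_eq_zero {R : ℝ} (hR : 1 < R) (e : ℤ) {z : ℤ} (hz : 1 ≤ z) :
    contour R (fun w => (w - 1) ^ e * w ^ (-z - 1 - e)) = 0 := by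
  have hne : ∀ w : ℂ, R ≤ ‖w‖ → w ≠ 0 ∧ w - 1 ≠ 0 := fun w hw =>
    ⟨norm_pos_iff.1 (by linarith), sub_ne_zero.2 fun h => by
      rw [h, norm_one] at hw; linarith⟩
  refine contour_eq_zero_of_decay (by linarith) (fun w hw => ?_) ?_
  · obtain ⟨h0, h1⟩ := hne w hw
    fun_prop (disch := first | exact Or.inl h0 | exact Or.inl h1)
  · have hlim : Tendsto (fun w : ℂ => (w / (w - 1)) ^ (-e) * w ^ (-z)) (Bornology.cobounded ℂ)
        (𝓝 ((1 : ℂ) ^ (-e) * 0)) :=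
      ((tendsto_div_sub 1).zpow₀ (-e) (Or.inl one_ne_zero)).mul
        (tendsto_zpow_neg_cobounded (by omega))
    rw [mul_zero] at hlim
    refine hlim.congr' ?_
    filter_upwards [Bornology.eventually_ne_cobounded (0 : ℂ),
      Bornology.eventually_ne_cobounded (1 : ℂ)] with w h0 h1
    rw [show -z - 1 - e = -z + (-1) + -e by ring, zpow_add₀ h0, zpow_add₀ h0, zpow_neg_one,
      div_zpow, zpow_neg (w - 1) e]
    have := zpow_ne_zero e (sub_ne_zero.2 h1)
    field_simp

lemma add_sub_le_of_lt_succ {b : ℕ → ℤ} {N : ℕ} (hb : ∀ i < N, b i < b (i + 1)) {i : ℕ}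
    (hi : i ≤ N) : b i + (N - i) ≤ b N := by
  induction N, hi using Nat.le_induction with
  | base => simp
  | succ n _ ih =>
    have := ih fun i hi => hb i (by omega)
    have := hb n (by omega)
    push_cast
    omega

variable {α : ℝ} (ρ : ContourRadii α) {N : ℕ} {a d : ℕ → ℤ}

/-- The functionals `initDual` for equal numbers of particles; they do not depend on that number. -/
noncomputable def startDual (d : ℕ → ℤ) (k : ℕ) : Module.Dual ℂ C(exterior α, ℂ) :=
  momentDual ρ (k + 1) (d k - k - 2)

lemma initDual_self (N : ℕ) (d : ℕ → ℤ) : initDual ρ N N d = startDual ρ d := by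
  funext k
  rw [initDual, startDual, show N + k + 1 - N = k + 1 by omega, sub_add_cancel]

lemma startDual_rowVec_time_zero (d a : ℕ → ℤ) (k i : ℕ) :
    startDual ρ d k (rowVec α 0 a i) = contour ρ.inner fun w =>
      (w - 1) ^ ((k : ℤ) - i) * w ^ (-(a i - d k) - 1 - ((k : ℤ) - i)) := by
  rw [startDual, rowVec, momentDual_weightVec]
  congr 1
  funext w
  push_cast
  rw [zero_mul, Complex.exp_zero, mul_one, add_sub_add_right_eq_sub,
    show d k - k - 2 + (i + 1) - a i = -(a i - d k) - 1 - (k - i) by ring]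

lemma startDual_eq_zero_of_lt {k i : ℕ} (hik : i ≤ k) (h : a i + (k - i) < d k) :
    startDual ρ d k (rowVec α 0 a i) = 0 := by
  rw [startDual_rowVec_time_zero]
  refine contour_eq_zero_of_disc ρ.inner_nonneg fun w _ => ?_
  exact ((differentiableAt_fun_id.sub_const 1).zpow (Or.inr (by omega))).mul
    (differentiableAt_fun_id.zpow (Or.inr (by omega)))

lemma startDual_eq_zero_of_gt {k i : ℕ} (h : d k < a i) :
    startDual ρ d k (rowVec α 0 a i) = 0 := by
  rw [startDual_rowVec_time_zero]
  exact contour_moment_eq_zero ((le_max_left _ _).trans_lt ρ.max_lt_inner) _ (by omega)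

lemma startDual_eq_one {k : ℕ} (h : a k = d k) : startDual ρ d k (rowVec α 0 a k) = 1 := by
  have hres := contour_div_sub (R := ρ.inner) (c := 0) (f := fun _ => 1)
    (by simpa using pos_of_max_one_lt ρ.max_lt_inner) fun _ _ => differentiableAt_const _
  rw [startDual_rowVec_time_zero, h]
  simpa using hres

lemma pfRow_time_zero_of_lt (hda : ∀ i < N, a i < a (i + 1)) (h : a N < d N) :
    pfRow (qForm ρ) (N + 1) (N + 1) (rowVec α 0 a) (startDual ρ d) = 0 := by
  refine pfSeq_eq_zero_of_row (extForm_isAlt (qForm_isAlt ρ)) (k := N + 1 + N) (by omega)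
    fun j _ _ => ?_
  rw [rowSeq_of_ge _ _ (by omega), Nat.add_sub_cancel_left]
  by_cases hj : j < N + 1
  · have := add_sub_le_of_lt_succ hda (Nat.lt_succ_iff.1 hj)
    rw [rowSeq_of_lt _ _ hj, extForm_apply, startDual_eq_zero_of_lt ρ (by omega) (by omega)]
    simp
  · rw [rowSeq_of_ge _ _ (by omega), extForm_apply]
    simp

lemma pfRow_time_zero_of_gt (ha : ∀ i ≤ N, 1 ≤ a i) (hdd : ∀ i < N, d i < d (i + 1))
    (h : d N < a N) :
    pfRow (qForm ρ) (N + 1) (N + 1) (rowVec α 0 a) (startDual ρ d) = 0 := by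
  refine pfSeq_eq_zero_of_row (extForm_isAlt (qForm_isAlt ρ)) (k := N) (by omega) fun j hj _ => ?_
  rw [rowSeq_of_lt _ _ (by omega)]
  by_cases hjN : j < N + 1
  · have := qForm_time_zero ρ (N + 1) (j + 1) (ha N le_rfl) (ha j (by omega))
    simp [rowSeq_of_lt _ _ hjN, extForm_apply, rowVec, this]
  · have := add_sub_le_of_lt_succ hdd (i := j - (N + 1)) (by omega)
    rw [rowSeq_of_ge _ _ (by omega), extForm_apply, startDual_eq_zero_of_gt ρ (by omega)]
    simp

lemma pfRow_time_zero_of_eq (ha : ∀ i ≤ N, 1 ≤ a i) (hdd : ∀ i < N, d i < d (i + 1))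
    (h : a N = d N) :
    pfRow (qForm ρ) (N + 1) (N + 1) (rowVec α 0 a) (startDual ρ d) =
      (-1) ^ N * pfRow (qForm ρ) N N (rowVec α 0 a) (startDual ρ d) := by
  rw [pfRow_succ_of_isotropic (qForm_isAlt ρ), startDual_eq_one ρ h, mul_one]
  · exact fun i hi => qForm_time_zero ρ _ _ (ha N le_rfl) (ha i hi.le)
  · intro k hk
    have := add_sub_le_of_lt_succ hdd hk.le
    exact startDual_eq_zero_of_gt ρ (by omega)

lemma pfRow_time_zero (N : ℕ) (ha : ∀ i < N, 1 ≤ a i) (hda : ∀ i, i + 1 < N → a i < a (i + 1))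
    (hdd : ∀ i, i + 1 < N → d i < d (i + 1)) :
    pfRow (qForm ρ) N N (rowVec α 0 a) (startDual ρ d) =
      if ∀ i < N, a i = d i then (-1) ^ N.choose 2 else 0 := by
  induction N with
  | zero => simp [pfRow, pfSeq_zero]
  | succ N ih =>
    have ha' : ∀ i ≤ N, 1 ≤ a i := fun i hi => ha i (by omega)
    have hdd' : ∀ i < N, d i < d (i + 1) := fun i hi => hdd i (by omega)
    obtain hlt | heq | hgt := lt_trichotomy (a N) (d N)
    · rw [pfRow_time_zero_of_lt ρ (fun i hi => hda i (by omega)) hlt,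
        if_neg fun h => hlt.ne (h N N.lt_succ_self)]
    · have hiff : (∀ i < N + 1, a i = d i) ↔ ∀ i < N, a i = d i := by
        rw [Nat.forall_lt_succ_right, and_iff_left heq]
      rw [pfRow_time_zero_of_eq ρ ha' hdd' heq, ih (fun i hi => ha i (by omega))
        (fun i hi => hda i (by omega)) (fun i hi => hdd i (by omega)), if_congr hiff rfl rfl,
        Nat.choose_succ_succ' N 1, Nat.choose_one_right, pow_add, mul_ite, mul_zero]
    · rw [pfRow_time_zero_of_gt ρ ha' hdd' hgt, if_neg fun h => hgt.ne' (h N N.lt_succ_self)]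

lemma transPf_time_zero_self (N : ℕ) (ha : ∀ i < N, 1 ≤ a i)
    (hda : ∀ i, i + 1 < N → a i < a (i + 1)) (hdd : ∀ i, i + 1 < N → d i < d (i + 1)) :
    transPf ρ 0 N N d a = if ∀ i < N, a i = d i then (-1) ^ N.choose 2 else 0 := by
  rw [← pfRow_time_zero ρ N ha hda hdd, transPf, borderDual, if_pos ⟨N, rfl⟩, initDual_self,
    show (N + N + 1) / 2 = N by omega]

end InitialCondition

/-! ### Configurations in increasing coordinates -/

section Coordinates

/-- The configuration with sites `c 0, …, c (N - 1)`. -/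
def coordSet (N : ℕ) (c : ℕ → ℕ+) : Config := (Finset.range N).image c

/-- The sites of `x` whose particle can have arrived by a jump from the left. -/
def arrivalSites (x : Config) : Finset ℕ+ := {s ∈ x | s ≠ 1 ∧ s - 1 ∉ x}

lemma sub_one_add_one {s : ℕ+} (h : s ≠ 1) : s - 1 + 1 = s :=
  PNat.sub_add_of_lt (one_le.lt_of_ne h.symm)

lemma predSum_eq (α : ℝ) (f : Config → ℝ) (x : Config) :
    predSum α f x = (if 1 ∈ x then α * f (x.erase 1) else 0) +
      ∑ s ∈ arrivalSites x, f (insert (s - 1) (x.erase s)) := by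
  unfold predSum
  congr 1
  symm
  refine Finset.sum_bij (fun s _ => s - 1) ?_ ?_ ?_ ?_
  · intro s hs
    obtain ⟨hs, hs1, hempty⟩ := Finset.mem_filter.1 hs
    exact Finset.mem_filter.2
      ⟨Finset.mem_image_of_mem _ hs, by rwa [sub_one_add_one hs1], hempty⟩
  · intro s hs s' hs' h
    rw [← sub_one_add_one (Finset.mem_filter.1 hs).2.1, h,
      sub_one_add_one (Finset.mem_filter.1 hs').2.1]
  · intro s hs
    obtain ⟨-, hocc, hempty⟩ := Finset.mem_filter.1 hs
    exact ⟨s + 1, Finset.mem_filter.2 ⟨hocc, (PNat.lt_add_left 1 s).ne', by rwa [PNat.add_sub]⟩,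
      PNat.add_sub⟩
  · intro s hs
    rw [hopBack, sub_one_add_one (Finset.mem_filter.1 hs).2.1]

lemma card_filter_add_one_mem (x : Config) :
    (x.filter fun s => s + 1 ∈ x).card = (x.filter fun s => s ≠ 1 ∧ s - 1 ∈ x).card := by
  refine Finset.card_bij (fun s _ => s + 1) ?_ (fun s _ s' _ h => add_right_cancel h) ?_
  · intro s hs
    obtain ⟨hs, hocc⟩ := Finset.mem_filter.1 hs
    exact Finset.mem_filter.2 ⟨hocc, (PNat.lt_add_left 1 s).ne', by rwa [PNat.add_sub]⟩
  · intro s hs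
    obtain ⟨hs, hs1, hocc⟩ := Finset.mem_filter.1 hs
    exact ⟨s - 1, Finset.mem_filter.2 ⟨hocc, by rwa [sub_one_add_one hs1]⟩, sub_one_add_one hs1⟩

lemma exitRate_eq (α : ℝ) (x : Config) :
    exitRate α x = (if 1 ∈ x then 1 else α) + ((arrivalSites x).card : ℝ) := by
  have hright := Finset.card_filter_add_card_filter_not (s := x) (fun s => s + 1 ∈ x)
  have hone := Finset.card_filter_add_card_filter_not (s := x) (fun s => s ≠ 1)
  have hleft := Finset.card_filter_add_card_filter_not (s := x.filter fun s => s ≠ 1)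
    (fun s => s - 1 ∈ x)
  rw [Finset.filter_filter, Finset.filter_filter] at hleft
  have hcard_one : (x.filter fun s => ¬ s ≠ 1).card = if 1 ∈ x then 1 else 0 := by
    simp only [ne_eq, not_not, Finset.filter_eq']
    split_ifs <;> simp
  have hcard : (x.filter fun s => s + 1 ∉ x).card =
      (if 1 ∈ x then 1 else 0) + (arrivalSites x).card := by
    have := card_filter_add_one_mem x
    unfold arrivalSites
    omega
  unfold exitRate jumpSum
  rw [Finset.sum_const, nsmul_one, hcard]
  split_ifs <;> push_cast <;> ring

variable {N : ℕ} {c : ℕ → ℕ+}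

lemma mem_coordSet {s : ℕ+} : s ∈ coordSet N c ↔ ∃ j < N, c j = s := by
  simp [coordSet]

lemma card_coordSet (hc : StrictMonoOn c (Set.Iio N)) : (coordSet N c).card = N := by
  rw [coordSet, Finset.card_image_of_injOn (by simpa using hc.injOn), Finset.card_range]

lemma sum_coordSet {A : Type*} [AddCommMonoid A] (hc : StrictMonoOn c (Set.Iio N)) (g : ℕ+ → A) :
    ∑ s ∈ coordSet N c, g s = ∑ j ∈ Finset.range N, g (c j) :=
  Finset.sum_image (by simpa using hc.injOn)

lemma sum_ite_add_sum_arrivalSites (hc : StrictMonoOn c (Set.Iio N)) (b : ℝ) (g : ℕ+ → ℝ) :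
    (if 1 ∈ coordSet N c then b else 0) + ∑ s ∈ arrivalSites (coordSet N c), g s =
      ∑ j ∈ Finset.range N, ((if c j = 1 then b else 0) +
        if c j ≠ 1 ∧ c j - 1 ∉ coordSet N c then g (c j) else 0) := by
  rw [arrivalSites, Finset.sum_filter, ← Finset.sum_ite_eq' _ (1 : ℕ+) fun _ => b,
    ← Finset.sum_add_distrib, sum_coordSet hc]

lemma predSum_coordSet (hc : StrictMonoOn c (Set.Iio N)) (α : ℝ) (f : Config → ℝ) :
    predSum α f (coordSet N c) =
      ∑ j ∈ Finset.range N, ((if c j = 1 then α * f ((coordSet N c).erase 1) else 0) +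
        if c j ≠ 1 ∧ c j - 1 ∉ coordSet N c then
          f (insert (c j - 1) ((coordSet N c).erase (c j))) else 0) := by
  rw [predSum_eq, sum_ite_add_sum_arrivalSites hc _ fun s =>
    f (insert (s - 1) ((coordSet N c).erase s))]

lemma exitRate_coordSet (hc : StrictMonoOn c (Set.Iio N)) (α : ℝ) :
    exitRate α (coordSet N c) = α + ∑ j ∈ Finset.range N, ((if c j = 1 then 1 - α else 0) +
      if c j ≠ 1 ∧ c j - 1 ∉ coordSet N c then 1 else 0) := by
  rw [exitRate_eq, ← sum_ite_add_sum_arrivalSites hc _ fun _ => 1, Finset.sum_const, nsmul_one]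
  split_ifs <;> ring

lemma erase_one_coordSet (hc : StrictMonoOn c (Set.Iio (N + 1))) (h : c 0 = 1) :
    (coordSet (N + 1) c).erase 1 = coordSet N fun i => c (i + 1) := by
  ext s
  rw [Finset.mem_erase, mem_coordSet, mem_coordSet]
  constructor
  · rintro ⟨hs, j, hj, rfl⟩
    obtain ⟨i, rfl⟩ : ∃ i, j = i + 1 := Nat.exists_eq_succ_of_ne_zero fun h0 => hs (by rw [h0, h])
    exact ⟨i, by omega, rfl⟩
  · rintro ⟨j, hj, rfl⟩
    refine ⟨?_, j + 1, by omega, rfl⟩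
    rw [← h]
    exact (hc N.succ_pos (Nat.succ_lt_succ hj) j.succ_pos).ne'

lemma insert_erase_coordSet (hc : StrictMonoOn c (Set.Iio N)) {j : ℕ} (hj : j < N) (s : ℕ+) :
    insert s ((coordSet N c).erase (c j)) = coordSet N (Function.update c j s) := by
  ext r
  rw [Finset.mem_insert, Finset.mem_erase, mem_coordSet, mem_coordSet]
  constructor
  · rintro (rfl | ⟨hr, i, hi, rfl⟩)
    · exact ⟨j, hj, Function.update_self ..⟩
    · exact ⟨i, hi, Function.update_of_ne (fun hij => hr (by rw [hij])) ..⟩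
  · rintro ⟨i, hi, rfl⟩
    obtain rfl | hij := eq_or_ne i j
    · simp
    · rw [Function.update_of_ne hij]
      exact Or.inr ⟨fun h => hij (hc.injOn hi hj h), i, hi, rfl⟩

lemma exists_pred_of_mem (hc : StrictMonoOn c (Set.Iio N)) {j : ℕ} (hj : j < N)
    (h1 : c j ≠ 1) (h : c j - 1 ∈ coordSet N c) : ∃ i, j = i + 1 ∧ c j = c i + 1 := by
  obtain ⟨i, hi, hij⟩ := mem_coordSet.1 h
  have hs : c i + 1 = c j := by rw [hij, sub_one_add_one h1]
  have hlt : i < j := (hc.lt_iff_lt hi hj).1 (hs ▸ PNat.lt_add_right _ _)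
  refine ⟨i, ?_, hs.symm⟩
  by_contra hne
  have hi' : i + 1 < j := by omega
  have hnext : c (i + 1) < c i + 1 := hs ▸ hc (hi'.trans hj) hj hi'
  exact (PNat.lt_add_one_iff.1 hnext).not_gt (hc hi (hi'.trans hj) i.lt_succ_self)

lemma strictMonoOn_update (hc : StrictMonoOn c (Set.Iio N)) {j : ℕ} (h1 : c j ≠ 1)
    (h : c j - 1 ∉ coordSet N c) :
    StrictMonoOn (Function.update c j (c j - 1)) (Set.Iio N) := by
  have hs := sub_one_add_one h1
  intro i hi l hl hil
  have hcil := hc hi hl hil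
  obtain rfl | hij := eq_or_ne i j
  · rw [Function.update_self, Function.update_of_ne hil.ne']
    exact (hs ▸ PNat.lt_add_right (c i - 1) 1).trans hcil
  · rw [Function.update_of_ne hij]
    obtain rfl | hlj := eq_or_ne l j
    · rw [← hs] at hcil
      rw [Function.update_self]
      exact (PNat.lt_add_one_iff.1 hcil).lt_of_ne fun heq => h (mem_coordSet.2 ⟨i, hi, heq⟩)
    · rwa [Function.update_of_ne hlj]

lemma coordSet_inj {d : ℕ → ℕ+} (hc : StrictMonoOn c (Set.Iio N))
    (hd : StrictMonoOn d (Set.Iio N)) :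
    coordSet N d = coordSet N c ↔ ∀ i < N, c i = d i := by
  refine ⟨fun h i hi => ?_, fun h => Finset.image_congr fun i hi => (h i (by simpa using hi)).symm⟩
  have hmono {b : ℕ → ℕ+} (hb : StrictMonoOn b (Set.Iio N)) : StrictMono fun i : Fin N => b i :=
    fun i j hij => hb i.2 j.2 hij
  have hrange (b : ℕ → ℕ+) : Set.range (fun i : Fin N => b i) = coordSet N b := by
    ext s
    rw [Finset.mem_coe, mem_coordSet, Set.mem_range, Fin.exists_iff]
    simp
  have hfun := (StrictMono.range_inj (hmono hc) (hmono hd)).1 (by rw [hrange, hrange, h])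
  exact congrFun hfun ⟨i, hi⟩

/-- The sequence of sites `c`, as integers. -/
def toInt (c : ℕ → ℕ+) (i : ℕ) : ℤ := (c i : ℕ)

lemma one_le_toInt (c : ℕ → ℕ+) (i : ℕ) : 1 ≤ toInt c i := by
  have := (c i).pos
  unfold toInt
  omega

lemma toInt_update {j : ℕ} (h : c j ≠ 1) :
    toInt (Function.update c j (c j - 1)) = Function.update (toInt c) j (toInt c j - 1) := by
  funext i
  obtain rfl | hi := eq_or_ne i j
  · have hs := congrArg (fun s : ℕ+ => (s : ℕ)) (sub_one_add_one h)
    simp only [PNat.add_coe, PNat.one_coe] at hs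
    simp only [toInt, Function.update_self]
    omega
  · simp [toInt, Function.update_of_ne hi]

end Coordinates

/-! ### The transition probabilities -/

section TransitionFormula

/-- The right-hand side of the theorem for `M` particles starting at `d 0 < d 1 < ⋯` and `N`
particles at `a 0 < a 1 < ⋯`. -/
noncomputable def transFormula {α : ℝ} (ρ : ContourRadii α) (t : ℝ) (M N : ℕ) (d a : ℕ → ℤ) : ℂ :=
  (-1) ^ N.choose 2 * Complex.exp (-(α * t)) * transPf ρ t M N d a

variable {α : ℝ} (ρ : ContourRadii α) {M N : ℕ}

lemma hasDerivAt_transFormula (t : ℝ) (M N : ℕ) (d a : ℕ → ℤ) :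
    HasDerivAt (fun s => transFormula ρ s M N d a)
      (∑ j ∈ Finset.range N, (transFormula ρ t M N d (Function.update a j (a j - 1)) -
        transFormula ρ t M N d a) - α * transFormula ρ t M N d a) t := by
  have hexp : HasDerivAt (fun s : ℝ => Complex.exp (-(α * s))) (-α * Complex.exp (-(α * t))) t := by
    have h : HasDerivAt (fun s : ℝ => -((α : ℂ) * (s : ℂ))) (-α) t := by
      simpa using ((Complex.ofRealCLM.hasDerivAt (x := t)).const_mul (α : ℂ)).fun_neg
    exact h.cexp.congr_deriv (by ring)
  have hpf := hasDerivAt_pfRow ρ (n := (N + M + 1) / 2) (N := N) (by omega) t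
    (fun k i a => hasDerivAt_borderDual ρ t M N d k i a) a
  refine ((hexp.const_mul ((-1) ^ N.choose 2)).mul hpf).congr_deriv ?_
  simp only [transFormula, transPf, ← mul_sub, ← Finset.mul_sum]
  ring

lemma transFormula_update_wall (hM : M ≤ N + 1) {d : ℕ → ℤ}
    (hd : ∀ k < M, (N : ℤ) + 3 + k ≤ d k + M) (t : ℝ) {a : ℕ → ℤ}
    (ha0 : a 0 = 1) (ha : ∀ i < N, 1 ≤ a (i + 1)) :
    transFormula ρ t M (N + 1) d (Function.update a 0 (a 0 - 1)) =
      α * transFormula ρ t M (N + 1) d a + α * transFormula ρ t M N d fun i => a (i + 1) := by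
  have hsign : (-1 : ℂ) ^ N * (-1) ^ N = 1 := by rw [← mul_pow, neg_one_mul, neg_neg, one_pow]
  simp only [transFormula]
  rw [transPf_update_wall ρ hM hd t ha0 ha, Nat.choose_succ_succ' N 1, Nat.choose_one_right,
    pow_add]
  linear_combination ((-1) ^ N.choose 2 * Complex.exp (-(α * t)) * α *
    transPf ρ t M N d fun i => a (i + 1)) * hsign

lemma transFormula_update_of_eq (t : ℝ) (d : ℕ → ℤ) {a : ℕ → ℤ} {j : ℕ} (hj : j + 1 < N)
    (h : a (j + 1) = a j + 1) :
    transFormula ρ t M N d (Function.update a (j + 1) (a (j + 1) - 1)) =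
      transFormula ρ t M N d a := by
  rw [transFormula, transPf, pfRow_update_of_eq ρ (by omega) _ t hj h]
  rfl

variable {d c : ℕ → ℕ+}

lemma transFormula_time_zero (hd : StrictMonoOn d (Set.Iio M)) (hc : StrictMonoOn c (Set.Iio N))
    (hMN : M ≤ N) : transFormula ρ 0 M N (toInt d) (toInt c) =
      if coordSet M d = coordSet N c then 1 else 0 := by
  rw [transFormula, Complex.ofReal_zero, mul_zero, neg_zero, Complex.exp_zero, mul_one]
  obtain hlt | rfl := hMN.lt_or_eq
  · rw [transPf_time_zero_of_gt ρ hlt _ fun i _ => one_le_toInt c i, mul_zero, if_neg]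
    intro h
    have hcard := congrArg Finset.card h
    rw [card_coordSet hc, card_coordSet hd] at hcard
    omega
  · have hstep {b : ℕ → ℕ+} (hb : StrictMonoOn b (Set.Iio M)) (i : ℕ) (hi : i + 1 < M) :
        toInt b i < toInt b (i + 1) := by
      simpa [toInt] using hb (i.lt_succ_self.trans hi) hi i.lt_succ_self
    have hiff : (∀ i < M, toInt c i = toInt d i) ↔ ∀ i < M, c i = d i := by simp [toInt]
    rw [transPf_time_zero_self ρ M (fun i _ => one_le_toInt c i) (hstep hc) (hstep hd),
      if_congr (hiff.trans (coordSet_inj hc hd).symm) rfl rfl]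
    split_ifs
    · rw [← mul_pow, neg_one_mul, neg_neg, one_pow]
    · rw [mul_zero]

lemma transFormula_update_sub (hc : StrictMonoOn c (Set.Iio N)) (hM : M ≤ N) {d : ℕ → ℤ}
    (hd : ∀ k < M, (N : ℤ) + 2 + k ≤ d k + M) (t : ℝ) {j : ℕ} (hj : j < N) :
    transFormula ρ t M N d (Function.update (toInt c) j (toInt c j - 1)) -
        transFormula ρ t M N d (toInt c) =
      (if c j = 1 then α * transFormula ρ t M (N - 1) d (toInt fun i => c (i + 1)) +
        (α - 1) * transFormula ρ t M N d (toInt c) else 0) +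
      if c j ≠ 1 ∧ c j - 1 ∉ coordSet N c then
        transFormula ρ t M N d (toInt (Function.update c j (c j - 1))) -
          transFormula ρ t M N d (toInt c) else 0 := by
  by_cases hone : c j = 1
  · obtain rfl : j = 0 := by
      by_contra hne
      have hlt := hc (a := 0) (Nat.zero_lt_of_lt hj) hj (by omega)
      exact not_lt_one (hone ▸ hlt)
    obtain ⟨n, rfl⟩ : ∃ n, N = n + 1 := Nat.exists_eq_succ_of_ne_zero (by omega)
    rw [if_pos hone, if_neg fun h => h.1 hone, transFormula_update_wall ρ hM
      (fun k hk => by have := hd k hk; push_cast at this; omega) t (by simp [toInt, hone])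
      fun i _ => one_le_toInt c _, Nat.add_sub_cancel]
    change _ + α * transFormula ρ t M n d (toInt fun i => c (i + 1)) - _ = _
    ring
  · rw [if_neg hone, zero_add]
    by_cases hmem : c j - 1 ∈ coordSet N c
    · obtain ⟨i, rfl, hi⟩ := exists_pred_of_mem hc hj hone hmem
      rw [if_neg fun h => h.2 hmem, transFormula_update_of_eq ρ t d hj (by simp [toInt, hi]),
        sub_self]
    · rw [if_pos ⟨hone, hmem⟩, toInt_update hone]

/-- `f` agrees with the Pfaffian formula at the configurations from which `coordSet N c` can be
reached in one jump. -/
structure AgreesBefore (f : Config → ℝ) (t : ℝ) (M N : ℕ) (d : ℕ → ℤ) (c : ℕ → ℕ+) : Prop where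
  enter : 1 ∈ coordSet N c → (f ((coordSet N c).erase 1) : ℂ) =
    transFormula ρ t M (N - 1) d (toInt fun i => c (i + 1))
  hop : ∀ j < N, c j ≠ 1 → c j - 1 ∉ coordSet N c →
    (f (insert (c j - 1) ((coordSet N c).erase (c j))) : ℂ) =
      transFormula ρ t M N d (toInt (Function.update c j (c j - 1)))

lemma AgreesBefore.sum_transFormula_update_sub {f : Config → ℝ} {t : ℝ} {d : ℕ → ℤ}
    (hf : AgreesBefore ρ f t M N d c) (hc : StrictMonoOn c (Set.Iio N)) (hM : M ≤ N)
    (hd : ∀ k < M, (N : ℤ) + 2 + k ≤ d k + M) :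
    ∑ j ∈ Finset.range N,
        (transFormula ρ t M N d (Function.update (toInt c) j (toInt c j - 1)) -
          transFormula ρ t M N d (toInt c)) - α * transFormula ρ t M N d (toInt c) =
      predSum α f (coordSet N c) -
        exitRate α (coordSet N c) * transFormula ρ t M N d (toInt c) := by
  rw [predSum_coordSet hc, exitRate_coordSet hc, Complex.ofReal_add, add_mul,
    sub_add_eq_sub_sub_swap, Complex.ofReal_sum, Complex.ofReal_sum, Finset.sum_mul,
    ← Finset.sum_sub_distrib]
  congr 1
  refine Finset.sum_congr rfl fun j hj => ?_
  have hj := Finset.mem_range.1 hj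
  rw [transFormula_update_sub ρ hc hM hd t hj]
  by_cases hone : c j = 1
  · have henter := hf.enter (mem_coordSet.2 ⟨j, hj, hone⟩)
    simp only [hone, if_true, ne_eq, not_true_eq_false, false_and, if_false, add_zero]
    push_cast
    rw [henter]
    ring
  · by_cases hmem : c j - 1 ∈ coordSet N c
    · simp [hone, hmem]
    · simp [hone, hmem, hf.hop j hj hone hmem]

lemma transProb_eq_transFormula_of_agreesBefore (hd : StrictMonoOn d (Set.Iio M))
    (hc : StrictMonoOn c (Set.Iio N)) (hM : M ≤ N)
    (hdM : ∀ k < M, (N : ℤ) + 2 + k ≤ toInt d k + M)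
    (h : ∀ t, AgreesBefore ρ (transProb α t (coordSet M d)) t M N (toInt d) c) (t : ℝ) :
    (transProb α t (coordSet M d) (coordSet N c) : ℂ) =
      transFormula ρ t M N (toInt d) (toInt c) := by
  have hderiv (t : ℝ) : HasDerivAt
      (fun s : ℝ => (transProb α s (coordSet M d) (coordSet N c) : ℂ) -
        transFormula ρ s M N (toInt d) (toInt c))
      ((-exitRate α (coordSet N c)) • ((transProb α t (coordSet M d) (coordSet N c) : ℂ) -
        transFormula ρ t M N (toInt d) (toInt c))) t := by
    refine ((hasDerivAt_transProb α t (coordSet M d) (coordSet N c)).ofReal_comp.sub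
      (hasDerivAt_transFormula ρ t M N (toInt d) (toInt c))).congr_deriv ?_
    rw [(h t).sum_transFormula_update_sub ρ hc hM hdM, Complex.real_smul]
    push_cast
    ring
  refine sub_eq_zero.1 (eq_zero_of_hasDerivAt_smul hderiv ?_ t)
  rw [transProb_zero, transFormula_time_zero ρ hd hc hM]
  split_ifs <;> simp

-- The formula is needed down to `N = M - 1`, where it is trivial: this is what the last particle
-- of `N = M` entering at site `1` requires.
theorem transProb_coordSet (hd : StrictMonoOn d (Set.Iio M)) (hc : StrictMonoOn c (Set.Iio N))
    (hM : M ≤ N + 1) (hdM : ∀ k < M, (N : ℤ) + 2 + k ≤ toInt d k + M) (t : ℝ) :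
    (transProb α t (coordSet M d) (coordSet N c) : ℂ) =
      transFormula ρ t M N (toInt d) (toInt c) := by
  obtain ⟨K, hK⟩ : ∃ K, height (coordSet N c) = K := ⟨_, rfl⟩
  induction K using Nat.strong_induction_on generalizing N c t with
  | _ K ih =>
  obtain hlt | hle := lt_or_ge N M
  · rw [transFormula, transPf_of_lt ρ hlt, mul_zero,
      transProb_eq_zero_of_card (by rwa [card_coordSet hc, card_coordSet hd]), Complex.ofReal_zero]
  refine transProb_eq_transFormula_of_agreesBefore ρ hd hc hle hdM (fun t => ⟨fun hone => ?_,
    fun j hj hone hmem => ?_⟩) t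
  · obtain ⟨n, rfl⟩ : ∃ n, N = n + 1 := by
      obtain ⟨j, hj, -⟩ := mem_coordSet.1 hone
      exact Nat.exists_eq_succ_of_ne_zero (by omega)
    have hc0 : c 0 = 1 := by
      obtain ⟨j, hj, hcj⟩ := mem_coordSet.1 hone
      exact le_antisymm (hcj ▸ hc.monotoneOn n.succ_pos hj j.zero_le) one_le
    have hheight := height_erase_one hone
    rw [erase_one_coordSet hc hc0] at hheight ⊢
    exact ih _ (by omega)
      (fun i hi l hl hil => hc (Nat.succ_lt_succ hi) (Nat.succ_lt_succ hl) (Nat.succ_lt_succ hil))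
      hle (fun k hk => by have := hdM k hk; push_cast at this; omega) t rfl
  · have hheight := height_hopBack (x := coordSet N c) (s := c j - 1)
      (by rw [sub_one_add_one hone]; exact mem_coordSet.2 ⟨j, hj, rfl⟩) hmem
    rw [hopBack, sub_one_add_one hone, insert_erase_coordSet hc hj] at hheight
    rw [insert_erase_coordSet hc hj]
    exact ih _ (by omega) (strictMonoOn_update hc hone hmem) hM hdM t rfl

end TransitionFormula

/-! ### The matrices of the theorem -/

section Matrices

lemma blockEven_apply {V : Type*} [AddCommGroup V] [Module ℂ V] {ω : V →ₗ[ℂ] V →ₗ[ℂ] ℂ}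
    (hω : ω.IsAlt) {N M : ℕ} {Q : Matrix (Fin N) (Fin N) ℂ} {U : Matrix (Fin N) (Fin M) ℂ}
    {u : ℕ → V} (hQ : ∀ i j : Fin N, Q i j = ω (u i) (u j))
    (hU : ∀ (i : Fin N) (k : Fin M), U i k = ω (u i) (u (N + k)))
    (h0 : ∀ k l : Fin M, ω (u (N + k)) (u (N + l)) = 0) (i j : Fin (N + M)) :
    blockEven Q U i j = ω (u i) (u j) := by
  induction i using Fin.addCases <;> induction j using Fin.addCases <;>
    simp [blockEven, hQ, hU, h0, hω.neg]

/-- The sequence `x (N - 1), …, x 0`, continued by `1`. -/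
def revSeq {N : ℕ} (x : Fin N → ℕ+) (i : ℕ) : ℕ+ := if h : i < N then x (Fin.rev ⟨i, h⟩) else 1

lemma revSeq_val {N : ℕ} (x : Fin N → ℕ+) (i : Fin N) : revSeq x i = x i.rev := by
  simp [revSeq]

lemma strictMonoOn_revSeq {N : ℕ} {x : Fin N → ℕ+} (hx : StrictAnti x) :
    StrictMonoOn (revSeq x) (Set.Iio N) := by
  intro i hi j hj hij
  simp only [revSeq, dif_pos (Set.mem_Iio.1 hi), dif_pos (Set.mem_Iio.1 hj)]
  exact hx (Fin.rev_lt_rev.2 hij)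

lemma coordSet_revSeq {N : ℕ} (x : Fin N → ℕ+) : coordSet N (revSeq x) = ofCoords x := by
  ext s
  rw [mem_coordSet, ofCoords, Finset.mem_image]
  constructor
  · rintro ⟨j, hj, rfl⟩
    exact ⟨Fin.rev ⟨j, hj⟩, Finset.mem_univ _, (revSeq_val x ⟨j, hj⟩).symm⟩
  · rintro ⟨i, -, rfl⟩
    exact ⟨i.rev, i.rev.2, by rw [revSeq_val, Fin.rev_rev]⟩

variable {α r : ℝ} (ρ : ContourRadii α) {N M : ℕ}

lemma Uker_eq_initDual (hr : 1 < r) (t : ℝ) (hM : M ≤ N) (i k : ℕ) (a : ℤ) (d : ℕ → ℤ) :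
    Uker t r N M ((i : ℤ) - k) (a - d k) = initDual ρ M N d k (weightVec α t (i + 1) a) := by
  set e : ℤ := ((N + k + 1 - M : ℕ) : ℤ) - ((i + 1 : ℕ) : ℤ)
  set m : ℤ := d k - k - N + M - 2 + ((i + 1 : ℕ) : ℤ) - a with hm
  have hU : Uker t r N M ((i : ℤ) - k) (a - d k) =
      contour r fun w => (w - 1) ^ e * Complex.exp (t * (w - 1)) * w ^ m := by
    unfold Uker
    congr 1
    funext w
    rw [div_eq_mul_inv, ← zpow_neg, show (N : ℤ) - M - (i - k) = e by omega,
      show -(a - d k - (i - k) + N - M + 1) = m by rw [hm]; push_cast; ring]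
  have hdiff (w : ℂ) (hw : 1 < ‖w‖) : DifferentiableAt ℂ
      (fun w : ℂ => (w - 1) ^ e * Complex.exp (t * (w - 1)) * w ^ m) w := by
    have h0 : w ≠ 0 := norm_pos_iff.1 (by linarith)
    have h1 : w - 1 ≠ 0 := sub_ne_zero.2 fun h => by simp [h] at hw
    fun_prop (disch := first | exact Or.inl h0 | exact Or.inl h1)
  have hρ : 1 < ρ.inner := (le_max_left _ _).trans_lt ρ.max_lt_inner
  rw [hU, initDual, momentDual_weightVec]
  obtain h | h := le_total r ρ.inner
  · exact (contour_eq_of_annulus (by linarith) h fun w hw _ => hdiff w (by linarith)).symm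
  · exact contour_eq_of_annulus (by linarith) h fun w hw _ => hdiff w (by linarith)

lemma Qmat_apply_eq_qForm (t : ℝ) (x : Fin N → ℕ+) (i j : Fin N) :
    Qmat α t ρ.inner ρ.outer x i j =
      qForm ρ (rowVec α t (toInt (revSeq x)) i) (rowVec α t (toInt (revSeq x)) j) := by
  have hpos := one_le_toInt (revSeq x) i
  have hpos' := one_le_toInt (revSeq x) j
  rw [rowVec, rowVec, qForm_weightVec_eq_Qker ρ t _ _ (by omega)]
  simp only [toInt, revSeq_val]
  rfl

lemma pvec_eq_contourDual (t : ℝ) (x : Fin N → ℕ+) (i : Fin N) : pvec α t ρ.inner x i =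
    ((α : ℂ) • contourDual ρ) (rowVec α t (toInt (revSeq x)) i) := by
  rw [LinearMap.smul_apply, rowVec, contourDual_weightVec, toInt, revSeq_val]
  rfl

lemma Umat_apply_eq_initDual (hr : 1 < r) (t : ℝ) (hM : M ≤ N) (x : Fin N → ℕ+)
    (y : Fin M → ℕ+) (i : Fin N) (k : Fin M) : Umat t r x y i k =
      initDual ρ M N (toInt (revSeq y)) k (rowVec α t (toInt (revSeq x)) i) := by
  rw [rowVec, ← Uker_eq_initDual ρ hr t hM, toInt, toInt, revSeq_val, revSeq_val]
  rfl

lemma pfaffian_Qmat (t : ℝ) (hpar : Even N) (x : Fin N → ℕ+) (d : ℕ → ℤ) :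
    pfaffian (Qmat α t ρ.inner ρ.outer x) = transPf ρ t 0 N d (toInt (revSeq x)) := by
  refine pfaffian_eq_pfSeq _ (by obtain ⟨n, hn⟩ := hpar; omega) _ _ fun i j => ?_
  simp [Qmat_apply_eq_qForm, rowSeq_of_lt, extForm_apply]

lemma pfaffian_blockEven (hr : 1 < r) (t : ℝ) (hM : M ≤ N) (hpar : Even (N + M))
    (x : Fin N → ℕ+) (y : Fin M → ℕ+) :
    pfaffian (blockEven (Qmat α t ρ.inner ρ.outer x) (Umat t r x y)) =
      transPf ρ t M N (toInt (revSeq y)) (toInt (revSeq x)) := by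
  rw [transPf, borderDual, if_pos hpar]
  refine pfaffian_eq_pfSeq _ (by obtain ⟨n, hn⟩ := hpar; omega) _ _
    (blockEven_apply (extForm_isAlt (qForm_isAlt ρ)) (fun i j => ?_) (fun i k => ?_) fun k l => ?_)
  · simp [Qmat_apply_eq_qForm, rowSeq_of_lt, extForm_apply]
  · simp [Umat_apply_eq_initDual ρ hr t hM, rowSeq_of_lt, rowSeq_of_ge, extForm_apply]
  · simp [rowSeq_of_ge, extForm_apply]

lemma blockBorder_apply (t : ℝ) (x : Fin N → ℕ+) {ψ : ℕ → Module.Dual ℂ C(exterior α, ℂ)}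
    (hψ : ψ 0 = (α : ℂ) • contourDual ρ) (i j : Fin (N + 1)) :
    blockBorder (Qmat α t ρ.inner ρ.outer x) (pvec α t ρ.inner x) i j =
      extForm (qForm ρ) (rowSeq N (rowVec α t (toInt (revSeq x))) ψ i)
        (rowSeq N (rowVec α t (toInt (revSeq x))) ψ j) := by
  refine blockEven_apply (extForm_isAlt (qForm_isAlt ρ)) (fun i j => ?_) (fun i k => ?_)
    (fun k l => ?_) i j
  · simp [Qmat_apply_eq_qForm, rowSeq_of_lt, extForm_apply]
  · simp [pvec_eq_contourDual, rowSeq_of_lt, rowSeq_of_ge, extForm_apply, hψ]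
  · simp [rowSeq_of_ge, extForm_apply]

lemma pfaffian_blockBorder (t : ℝ) (hpar : Odd N) (x : Fin N → ℕ+) (d : ℕ → ℤ) :
    pfaffian (blockBorder (Qmat α t ρ.inner ρ.outer x) (pvec α t ρ.inner x)) =
      transPf ρ t 0 N d (toInt (revSeq x)) := by
  rw [transPf, borderDual, if_neg (by simpa using hpar)]
  exact pfaffian_eq_pfSeq _ (by obtain ⟨n, hn⟩ := hpar; omega) _ _ (blockBorder_apply ρ t x rfl)

lemma pfaffian_blockOdd (hr : 1 < r) (t : ℝ) (hM : M ≤ N) (hpar : Odd (N + M))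
    (x : Fin N → ℕ+) (y : Fin M → ℕ+) :
    pfaffian (blockOdd (Qmat α t ρ.inner ρ.outer x) (pvec α t ρ.inner x) (Umat t r x y)) =
      transPf ρ t M N (toInt (revSeq y)) (toInt (revSeq x)) := by
  have hge (k : ℕ) : N ≤ N + 1 + k := by omega
  have hidx (k : ℕ) : N + 1 + k - N = k + 1 := by omega
  rw [transPf, borderDual, if_neg (by simpa using hpar)]
  refine pfaffian_eq_pfSeq _ (by obtain ⟨n, hn⟩ := hpar; omega) _ _
    (blockEven_apply (extForm_isAlt (qForm_isAlt ρ)) (blockBorder_apply ρ t x rfl)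
      (fun i k => ?_) fun k l => ?_)
  · induction i using Fin.lastCases with
    | last => simp [rowSeq_of_ge, hge, extForm_apply]
    | cast i =>
      simp [Umat_apply_eq_initDual ρ hr t hM, rowSeq_of_lt, rowSeq_of_ge, hge, hidx,
        extForm_apply, consSeq]
  · simp [rowSeq_of_ge, hge, extForm_apply]

lemma transProb_ofCoords (t : ℝ) {x : Fin N → ℕ+} {y : Fin M → ℕ+} (hx : StrictAnti x)
    (hy : StrictAnti y) (hM : M ≤ N)
    (hyM : ∀ hM : 0 < M, N - M + 1 < (y ⟨M - 1, Nat.sub_lt hM Nat.one_pos⟩ : ℕ)) :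
    (transProb α t (ofCoords y) (ofCoords x) : ℂ) = (-1) ^ N.choose 2 * Complex.exp (-(α * t)) *
      transPf ρ t M N (toInt (revSeq y)) (toInt (revSeq x)) := by
  rw [← coordSet_revSeq, ← coordSet_revSeq]
  refine transProb_coordSet ρ (strictMonoOn_revSeq hy) (strictMonoOn_revSeq hx) (by omega)
    (fun k hk => ?_) t
  induction k with
  | zero =>
    have hfirst : revSeq y 0 = y ⟨M - 1, Nat.sub_lt hk Nat.one_pos⟩ := by
      rw [revSeq, dif_pos hk]
      rfl
    have := hyM hk
    rw [toInt, hfirst]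
    omega
  | succ k ih =>
    have hstep : (revSeq y k : ℕ) < revSeq y (k + 1) :=
      strictMonoOn_revSeq hy (k.lt_succ_self.trans hk) hk k.lt_succ_self
    have := ih (by omega)
    simp only [toInt] at this ⊢
    push_cast
    omega

lemma Qmat_transpose {R₁ R₂ : ℝ} (h₁ : max 1 |α| < R₁) (h₂ : max 1 |α| < R₂) (h : 1 < |R₁ - R₂|)
    (t : ℝ) (x : Fin N → ℕ+) : (Qmat α t R₁ R₂ x).transpose = -Qmat α t R₁ R₂ x :=
  Matrix.ext fun i j => Qker_skew h₁ h₂ h t _ _ (by have := (x i.rev).pos; omega)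

lemma exists_contourRadii {R₁ R₂ : ℝ} (h₁ : max 1 |α| < R₁) (h₂ : max 1 |α| < R₂)
    (h : 1 < |R₁ - R₂|) (t : ℝ) (x : Fin N → ℕ+) : ∃ ρ : ContourRadii α,
      Qmat α t R₁ R₂ x = Qmat α t ρ.inner ρ.outer x ∧ pvec α t R₁ x = pvec α t ρ.inner x := by
  obtain h | h := lt_abs.1 h
  · have hlt : R₂ + 1 < R₁ := by linarith
    exact ⟨⟨R₂, R₁, h₂, hlt⟩,
      Matrix.ext fun i j => (Qker_comm_radii h₂ hlt t _ _
        (by have := (x i.rev).pos; omega)).symm,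
      funext fun i => pker_eq_of_radii h₁ h₂ t _ _⟩
  · exact ⟨⟨R₁, R₂, h₁, by linarith⟩, rfl, rfl⟩

end Matrices

end HalfTASEP

theorem theorem3p5
    (α t : ℝ) (hα : 0 ≤ α) (ht : 0 ≤ t)
    -- the radii of the contours: `R₁`, `R₂` for the `w`- and `u`-contours, `r` for the contour of `U`
    (R₁ R₂ r : ℝ) (hR₁ : max 1 α < R₁) (hR₂ : max 1 α < R₂) (hR : 1 < |R₁ - R₂|) (hr : 1 < r)
    (N : ℕ) (x : Fin N → ℕ+) (hx : StrictAnti x) :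
    -- the matrix `Q` is skew-symmetric
    (HalfTASEP.Qmat α t R₁ R₂ x).transpose = -HalfTASEP.Qmat α t R₁ R₂ x ∧
    -- general initial condition `y`, with smallest coordinate `y_M > N - M + 1`
    (∀ (M : ℕ) (y : Fin M → ℕ+), M ≤ N → StrictAnti y →
      (∀ hM : 0 < M, N - M + 1 < (y ⟨M - 1, Nat.sub_lt hM Nat.one_pos⟩ : ℕ)) →
      (Even (N + M) →
        (HalfTASEP.transProb α t (HalfTASEP.ofCoords y) (HalfTASEP.ofCoords x) : ℂ) =
          (-1) ^ (N.choose 2) * Complex.exp (-(α * t)) *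
            HalfTASEP.pfaffian (HalfTASEP.blockEven (HalfTASEP.Qmat α t R₁ R₂ x)
              (HalfTASEP.Umat t r x y))) ∧
      (Odd (N + M) →
        (HalfTASEP.transProb α t (HalfTASEP.ofCoords y) (HalfTASEP.ofCoords x) : ℂ) =
          (-1) ^ (N.choose 2) * Complex.exp (-(α * t)) *
            HalfTASEP.pfaffian (HalfTASEP.blockOdd (HalfTASEP.Qmat α t R₁ R₂ x)
              (HalfTASEP.pvec α t R₁ x) (HalfTASEP.Umat t r x y)))) ∧
    -- empty initial condition
    (Even N →
      (HalfTASEP.transProb α t ∅ (HalfTASEP.ofCoords x) : ℂ) =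
        (-1) ^ (N.choose 2) * Complex.exp (-(α * t)) *
          HalfTASEP.pfaffian (HalfTASEP.Qmat α t R₁ R₂ x)) ∧
    (Odd N →
      (HalfTASEP.transProb α t ∅ (HalfTASEP.ofCoords x) : ℂ) =
        (-1) ^ (N.choose 2) * Complex.exp (-(α * t)) *
          HalfTASEP.pfaffian (HalfTASEP.blockBorder (HalfTASEP.Qmat α t R₁ R₂ x)
            (HalfTASEP.pvec α t R₁ x))) := by
  rw [← abs_of_nonneg hα] at hR₁ hR₂
  refine ⟨HalfTASEP.Qmat_transpose hR₁ hR₂ hR t x, ?_⟩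
  obtain ⟨ρ, hQ, hp⟩ := HalfTASEP.exists_contourRadii hR₁ hR₂ hR t x
  have hempty := HalfTASEP.transProb_ofCoords ρ t (y := Fin.elim0) hx (fun i => i.elim0) N.zero_le
    fun h => absurd h (lt_irrefl 0)
  rw [show HalfTASEP.ofCoords (Fin.elim0 : Fin 0 → ℕ+) = ∅ from rfl] at hempty
  rw [hQ, hp]
  refine ⟨fun M y hM hy hyM => ⟨fun hpar => ?_, fun hpar => ?_⟩, fun hpar => ?_, fun hpar => ?_⟩
  · rw [HalfTASEP.transProb_ofCoords ρ t hx hy hM hyM,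
      HalfTASEP.pfaffian_blockEven ρ hr t hM hpar]
  · rw [HalfTASEP.transProb_ofCoords ρ t hx hy hM hyM,
      HalfTASEP.pfaffian_blockOdd ρ hr t hM hpar]
  · rw [hempty, HalfTASEP.pfaffian_Qmat ρ t hpar]
  · rw [hempty, HalfTASEP.pfaffian_blockBorder ρ t hpar]
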